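/- Let $q\ge 1$ and $a$ be coprime integers. Put \[ \mathscr{L}(s;q,a)=\sum_{\chi \bmod q}\overline{\chi}(a)\,\frac{L'}{L}(s,\chi), \] where $\chi$ runs over the Dirichlet characters modulo $q$ and $L(s,\chi)$ is the (analytically continued) Dirichlet $L$-function of $\chi$. The hypothesis $\mathrm{SH}_{q,a}$ states that all singularities of $\mathscr{L}(s;q,a)$ in the critical strip $0<\Re(s)<1$ lie on the line $\Re(s)=1/2$. Let $\Theta=\Theta(q,a)$ be the supremum of the real parts of the singularities of $\mathscr{L}(s;q,a)$ in $0<\Re(s)<1$. With $p$ denoting primes, let $\theta(x;q,a)=\sum_{p\le x,\ p\equiv a\,(q)}\log p$ and \[ f(x;q,a)=\frac{\bigl(\log(\varphi(q)\,\theta(x;q,a))\bigr)^{1/\varphi(q)}}{C(q,a)}\prod_{\substack{p\le x\\ p\equiv a\,(q)}}\Bigl(1-\frac1p\Bigr), \] where $\varphi$ is Euler's totient function and $C(q,a)>0$ is defined by $C(q,a)^{\varphi(q)}=e^{-\gamma}\prod_p(1-1/p)^{\alpha(p;q,a)}$, in which $\gamma$ is the Euler--Mascheroni constant, the product runs over all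 primes in increasing order, and $\alpha(p;q,a)=\varphi(q)-1$ if $p\equiv a\pmod q$ and $\alpha(p;q,a)=-1$ otherwise. Write $F(x)=\Omega_{\pm}(G(x))$ if there are a constant $c>0$ and an increasing real sequence tending to infinity along which $F(x)>cG(x)$, and also a constant $c'>0$ and an increasing real sequence tending to infinity along which $F(x)<-c'G(x)$. (a) Suppose that $\mathrm{SH}_{q,a}$ is false, let $1-\Theta<b<\tfrac12$, and assume that $\mathscr{L}(s;q,a)$ has no singularities on the real segment $(1-b,1)$. Then \[\log f(x;q,a)=\Omega_{\pm}(x^{-b})\quad\text{as } x\to\infty .\] (b) Suppose that $a$ is not a square modulo $q$, that $\mathrm{SH}_{q,a}$ is true, and that $\mathscr{L}(s;q,a)$ has a singularity on the line $\Re(s)=1/2$ but no singularity at $s=1/2$. Then, for every $b$ with $\tfrac12<b<\tfrac23$, \[\log f(x;q,a)=\Omega_{\pm}(x^{-b})\quad\text{as } x\to\infty .\] -/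

import Mathlib

open Filter Topology

noncomputable section

namespace PrimesAP

/-- The point `s` is a singularity of `F`: no function analytic at `s` agrees with `F` on a
punctured neighbourhood of `s`. (The value that `F` itself takes at `s` plays no role.) -/
def IsSingularity (F : ℂ → ℂ) (s : ℂ) : Prop :=
  ¬ ∃ g : ℂ → ℂ, AnalyticAt ℂ g s ∧ F =ᶠ[𝓝[≠] s] g

/-- `𝓛(s;q,a) = ∑_{χ mod q} conj(χ(a)) (L'/L)(s,χ)`. -/
def scriptL (q : ℕ) [NeZero q] (a : ℤ) (s : ℂ) : ℂ :=
  ∑ χ : DirichletCharacter ℂ q,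
    starRingEnd ℂ (χ (a : ZMod q)) *
      (deriv (DirichletCharacter.LFunction χ) s / DirichletCharacter.LFunction χ s)

/-- The set of singularities of `𝓛(s;q,a)` in the critical strip `0 < Re s < 1`. -/
def stripSingularities (q : ℕ) [NeZero q] (a : ℤ) : Set ℂ :=
  {ρ | 0 < ρ.re ∧ ρ.re < 1 ∧ IsSingularity (scriptL q a) ρ}

/-- The Singularity Hypothesis: all singularities of `𝓛(s;q,a)` in the critical strip lie on
the line `Re s = 1/2`. -/
def SingularityHypothesis (q : ℕ) [NeZero q] (a : ℤ) : Prop :=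
  ∀ ρ ∈ stripSingularities q a, ρ.re = 1 / 2

/-- `Θ(q,a)`, the supremum of the real parts of the singularities of `𝓛(s;q,a)` in the critical
strip. The set is bounded above by `1`; it is nonempty whenever the Singularity Hypothesis
fails. -/
def bigTheta (q : ℕ) [NeZero q] (a : ℤ) : ℝ :=
  sSup (Complex.re '' stripSingularities q a)

/-- The primes `p ≤ x` with `p ≡ a (mod q)`. -/
def primesUpTo (q : ℕ) (a : ℤ) (x : ℝ) : Finset ℕ :=
  (Finset.Ioc 0 ⌊x⌋₊).filter fun p => p.Prime ∧ (p : ZMod q) = (a : ZMod q)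

/-- `θ(x;q,a) = ∑_{p ≤ x, p ≡ a (mod q)} log p`. -/
def thetaAP (q : ℕ) (a : ℤ) (x : ℝ) : ℝ :=
  ∑ p ∈ primesUpTo q a x, Real.log p

/-- The exponent `α(p;q,a)`: it is `φ(q) - 1` if `p ≡ a (mod q)`, and `-1` otherwise. -/
def mertensExponent (q : ℕ) (a : ℤ) (p : ℕ) : ℤ :=
  if (p : ZMod q) = (a : ZMod q) then (q.totient : ℤ) - 1 else -1

/-- The partial product `∏_{p ≤ n} (1 - 1/p)^{α(p;q,a)}` over the primes up to `n`. -/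
def mertensPartialProduct (q : ℕ) (a : ℤ) (n : ℕ) : ℝ :=
  ∏ p ∈ (Finset.Ioc 0 n).filter Nat.Prime, (1 - 1 / (p : ℝ)) ^ mertensExponent q a p

/-- The positive constant `C(q,a)` in Mertens' theorem for arithmetic progressions, defined by
`C(q,a)^φ(q) = e^{-γ} ∏_p (1 - 1/p)^{α(p;q,a)}`. The infinite product converges only
conditionally, so it is taken over the primes in increasing order. -/
def mertensConstant (q : ℕ) (a : ℤ) : ℝ :=
  (Real.exp (-Real.eulerMascheroniConstant) *
    limUnder atTop (mertensPartialProduct q a)) ^ (1 / (q.totient : ℝ))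

/-- `f(x;q,a) = (log(φ(q) θ(x;q,a)))^{1/φ(q)} / C(q,a) * ∏_{p ≤ x, p ≡ a (mod q)} (1 - 1/p)`. -/
def nicolasF (q : ℕ) (a : ℤ) (x : ℝ) : ℝ :=
  Real.log (q.totient * thetaAP q a x) ^ (1 / (q.totient : ℝ)) / mertensConstant q a *
    ∏ p ∈ primesUpTo q a x, (1 - 1 / (p : ℝ))

/-- `F(x) = Ω₊(G(x))` as `x → ∞`. -/
def OmegaPlus (F G : ℝ → ℝ) : Prop :=
  ∃ c : ℝ, 0 < c ∧ ∃ u : ℕ → ℝ, StrictMono u ∧ Tendsto u atTop atTop ∧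
    ∀ n, F (u n) > c * G (u n)

/-- `F(x) = Ω₋(G(x))` as `x → ∞`. -/
def OmegaMinus (F G : ℝ → ℝ) : Prop :=
  ∃ c : ℝ, 0 < c ∧ ∃ u : ℕ → ℝ, StrictMono u ∧ Tendsto u atTop atTop ∧
    ∀ n, F (u n) < -c * G (u n)

/-- `F(x) = Ω_±(G(x))` as `x → ∞`. -/
def OmegaPlusMinus (F G : ℝ → ℝ) : Prop :=
  OmegaPlus F G ∧ OmegaMinus F G

end PrimesAP

end

/-! ### Landau's theorem and analytic continuation through derivatives -/

namespace PrimesAP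

open MeasureTheory ProbabilityTheory Set

/-! Put S(x) = φ(q)θ(x;q,a) − x, w(t) = −(1/(t log t))′ and K(x) = −∫_2^x S w. Partial summation and
the evaluation of C(q,a) give, with c₀ = lim K and 0 ≤ r = O(1/x), φ(q) log f = [log log(φ(q)θ) −
log log x − S/(x log x)] + (K − c₀) + r. So oscillation of log f reduces to oscillation of K − c₀,
whose Mellin transform is governed by 𝓛.

From log f to K: the bracket is ≤ 0 because log log is concave, so log f ≥ −x^{-b} bounds K − c₀
below by a multiple of −x^{-b}. If instead log f ≤ x^{-b}, the bracket is known to be ≥ −S/(x log x)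
only where S ≥ 0; a comparison argument (`exists_weightedAntideriv_le`) still yields an upper bound
of order x^{-b} for K − c₀ everywhere.

From K to singularities: the transform U(z) = ∫ S w t^z dt satisfies U″ = V + V′ with V(z) = ∫ S
t^{z-2} dt, and, with s = 1 − z, V is −(𝓛(s) + 1/(s−1))/s up to terms analytic in Re z < b. The
proper prime powers in the class enter through a Dirichlet series convergent for Re s > 1/2, or for
Re s > 1/3 if a is not a square; this limits b to 1/2 or 2/3. If K − c₀ has a one-sided bound of
order x^{-b} and V is regular on the real segment [0, b), Landau's theorem pushes the convergence up
to Re z < b (`exists_analyticAt_of_one_sided`). Then V has no pole there, so 𝓛 has no singularity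
with 1 − b < Re s < 1. In (a) and (b) the hypotheses supply such a singularity.

That K converges follows from a Karamata-type Tauberian theorem (`tendsto_of_tendsto_laplace`): U
continues to z = 0 because the L-functions, freed of their pole, do not vanish at 1. The factor
e^{-γ} comes from comparing a Laplace mean with ζ(1+δ) ~ 1/δ (`logMertens_one_limit`). -/

/-- **Landau's theorem** for the moment generating function of a nonnegative variable: if the
complex moment generating function continues analytically at the real point `τ`, then the
exponential moments exist beyond `τ`. -/
theorem exists_gt_integrable_of_analyticAt {Ω : Type*} [MeasurableSpace Ω] {μ : Measure Ω}
    {X : Ω → ℝ} (hXm : Measurable X) (hX : ∀ᵐ ω ∂μ, 0 ≤ X ω) {τ : ℝ}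
    (hτ : ∀ t < τ, Integrable (fun ω => Real.exp (t * X ω)) μ) {g : ℂ → ℂ}
    (hg : AnalyticAt ℂ g τ)
    (hgT : ∀ᶠ z in 𝓝 (τ : ℂ), z.re < τ → g z = complexMGF X μ z) :
    ∃ t > τ, Integrable (fun ω => Real.exp (t * X ω)) μ := by
  obtain ⟨δ, hδ, hball⟩ := Metric.eventually_nhds_iff_ball.1 (hgT.and hg.eventually_analyticAt)
  -- The centre c lies left of τ, where the moments exist, while c + d = τ + δ/8 lies beyond τ but
  -- inside the disc of radius δ/2 about c, on which g is analytic.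
  set c : ℝ := τ - δ / 4 with hc
  set d : ℝ := 3 * δ / 8 with hd
  have hint : ∀ t < τ, t ∈ interior (integrableExpSet X μ) := fun t ht =>
    mem_interior.2 ⟨Iio τ, fun s hs => hτ s hs, isOpen_Iio, ht⟩
  have hcτ : c < τ := by linarith
  have hsub : Metric.ball (c : ℂ) (δ / 2) ⊆ Metric.ball (τ : ℂ) δ := by
    apply Metric.ball_subset_ball'
    rw [Complex.dist_eq, ← Complex.ofReal_sub, Complex.norm_real, Real.norm_eq_abs,
      abs_of_nonpos (by linarith)]
    linarith
  have hdiff : DifferentiableOn ℂ g (Metric.ball (c : ℂ) (δ / 2)) := fun z hz =>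
    (hball z (hsub hz)).2.differentiableAt.differentiableWithinAt
  have hz : ((c + d : ℝ) : ℂ) ∈ Metric.ball (c : ℂ) (δ / 2) := by
    rw [Metric.mem_ball, Complex.dist_eq, ← Complex.ofReal_sub, Complex.norm_real,
      Real.norm_eq_abs, abs_of_nonneg (by linarith)]
    linarith
  have hsum := Complex.hasSum_taylorSeries_on_ball hdiff hz
  have hder : ∀ n, iteratedDeriv n g c =
      ((∫ ω, X ω ^ n * Real.exp (c * X ω) ∂μ : ℝ) : ℂ) := by
    intro n
    have hev : g =ᶠ[𝓝 (c : ℂ)] complexMGF X μ := by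
      have h1 : ∀ᶠ z in 𝓝 (c : ℂ), z ∈ Metric.ball (c : ℂ) (δ / 2) :=
        Metric.ball_mem_nhds _ (by linarith)
      have h2 : ∀ᶠ z : ℂ in 𝓝 (c : ℂ), z.re < τ :=
        (isOpen_Iio.preimage Complex.continuous_re).mem_nhds (by simpa using hcτ)
      filter_upwards [h1, h2] with z hz1 hz2 using (hball z (hsub hz1)).1 hz2
    rw [hev.iteratedDeriv_eq, iteratedDeriv_complexMGF (by simpa using hint c hcτ),
      ← integral_complex_ofReal]
    congr 1
    ext ω
    push_cast
    rfl
  have hF0 : ∀ n, 0 ≤ᵐ[μ] fun ω => ((n.factorial : ℝ)⁻¹ * d ^ n) *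
      (X ω ^ n * Real.exp (c * X ω)) := fun n => by
    filter_upwards [hX] with ω hω
    positivity
  have hFi : ∀ n, Integrable (fun ω => ((n.factorial : ℝ)⁻¹ * d ^ n) *
      (X ω ^ n * Real.exp (c * X ω))) μ := fun n =>
    (integrable_pow_mul_exp_of_mem_interior_integrableExpSet (hint c hcτ) n).const_mul _
  have hsummable : Summable fun n : ℕ => ∫ ω, ((n.factorial : ℝ)⁻¹ * d ^ n) *
      (X ω ^ n * Real.exp (c * X ω)) ∂μ := by
    refine Complex.summable_ofReal.1 (hsum.summable.congr fun n => ?_)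
    rw [hder, integral_const_mul]
    push_cast
    simp only [add_sub_cancel_left, smul_eq_mul]
    ring
  refine ⟨c + d, by rw [hc, hd]; linarith, ?_⟩
  refine ⟨by fun_prop, ?_⟩
  rw [hasFiniteIntegral_iff_ofReal (Eventually.of_forall fun ω => (Real.exp_pos _).le)]
  -- Expanding e^{dX} gives nonnegative terms, so Tonelli identifies the moment at c + d with the
  -- Taylor series of g about c, which converges there.
  have heq : ∀ᵐ ω ∂μ, ENNReal.ofReal (Real.exp ((c + d) * X ω)) =
      ∑' n : ℕ, ENNReal.ofReal (((n.factorial : ℝ)⁻¹ * d ^ n) *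
        (X ω ^ n * Real.exp (c * X ω))) := by
    filter_upwards [hX] with ω hω
    have hs : HasSum (fun n : ℕ => ((n.factorial : ℝ)⁻¹ * d ^ n) *
        (X ω ^ n * Real.exp (c * X ω))) (Real.exp ((c + d) * X ω)) := by
      have h1 := (NormedSpace.expSeries_div_hasSum_exp (d * X ω)).mul_right (Real.exp (c * X ω))
      rw [← Real.exp_eq_exp_ℝ, ← Real.exp_add] at h1
      rw [← add_mul, add_comm d c] at h1
      have h2 : ∀ n : ℕ, ((n.factorial : ℝ)⁻¹ * d ^ n) * (X ω ^ n * Real.exp (c * X ω)) =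
          (d * X ω) ^ n / n.factorial * Real.exp (c * X ω) := fun n => by
        rw [mul_pow]
        ring
      simpa only [h2] using h1
    rw [← hs.tsum_eq, ENNReal.ofReal_tsum_of_nonneg (fun n => by positivity) hs.summable]
  rw [lintegral_congr_ae heq, lintegral_tsum fun n => (hFi n).1.aemeasurable.ennreal_ofReal]
  have : ∀ n : ℕ, ∫⁻ ω, ENNReal.ofReal (((n.factorial : ℝ)⁻¹ * d ^ n) *
      (X ω ^ n * Real.exp (c * X ω))) ∂μ = ENNReal.ofReal (∫ ω, ((n.factorial : ℝ)⁻¹ * d ^ n) *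
      (X ω ^ n * Real.exp (c * X ω)) ∂μ) := fun n =>
    (ofReal_integral_eq_lintegral_ofReal (hFi n) (hF0 n)).symm
  simp_rw [this]
  rw [← ENNReal.ofReal_tsum_of_nonneg (fun n => integral_nonneg_of_ae (hF0 n)) hsummable]
  exact ENNReal.ofReal_lt_top

theorem isPreconnected_ball_inter_re_lt (c : ℂ) (r τ : ℝ) :
    IsPreconnected (Metric.ball c r ∩ {z : ℂ | z.re < τ}) :=
  ((convex_ball c r).inter (convex_halfSpace_re_lt τ)).isPreconnected

theorem isOpen_re_lt (τ : ℝ) : IsOpen {z : ℂ | z.re < τ} :=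
  isOpen_Iio.preimage Complex.continuous_re

/-- If the second derivative of `U` on a half plane continues analytically at a boundary point,
so does `U`. -/
theorem exists_continuation_of_second_deriv {τ : ℝ} {U U' h g : ℂ → ℂ}
    (hU : ∀ z : ℂ, z.re < τ → HasDerivAt U (U' z) z)
    (hU' : ∀ z : ℂ, z.re < τ → HasDerivAt U' (h z) z) (hg : AnalyticAt ℂ g τ)
    (hgh : ∀ᶠ z in 𝓝 (τ : ℂ), z.re < τ → h z = g z) :
    ∃ u : ℂ → ℂ, AnalyticAt ℂ u τ ∧ ∀ᶠ z in 𝓝 (τ : ℂ), z.re < τ → u z = U z := by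
  obtain ⟨r, hr, hball⟩ := Metric.eventually_nhds_iff_ball.1 (hgh.and hg.eventually_analyticAt)
  have hdg : DifferentiableOn ℂ g (Metric.ball (τ : ℂ) r) := fun z hz =>
    (hball z hz).2.differentiableAt.differentiableWithinAt
  obtain ⟨G₁, hG₁⟩ := hdg.isExactOn_ball
  have hdG₁ : DifferentiableOn ℂ G₁ (Metric.ball (τ : ℂ) r) := fun z hz =>
    (hG₁ z hz).differentiableAt.differentiableWithinAt
  obtain ⟨G₀, hG₀⟩ := hdG₁.isExactOn_ball
  have hdG₀ : DifferentiableOn ℂ G₀ (Metric.ball (τ : ℂ) r) := fun z hz =>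
    (hG₀ z hz).differentiableAt.differentiableWithinAt
  set D := Metric.ball (τ : ℂ) r ∩ {z : ℂ | z.re < τ}
  have hDo : IsOpen D := Metric.isOpen_ball.inter (isOpen_re_lt τ)
  have hDc : IsPreconnected D := isPreconnected_ball_inter_re_lt _ _ _
  -- G₀ is a double primitive of g on the disc. On the connected half disc D it differs from U by an
  -- affine function.
  have h1 : ∀ z ∈ D, HasDerivAt (fun z => U' z - G₁ z) 0 z := fun z hz => by
    have := (hU' z hz.2).sub (hG₁ z hz.1)
    rwa [(hball z hz.1).1 hz.2, sub_self] at this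
  obtain ⟨β, hβ⟩ := hDo.exists_is_const_of_deriv_eq_zero hDc
    (fun z hz => (h1 z hz).differentiableAt.differentiableWithinAt) (fun z hz => (h1 z hz).deriv)
  have h2 : ∀ z ∈ D, HasDerivAt (fun z => U z - G₀ z - β * z) 0 z := fun z hz => by
    have := ((hU z hz.2).sub (hG₀ z hz.1)).sub ((hasDerivAt_id z).const_mul β)
    have e : U' z - G₁ z - β * 1 = 0 := by rw [hβ z hz]; ring
    rwa [e] at this
  obtain ⟨α, hα⟩ := hDo.exists_is_const_of_deriv_eq_zero hDc
    (fun z hz => (h2 z hz).differentiableAt.differentiableWithinAt) (fun z hz => (h2 z hz).deriv)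
  refine ⟨fun z => G₀ z + β * z + α, ?_, ?_⟩
  · have := hdG₀.analyticAt (Metric.ball_mem_nhds _ hr)
    fun_prop
  · filter_upwards [Metric.ball_mem_nhds (τ : ℂ) hr] with z hz hzτ
    linear_combination -(hα z ⟨hz, hzτ⟩)

/-- A pole of a quotient `Y / P` is visible in its logarithmic-type derivative `W + W'`: if
`W + W'` continues analytically, then so does `W = Y / P`. -/
theorem exists_analyticAt_quotient {P Y h : ℂ → ℂ} {ρ : ℂ} (hP : AnalyticAt ℂ P ρ)
    (hY : AnalyticAt ℂ Y ρ) (hh : AnalyticAt ℂ h ρ) (hP0 : ∀ᶠ z in 𝓝[≠] ρ, P z ≠ 0)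
    (hrel : ∀ᶠ z in 𝓝 ρ, P z ^ 2 * h z = Y z * P z + deriv Y z * P z - Y z * deriv P z) :
    ∃ g, AnalyticAt ℂ g ρ ∧ ∀ᶠ z in 𝓝 ρ, P z * g z = Y z := by
  rw [eventually_nhdsWithin_iff] at hP0
  obtain ⟨r, hr, hball⟩ := Metric.eventually_nhds_iff_ball.1
    ((hP0.and hrel).and (hh.eventually_analyticAt.and
      (hP.eventually_analyticAt.and hY.eventually_analyticAt)))
  -- With W = Y/P, W + W′ = h reads (e^z W)′ = e^z h, and a primitive G of the right side exists on
  -- the whole disc, pole of W or not.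
  have hdh : DifferentiableOn ℂ (fun z => Complex.exp z * h z) (Metric.ball ρ r) := fun z hz =>
    (Complex.differentiable_exp.differentiableAt.mul
      (hball z hz).2.1.differentiableAt).differentiableWithinAt
  obtain ⟨G, hG⟩ := hdh.isExactOn_ball
  have hdG : DifferentiableOn ℂ G (Metric.ball ρ r) := fun z hz =>
    (hG z hz).differentiableAt.differentiableWithinAt
  -- The ball of radius r/2 about z₁ just misses ρ. There e^z W − G is constant; clearing P lets the
  -- identity theorem carry this across ρ.
  set z₁ : ℂ := ρ + (r / 2 : ℝ)
  have hz₁ : dist z₁ ρ = r / 2 := by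
    simp only [z₁, dist_self_add_left, Complex.norm_real, Real.norm_eq_abs]
    exact abs_of_pos (by linarith)
  have hsub : Metric.ball z₁ (r / 2) ⊆ Metric.ball ρ r :=
    Metric.ball_subset_ball' (by linarith)
  have hne : ∀ z ∈ Metric.ball z₁ (r / 2), z ≠ ρ := by
    rintro z hz rfl
    rw [Metric.mem_ball, dist_comm] at hz
    linarith
  have hconst : ∀ z ∈ Metric.ball z₁ (r / 2),
      HasDerivAt (fun z => Complex.exp z * (Y z / P z) - G z) 0 z := fun z hz => by
    have hz' := hball z (hsub hz)
    have hPz : P z ≠ 0 := hz'.1.1 (hne z hz)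
    have h1 := ((Complex.hasDerivAt_exp z).mul (hz'.2.2.2.differentiableAt.hasDerivAt.div
      hz'.2.2.1.differentiableAt.hasDerivAt hPz)).sub (hG z (hsub hz))
    have e : Complex.exp z * (Y z / P z) + Complex.exp z * ((deriv Y z * P z - Y z * deriv P z) /
        P z ^ 2) - Complex.exp z * h z = 0 := by
      have := hz'.1.2
      field_simp
      linear_combination (-Complex.exp z) * this
    simp only [Pi.div_apply] at h1
    rw [e] at h1
    exact h1
  obtain ⟨α, hα⟩ := Metric.isOpen_ball.exists_is_const_of_deriv_eq_zero
    (convex_ball z₁ (r / 2)).isPreconnected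
    (fun z hz => (hconst z hz).differentiableAt.differentiableWithinAt)
    (fun z hz => (hconst z hz).deriv)
  have hEq : EqOn (fun z => Complex.exp z * Y z) (fun z => P z * (G z + α)) (Metric.ball ρ r) := by
    refine AnalyticOnNhd.eqOn_of_preconnected_of_eventuallyEq (𝕜 := ℂ)
      (fun z hz => ?_) (fun z hz => ?_) (convex_ball ρ r).isPreconnected
      (hsub (Metric.mem_ball_self (half_pos hr))) ?_
    · have := (hball z hz).2.2.2
      fun_prop
    · have h1 := (hball z hz).2.2.1
      have h2 := hdG.analyticAt (Metric.isOpen_ball.mem_nhds hz)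
      fun_prop
    · filter_upwards [Metric.ball_mem_nhds z₁ (half_pos hr)] with z hz
      have hPz : P z ≠ 0 := (hball z (hsub hz)).1.1 (hne z hz)
      have := hα z hz
      field_simp at this
      linear_combination this
  refine ⟨fun z => Complex.exp (-z) * (G z + α), ?_, ?_⟩
  · have := hdG.analyticAt (Metric.ball_mem_nhds ρ hr)
    fun_prop
  · filter_upwards [Metric.ball_mem_nhds ρ hr] with z hz
    have := hEq hz
    simp only at this
    rw [mul_left_comm, ← this, ← mul_assoc, ← Complex.exp_add]
    simp

end PrimesAP

/-! ### Mellin transforms over a half line -/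

namespace PrimesAP

open MeasureTheory ProbabilityTheory Set Asymptotics

/-- The tail `∫_{x₀}^∞ f(t) t^{z-1} dt` of the Mellin transform. -/
noncomputable def tailMellin (f : ℝ → ℝ) (x₀ : ℝ) (z : ℂ) : ℂ :=
  ∫ t in Ioi x₀, (t : ℂ) ^ (z - 1) * (f t : ℂ)

/-- `f` grows at most logarithmically on `(x₀, ∞)`. -/
def LogBounded (f : ℝ → ℝ) (x₀ : ℝ) : Prop :=
  ∃ B, ∀ t > x₀, |f t| ≤ B * (1 + Real.log t)

section TailMellin

variable {f : ℝ → ℝ} {x₀ : ℝ}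

theorem LogBounded.of_bounded {B : ℝ} (hx₀ : 1 ≤ x₀) (h : ∀ t > x₀, |f t| ≤ B) :
    LogBounded f x₀ :=
  ⟨B, fun t ht => (h t ht).trans (le_mul_of_one_le_right ((abs_nonneg _).trans (h t ht))
    (by linarith [Real.log_nonneg (hx₀.trans ht.le)]))⟩

theorem tailMellin_eq_mellin (hx₀ : 0 ≤ x₀) (f : ℝ → ℝ) (z : ℂ) :
    tailMellin f x₀ z = mellin (fun t => (((Ioi x₀).indicator f t : ℝ) : ℂ)) z := by
  rw [tailMellin, mellin, ← integral_indicator measurableSet_Ioi,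
    ← integral_indicator measurableSet_Ioi]
  congr 1
  ext t
  by_cases ht : x₀ < t
  · simp [indicator, ht, hx₀.trans_lt ht]
  · simp [indicator, ht]

theorem mellinConvergent_indicator_iff (hx₀ : 0 ≤ x₀) (f : ℝ → ℝ) (z : ℂ) :
    MellinConvergent (fun t => (((Ioi x₀).indicator f t : ℝ) : ℂ)) z ↔
      IntegrableOn (fun t : ℝ => (t : ℂ) ^ (z - 1) * (f t : ℂ)) (Ioi x₀) := by
  rw [MellinConvergent, ← integrable_indicator_iff measurableSet_Ioi,
    ← integrable_indicator_iff measurableSet_Ioi]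
  apply iff_of_eq
  congr 1
  ext t
  by_cases ht : x₀ < t
  · simp [indicator, ht, hx₀.trans_lt ht]
  · simp [indicator, ht]

/-- The logarithm costs only t^ε, so the transform exists in all of Re z < 0. The exponent keeps the
form −a, with a = −ε, that the Mellin lemmas expect. -/
theorem LogBounded.isBigO (hf : LogBounded f x₀) {ε : ℝ} (hε : 0 < ε) :
    (fun t => (((Ioi x₀).indicator f t : ℝ) : ℂ)) =O[atTop] (fun t : ℝ => t ^ (-(-ε))) := by
  obtain ⟨B, hB⟩ := hf
  have h1 : (fun t => (((Ioi x₀).indicator f t : ℝ) : ℂ)) =O[atTop]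
      (fun t => 1 + Real.log t) := by
    refine IsBigO.of_bound |B| ?_
    filter_upwards [eventually_gt_atTop x₀] with t ht
    have e : (Ioi x₀).indicator f t = f t := indicator_of_mem ht f
    rw [e, Complex.norm_real, Real.norm_eq_abs, Real.norm_eq_abs, ← abs_mul]
    exact (hB t ht).trans (le_abs_self _)
  rw [neg_neg]
  refine h1.trans (IsBigO.add ?_ (isLittleO_log_rpow_atTop hε).isBigO)
  refine IsBigO.of_bound 1 ?_
  filter_upwards [eventually_ge_atTop 1] with t ht
  have := Real.one_le_rpow ht hε.le
  rw [norm_one, one_mul, Real.norm_eq_abs]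
  exact this.trans (le_abs_self _)

/-- The function vanishes near 0, so the Mellin strip has no left edge. -/
theorem isBigO_zero_indicator (hx₀ : 0 < x₀) (f : ℝ → ℝ) (b : ℝ) :
    (fun t => (((Ioi x₀).indicator f t : ℝ) : ℂ)) =O[𝓝[>] 0] (fun t : ℝ => t ^ (-b)) := by
  refine IsBigO.of_bound 0 ?_
  filter_upwards [nhdsWithin_le_nhds (Iio_mem_nhds hx₀)] with t ht
  simp [indicator, not_lt.2 (le_of_lt (mem_Iio.1 ht))]

theorem LogBounded.locallyIntegrableOn (hfm : Measurable f)
    (hf : LogBounded f x₀) :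
    LocallyIntegrableOn (fun t => (((Ioi x₀).indicator f t : ℝ) : ℂ)) (Ioi 0) := by
  obtain ⟨B, hB⟩ := hf
  have hc : LocallyIntegrableOn (fun t => B * (1 + Real.log t)) (Ioi 0) := by
    refine ContinuousOn.locallyIntegrableOn ?_ measurableSet_Ioi
    exact continuousOn_const.mul (continuousOn_const.add
      (Real.continuousOn_log.mono fun t ht => (ne_of_gt ht)))
  intro x hx
  obtain ⟨u, hu, hui⟩ := hc x hx
  refine ⟨u, hu, ?_⟩
  refine hui.norm.mono' (Complex.measurable_ofReal.comp
    (hfm.indicator measurableSet_Ioi)).aestronglyMeasurable ?_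
  refine Eventually.of_forall fun t => ?_
  rw [Complex.norm_real, Real.norm_eq_abs, Real.norm_eq_abs]
  by_cases ht : x₀ < t
  · rw [indicator_of_mem (show t ∈ Ioi x₀ from ht)]
    exact (hB t ht).trans (le_abs_self _)
  · rw [indicator_of_notMem (show t ∉ Ioi x₀ from ht), abs_zero]
    exact abs_nonneg _

theorem LogBounded.tailMellin_hasDerivAt (hx₀ : 0 < x₀) (hfm : Measurable f)
    (hf : LogBounded f x₀) {z : ℂ} (hz : z.re < 0) :
    HasDerivAt (tailMellin f x₀) (tailMellin (fun t => Real.log t * f t) x₀ z) z := by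
  have h := (mellin_hasDerivAt_of_isBigO_rpow (s := z) (hf.locallyIntegrableOn hfm)
    (hf.isBigO (ε := -z.re / 2) (by linarith)) (by linarith)
    (isBigO_zero_indicator hx₀ f (z.re - 1)) (by linarith)).2
  have e1 : tailMellin f x₀ = mellin (fun t => (((Ioi x₀).indicator f t : ℝ) : ℂ)) :=
    funext fun z => tailMellin_eq_mellin hx₀.le f z
  have e2 : (fun t => (((Ioi x₀).indicator (fun t => Real.log t * f t) t : ℝ) : ℂ)) =
      fun t => Real.log t • (((Ioi x₀).indicator f t : ℝ) : ℂ) := by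
    ext t
    by_cases ht : x₀ < t <;> simp [indicator, ht]
  rw [e1, tailMellin_eq_mellin hx₀.le, e2]
  exact h

theorem LogBounded.integrableOn (hx₀ : 0 < x₀) (hfm : Measurable f)
    (hf : LogBounded f x₀) {z : ℂ} (hz : z.re < 0) :
    IntegrableOn (fun t : ℝ => (t : ℂ) ^ (z - 1) * (f t : ℂ)) (Ioi x₀) := by
  rw [← mellinConvergent_indicator_iff hx₀.le]
  exact mellinConvergent_of_isBigO_rpow (s := z) (hf.locallyIntegrableOn hfm)
    (hf.isBigO (ε := -z.re / 2) (by linarith)) (by linarith)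
    (isBigO_zero_indicator hx₀ f (z.re - 1)) (by linarith)

/-- The right side provides the continuation of the comparison term c t^{-b}, regular throughout Re
z < b. -/
theorem tailMellin_rpow (hx₀ : 0 < x₀) {b : ℝ} {z : ℂ} (hz : z.re < b) :
    tailMellin (fun t => t ^ (-b)) x₀ z = -(x₀ : ℂ) ^ (z - b) / (z - b) := by
  have h := integral_Ioi_cpow_of_lt (a := z - b - 1) (by simpa using by linarith) hx₀
  rw [sub_add_cancel] at h
  rw [tailMellin, ← h]
  refine setIntegral_congr_fun measurableSet_Ioi fun t ht => ?_
  have ht0 : (0 : ℝ) < t := hx₀.trans ht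
  rw [Complex.ofReal_cpow ht0.le, ← Complex.cpow_add _ _ (Complex.ofReal_ne_zero.2 ht0.ne')]
  congr 1
  push_cast
  ring

theorem integrableOn_rpow_tail (hx₀ : 0 < x₀) {b : ℝ} {z : ℂ} (hz : z.re < b) :
    IntegrableOn (fun t : ℝ => (t : ℂ) ^ (z - 1) * ((t ^ (-b) : ℝ) : ℂ)) (Ioi x₀) := by
  refine (integrableOn_Ioi_cpow_of_lt (a := z - b - 1) (by simpa using by linarith) hx₀).congr_fun
    (fun t ht => ?_) measurableSet_Ioi
  have ht0 : (0 : ℝ) < t := hx₀.trans ht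
  simp only
  rw [Complex.ofReal_cpow ht0.le, ← Complex.cpow_add _ _ (Complex.ofReal_ne_zero.2 ht0.ne')]
  congr 1
  push_cast
  ring

/-- The measure `A(t) dt / t` on `(x₀, ∞)`, whose moment generating function with respect to `log`
is the tail Mellin transform of `A`. -/
noncomputable def tailMeasure (A : ℝ → ℝ) (x₀ : ℝ) : Measure ℝ :=
  (volume.restrict (Ioi x₀)).withDensity fun t => ENNReal.ofReal (A t / t)

theorem complexMGF_tailMeasure {A : ℝ → ℝ} (hAm : Measurable A) (hx₀ : 0 < x₀)
    (hA : ∀ t > x₀, 0 ≤ A t) (z : ℂ) :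
    complexMGF Real.log (tailMeasure A x₀) z = tailMellin A x₀ z := by
  rw [complexMGF, tailMeasure, integral_withDensity_eq_integral_toReal_smul
    (by fun_prop) (Eventually.of_forall fun _ => ENNReal.ofReal_lt_top), tailMellin]
  refine setIntegral_congr_fun measurableSet_Ioi fun t ht => ?_
  have ht0 : (0 : ℝ) < t := hx₀.trans ht
  have ht0' : (t : ℂ) ≠ 0 := Complex.ofReal_ne_zero.2 ht0.ne'
  rw [ENNReal.toReal_ofReal (div_nonneg (hA t ht) ht0.le), Complex.cpow_sub _ _ ht0',
    Complex.cpow_one, Complex.cpow_def_of_ne_zero ht0', ← Complex.ofReal_log ht0.le,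
    Complex.real_smul]
  push_cast
  rw [mul_comm z]
  ring

theorem integrable_tailMeasure_iff {A : ℝ → ℝ} (hAm : Measurable A) (hx₀ : 0 < x₀)
    (hA : ∀ t > x₀, 0 ≤ A t) (τ : ℝ) :
    Integrable (fun t => Real.exp (τ * Real.log t)) (tailMeasure A x₀) ↔
      IntegrableOn (fun t : ℝ => (t : ℂ) ^ ((τ : ℂ) - 1) * (A t : ℂ)) (Ioi x₀) := by
  rw [tailMeasure, integrable_withDensity_iff_integrable_smul'
    (by fun_prop) (Eventually.of_forall fun _ => ENNReal.ofReal_lt_top)]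
  refine Iff.trans ⟨fun h => h.ofReal (𝕜 := ℂ), fun h => h.re⟩
    (integrable_congr ?_)
  filter_upwards [self_mem_ae_restrict measurableSet_Ioi] with t ht
  have ht0 : (0 : ℝ) < t := hx₀.trans ht
  have ht0' : (t : ℂ) ≠ 0 := Complex.ofReal_ne_zero.2 ht0.ne'
  rw [ENNReal.toReal_ofReal (div_nonneg (hA t ht) ht0.le), Complex.cpow_sub _ _ ht0',
    Complex.cpow_one, Complex.cpow_def_of_ne_zero ht0', ← Complex.ofReal_log ht0.le, smul_eq_mul]
  change ((A t / t * Real.exp (τ * Real.log t) : ℝ) : ℂ) = _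
  rw [mul_comm (Real.log t : ℂ), Complex.ofReal_mul, Complex.ofReal_exp, Complex.ofReal_mul,
    Complex.ofReal_div]
  ring

end TailMellin

/-! ### The logarithmic weight and the transform U -/

section Weight

/-- The weight `(1 + log t) / (t log t)²`, minus the derivative of `1 / (t log t)`. -/
noncomputable def logWeight (t : ℝ) : ℝ := (1 + Real.log t) / (t * Real.log t) ^ 2

theorem measurable_logWeight : Measurable logWeight := by
  unfold logWeight
  fun_prop

theorem half_le_log {t : ℝ} (ht : 2 ≤ t) : 1 / 2 ≤ Real.log t :=
  (by linarith [Real.log_two_gt_d9] : 1 / 2 ≤ Real.log 2).trans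
    (Real.log_le_log (by norm_num) ht)

theorem logWeight_nonneg {t : ℝ} (ht : 2 ≤ t) : 0 ≤ logWeight t := by
  have := half_le_log ht
  unfold logWeight
  positivity

theorem logWeight_pos {t : ℝ} (ht : 2 ≤ t) : 0 < logWeight t := by
  have := half_le_log ht
  unfold logWeight
  positivity

theorem logWeight_le {t : ℝ} (ht : 2 ≤ t) : logWeight t ≤ 3 / (t ^ 2 * Real.log t) := by
  have := half_le_log ht
  unfold logWeight
  rw [div_le_div_iff₀ (by positivity) (by positivity)]
  -- After clearing denominators the claim is 1 ≤ 2 log t.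
  have h : 0 ≤ t ^ 2 * Real.log t * (2 * Real.log t - 1) := by
    have : 0 ≤ 2 * Real.log t - 1 := by linarith
    positivity
  nlinarith

variable {S : ℝ → ℝ} {C : ℝ}

theorem abs_mul_logWeight_le {t : ℝ} (hS : |S t| ≤ C * t) (ht : 2 ≤ t) :
    |S t * logWeight t| ≤ 3 * C / (t * Real.log t) := by
  have h1 := half_le_log ht
  rw [abs_mul, abs_of_nonneg (logWeight_nonneg ht)]
  calc |S t| * logWeight t ≤ (C * t) * (3 / (t ^ 2 * Real.log t)) :=
        mul_le_mul hS (logWeight_le ht) (logWeight_nonneg ht) ((abs_nonneg _).trans hS)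
    _ = 3 * C / (t * Real.log t) := by field_simp

theorem measurable_mul_logWeight (hSm : Measurable S) :
    Measurable fun t => t * (S t * logWeight t) :=
  measurable_id.mul (hSm.mul measurable_logWeight)

/-- The weight has size 1/(t² log t), so under a Chebyshev bound on S the factor log t from one
differentiation of U still leaves a bounded integrand. -/
theorem abs_log_mul_logWeight_le {t : ℝ} (hS : |S t| ≤ C * t) (ht : 2 ≤ t) :
    |Real.log t * (t * (S t * logWeight t))| ≤ 3 * C := by
  have h1 := half_le_log ht
  have h2 := abs_mul_logWeight_le hS ht
  rw [abs_mul, abs_mul, abs_of_pos (by linarith : 0 < Real.log t),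
    abs_of_pos (by linarith : 0 < t), ← mul_assoc]
  calc Real.log t * t * |S t * logWeight t|
      ≤ Real.log t * t * (3 * C / (t * Real.log t)) := by gcongr
    _ = 3 * C := by field_simp

theorem abs_self_mul_logWeight_le {t : ℝ} (hS : |S t| ≤ C * t) (ht : 2 ≤ t) :
    |t * (S t * logWeight t)| ≤ 6 * C := by
  have h1 := half_le_log ht
  have h2 := abs_log_mul_logWeight_le hS ht
  rw [abs_mul, abs_of_pos (by linarith : 0 < Real.log t)] at h2
  nlinarith [abs_nonneg (t * (S t * logWeight t))]

variable {x₀ : ℝ}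

/-- The transform `U(z) = ∫_{x₀}^∞ S(t) w(t) t^z dt` is holomorphic in `Re z < 0`. -/
theorem weighted_hasDerivAt (hSm : Measurable S) (hx₀ : 2 ≤ x₀) (hS : ∀ t ≥ 2, |S t| ≤ C * t)
    {z : ℂ} (hz : z.re < 0) :
    HasDerivAt (tailMellin (fun t => t * (S t * logWeight t)) x₀)
      (tailMellin (fun t => Real.log t * (t * (S t * logWeight t))) x₀ z) z :=
  (LogBounded.of_bounded (by linarith) fun t ht =>
    abs_self_mul_logWeight_le (hS t (by linarith)) (by linarith)).tailMellin_hasDerivAt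
    (by linarith) (measurable_mul_logWeight hSm) hz

/-- The second derivative of `U` is `V + V'` where `V(z) = ∫_{x₀}^∞ S(t) t^{z-2} dt`. -/
theorem weighted_hasDerivAt_second (hSm : Measurable S) (hx₀ : 2 ≤ x₀)
    (hS : ∀ t ≥ 2, |S t| ≤ C * t) {z : ℂ} (hz : z.re < 0) :
    HasDerivAt (tailMellin (fun t => Real.log t * (t * (S t * logWeight t))) x₀)
      (tailMellin (fun t => S t / t) x₀ z + deriv (tailMellin (fun t => S t / t) x₀) z) z := by
  have hb : ∀ t > x₀, |S t / t| ≤ C := fun t ht => by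
    have ht0 : 0 < t := by linarith
    rw [abs_div, abs_of_pos ht0, div_le_iff₀ ht0]
    exact hS t (by linarith)
  have hm : Measurable fun t => S t / t := hSm.div measurable_id
  have hlb := LogBounded.of_bounded (by linarith) hb
  have hV := hlb.tailMellin_hasDerivAt (by linarith) hm hz
  have hlog : LogBounded (fun t => Real.log t * (S t / t)) x₀ := by
    refine ⟨C, fun t ht => ?_⟩
    have h1 := half_le_log (by linarith : 2 ≤ t)
    rw [abs_mul, abs_of_pos (by linarith)]
    nlinarith [hb t ht, abs_nonneg (S t / t)]
  have hU := (LogBounded.of_bounded (by linarith) fun t ht =>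
    abs_log_mul_logWeight_le (hS t (by linarith)) (by linarith)).tailMellin_hasDerivAt
    (x₀ := x₀) (by linarith)
    (Real.measurable_log.mul (measurable_mul_logWeight hSm)) hz
  rw [hV.deriv]
  -- Since (t log t)² w(t) = 1 + log t, two differentiations remove the logarithm from the
  -- denominator: the 1 gives V and the log t gives V′.
  refine hU.congr_deriv (Eq.symm ?_)
  simp only [tailMellin]
  refine (integral_add (hlb.integrableOn (by linarith) hm hz) (hlog.integrableOn (by linarith)
    (Real.measurable_log.mul hm) hz)).symm.trans ?_
  refine setIntegral_congr_fun measurableSet_Ioi fun t ht => ?_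
  have ht' : x₀ < t := ht
  have h1 := half_le_log (by linarith : 2 ≤ t)
  have ht0 : t ≠ 0 := by linarith
  have hl0 : Real.log t ≠ 0 := by linarith
  rw [← mul_add, ← Complex.ofReal_add]
  congr 2
  simp only [logWeight, Pi.mul_apply]
  field_simp

/-- Integration by parts: `U(z) = z ∫_{x₀}^∞ K(t) t^{z-1} dt + x₀^z K(x₀)` for an antiderivative
`K` of `-S w`. -/
theorem weighted_eq_of_antideriv (hSm : Measurable S) (hx₀ : 2 ≤ x₀)
    (hS : ∀ t ≥ 2, |S t| ≤ C * t) {K : ℝ → ℝ} (hKm : Measurable K)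
    (hKc : ContinuousOn K (Ici x₀)) (hK : LogBounded K x₀)
    (hK' : ∀ x ≥ x₀, HasDerivWithinAt K (-(S x * logWeight x)) (Ici x) x) {z : ℂ}
    (hz : z.re < 0) :
    tailMellin (fun t => t * (S t * logWeight t)) x₀ z =
      z * tailMellin K x₀ z + (x₀ : ℂ) ^ z * K x₀ := by
  have hx0 : 0 < x₀ := by linarith
  have hz0 : z ≠ 0 := by rintro rfl; simp at hz
  have hKi := hK.integrableOn hx0 hKm hz
  have hUi := (LogBounded.of_bounded (f := fun t => t * (S t * logWeight t)) (by linarith)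
    fun t ht => abs_self_mul_logWeight_le (hS t (by linarith)) (by linarith)).integrableOn
    hx0 (measurable_mul_logWeight hSm) hz
  set F : ℝ → ℂ := fun t => (t : ℂ) ^ z * K t
  set F' : ℝ → ℂ := fun t => z * ((t : ℂ) ^ (z - 1) * K t) -
    (t : ℂ) ^ (z - 1) * ((t * (S t * logWeight t) : ℝ) : ℂ)
  have hF'i : IntegrableOn F' (Ioi x₀) := (hKi.const_mul z).sub hUi
  -- Only right derivatives are available, since S is allowed to jump.
  have hF' : ∀ x ≥ x₀, HasDerivWithinAt F (F' x) (Ioi x) x := fun x hx => by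
    have hx' : x ≠ 0 := by linarith
    have h1 := (hasDerivAt_ofReal_cpow_const hx' hz0).hasDerivWithinAt (s := Ioi x)
    have h2 := ((hK' x hx).mono Ioi_subset_Ici_self).ofReal_comp
    refine (h1.mul h2).congr_deriv (Eq.symm ?_)
    have : (x : ℂ) ^ z = (x : ℂ) ^ (z - 1) * x := by
      rw [Complex.cpow_sub _ _ (Complex.ofReal_ne_zero.2 hx'), Complex.cpow_one,
        div_mul_cancel₀ _ (Complex.ofReal_ne_zero.2 hx')]
    simp only [F', this]
    push_cast
    ring
  have hFc : ContinuousOn F (Ici x₀) := by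
    refine ContinuousOn.mul (fun x hx => ?_) (Complex.continuous_ofReal.comp_continuousOn hKc)
    have hx' : x₀ ≤ x := hx
    exact (Complex.continuousAt_ofReal_cpow_const x z
      (Or.inr (by linarith))).continuousWithinAt
  have hlim := intervalIntegral_tendsto_integral_Ioi x₀ hF'i tendsto_id
  have hF0 : Tendsto F atTop (𝓝 0) := by
    have h1 := hK.isBigO (ε := -z.re / 2) (by linarith)
    have h2 : F =O[atTop] fun t : ℝ => t ^ (z.re / 2) := by
      have h3 : (fun t : ℝ => (t : ℂ) ^ z) =O[atTop] fun t : ℝ => t ^ z.re := by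
        refine IsBigO.of_bound 1 ?_
        filter_upwards [eventually_gt_atTop 0] with t ht
        rw [Complex.norm_cpow_eq_rpow_re_of_pos ht, one_mul]
        exact le_abs_self _
      refine (h3.mul h1).congr' ?_ ?_
      · filter_upwards [eventually_gt_atTop x₀] with t ht
        rw [indicator_of_mem (show t ∈ Ioi x₀ from ht)]
      · filter_upwards [eventually_gt_atTop 0] with t ht
        rw [← Real.rpow_add ht]
        congr 1
        ring
    refine h2.trans_tendsto ?_
    have := tendsto_rpow_neg_atTop (y := -z.re / 2) (by linarith)
    convert this using 3
    ring
  have hval : ∀ X ≥ x₀, ∫ t in x₀..X, F' t = F X - F x₀ := fun X hX => by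
    refine intervalIntegral.integral_eq_sub_of_hasDeriv_right_of_le hX
      (hFc.mono Icc_subset_Ici_self) (fun x hx => hF' x hx.1.le) ?_
    rw [intervalIntegrable_iff_integrableOn_Ioc_of_le hX]
    exact hF'i.mono_set Ioc_subset_Ioi_self
  have hlim2 : Tendsto (fun X => ∫ t in x₀..id X, F' t) atTop (𝓝 (0 - F x₀)) :=
    (hF0.sub_const _).congr' (by
      filter_upwards [eventually_ge_atTop x₀] with X hX using (hval X hX).symm)
  have h := tendsto_nhds_unique hlim hlim2
  have h4 : ∫ t in Ioi x₀, F' t = z * tailMellin K x₀ z -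
      tailMellin (fun t => t * (S t * logWeight t)) x₀ z := by
    simp only [tailMellin]
    rw [← integral_const_mul]
    exact integral_sub (hKi.const_mul z) hUi
  rw [h4] at h
  simp only [F] at h
  linear_combination -h

end Weight

end PrimesAP

/-! ### Landau's oscillation theorem for K -/

namespace PrimesAP

open MeasureTheory ProbabilityTheory Set Asymptotics

theorem LogBounded.bounded_on {K : ℝ → ℝ} {x₀ : ℝ} (hK : LogBounded K x₀) (hx₀ : 1 ≤ x₀) (X : ℝ) :
    ∃ B, 0 ≤ B ∧ ∀ t > x₀, t ≤ X → |K t| ≤ B := by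
  obtain ⟨B, hB⟩ := hK
  refine ⟨|B| * (1 + |Real.log X|), by positivity, fun t ht htX => (hB t ht).trans ?_⟩
  have h0 := Real.log_nonneg (hx₀.trans ht.le)
  have h1 : Real.log t ≤ |Real.log X| :=
    (Real.log_le_log (by linarith) htX).trans (le_abs_self _)
  exact mul_le_mul (le_abs_self _) (by linarith) (by linarith) (abs_nonneg _)

/-- Abelian theorem: if `K → 0` then `σ ∫_{x₀}^∞ K(t) t^{σ-1} dt → 0` as `σ → 0⁻`. -/
theorem tendsto_mul_tailMellin_zero {K : ℝ → ℝ} {x₀ : ℝ} (hx₀ : 1 ≤ x₀)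
    (hK : LogBounded K x₀) (hK0 : Tendsto K atTop (𝓝 0)) :
    Tendsto (fun σ : ℝ => (σ : ℂ) * tailMellin K x₀ σ) (𝓝[<] 0) (𝓝 0) := by
  rw [Metric.tendsto_nhds]
  intro ε hε
  obtain ⟨X, hX⟩ := eventually_atTop.1 (Metric.tendsto_nhds.1 hK0 (ε / 2) (half_pos hε))
  obtain ⟨B, hB0, hB⟩ := hK.bounded_on hx₀ (max X 1)
  set B' := B * max X 1
  have hX0 : 0 < max X 1 := by positivity
  have hB'0 : 0 ≤ B' := by positivity
  have hx0 : 0 < x₀ := by linarith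
  -- The part of K before X is absorbed into B′/t, whose transform stays bounded near σ = 0 and is
  -- killed by the factor σ.
  have hbound : ∀ t > x₀, |K t| ≤ ε / 2 + B' * t⁻¹ := fun t ht => by
    have ht0 : 0 < t := hx0.trans ht
    rcases le_total t (max X 1) with h | h
    · have h1 : B ≤ B' * t⁻¹ := by
        rw [← div_eq_mul_inv, le_div_iff₀ ht0]
        exact mul_le_mul_of_nonneg_left h hB0
      linarith [hB t ht h]
    · have h1 := hX t ((le_max_left _ _).trans h)
      rw [Real.dist_eq, sub_zero] at h1
      have : 0 ≤ B' * t⁻¹ := by positivity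
      linarith
  have hδ : 0 < ε / (2 * (B' + 1)) := by positivity
  filter_upwards [self_mem_nhdsWithin, nhdsWithin_le_nhds (Ioi_mem_nhds (neg_lt_zero.2 hδ))]
    with σ hσ hσδ
  have hσ0 : σ < 0 := hσ
  have hσ1 : -σ < ε / (2 * (B' + 1)) := by
    have : -(ε / (2 * (B' + 1))) < σ := hσδ
    linarith
  have hi1 := (integrableOn_Ioi_rpow_of_lt (a := σ - 1) (by linarith) hx0)
  have hi2 := (integrableOn_Ioi_rpow_of_lt (a := σ - 2) (by linarith) hx0)
  have hn : ‖tailMellin K x₀ σ‖ ≤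
      ∫ t in Ioi x₀, (ε / 2 * t ^ (σ - 1) + B' * t ^ (σ - 2)) := by
    refine norm_integral_le_of_norm_le ((hi1.const_mul _).add (hi2.const_mul _)) ?_
    filter_upwards [self_mem_ae_restrict measurableSet_Ioi] with t ht
    have ht0 : 0 < t := hx0.trans ht
    rw [norm_mul, Complex.norm_cpow_eq_rpow_re_of_pos ht0, Complex.norm_real, Real.norm_eq_abs]
    have e1 : ((σ : ℂ) - 1).re = σ - 1 := by simp
    have e2 : t ^ (σ - 2) = t ^ (σ - 1) * t⁻¹ := by
      rw [← Real.rpow_neg_one t, ← Real.rpow_add ht0]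
      congr 1
      ring
    rw [e1, e2]
    calc t ^ (σ - 1) * |K t| ≤ t ^ (σ - 1) * (ε / 2 + B' * t⁻¹) := by
          gcongr
          exact hbound t ht
      _ = _ := by ring
  rw [integral_add (hi1.const_mul _) (hi2.const_mul _), integral_const_mul, integral_const_mul,
    integral_Ioi_rpow_of_lt (by linarith) hx0, integral_Ioi_rpow_of_lt (by linarith) hx0] at hn
  have h3 : x₀ ^ (σ - 1 + 1) ≤ 1 := Real.rpow_le_one_of_one_le_of_nonpos hx₀ (by linarith)
  have h4 : x₀ ^ (σ - 2 + 1) ≤ 1 := Real.rpow_le_one_of_one_le_of_nonpos hx₀ (by linarith)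
  have h5 : 0 < x₀ ^ (σ - 2 + 1) := Real.rpow_pos_of_pos hx0 _
  have h6 : -x₀ ^ (σ - 2 + 1) / (σ - 2 + 1) ≤ 1 := by
    rw [neg_div, ← div_neg, div_le_one (by linarith)]
    linarith
  have h7 : -σ * (-x₀ ^ (σ - 1 + 1) / (σ - 1 + 1)) ≤ 1 := by
    have : -σ * (-x₀ ^ (σ - 1 + 1) / (σ - 1 + 1)) = x₀ ^ (σ - 1 + 1) := by
      have := hσ0.ne
      rw [sub_add_cancel]
      field_simp
    rw [this]
    exact h3
  rw [dist_zero_right, norm_mul, Complex.norm_real, Real.norm_eq_abs, abs_of_neg hσ0]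
  calc -σ * ‖tailMellin K x₀ σ‖
      ≤ -σ * (ε / 2 * (-x₀ ^ (σ - 1 + 1) / (σ - 1 + 1)) +
          B' * (-x₀ ^ (σ - 2 + 1) / (σ - 2 + 1))) :=
        mul_le_mul_of_nonneg_left hn (by linarith)
    _ = ε / 2 * (-σ * (-x₀ ^ (σ - 1 + 1) / (σ - 1 + 1))) +
          -σ * (B' * (-x₀ ^ (σ - 2 + 1) / (σ - 2 + 1))) := by ring
    _ ≤ ε / 2 * 1 + -σ * (B' * 1) := by
        gcongr
        linarith
    _ ≤ ε / 2 + -σ * (B' + 1) := by nlinarith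
    _ < ε / 2 + ε / (2 * (B' + 1)) * (B' + 1) := by gcongr
    _ = ε := by field_simp; ring

/-- The relation `P g = Y` turns `P² (g + g')` into an expression in `P`, `Y` and their
derivatives. -/
theorem sq_mul_add_deriv_eq {P Y g : ℂ → ℂ} {z : ℂ} (hP : AnalyticAt ℂ P z)
    (hg : AnalyticAt ℂ g z) (h : (fun w => P w * g w) =ᶠ[𝓝 z] Y) :
    P z ^ 2 * (g z + deriv g z) = Y z * P z + deriv Y z * P z - Y z * deriv P z := by
  have h1 := h.deriv_eq
  rw [deriv_fun_mul hP.differentiableAt hg.differentiableAt] at h1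
  have h2 := h.eq_of_nhds
  rw [← h1, ← h2]
  ring

/-- This is U″ = V + V′ with V = Y/P, cleared of denominators so that the identity theorem can
extend it past Re z = 0 and across zeros of P. -/
theorem weighted_relation {S : ℝ → ℝ} {C x₀ : ℝ} {P Y : ℂ → ℂ} (hSm : Measurable S)
    (hx₀ : 2 ≤ x₀) (hS : ∀ t ≥ 2, |S t| ≤ C * t) {z : ℂ} (hz : z.re < 0) (hP : AnalyticAt ℂ P z)
    (hPV : ∀ z : ℂ, z.re < 0 → P z * tailMellin (fun t => S t / t) x₀ z = Y z) :
    P z ^ 2 * deriv (deriv (tailMellin (fun t => t * (S t * logWeight t)) x₀)) z =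
      Y z * P z + deriv Y z * P z - Y z * deriv P z := by
  have hnear : ∀ᶠ w : ℂ in 𝓝 z, w.re < 0 := (isOpen_re_lt 0).mem_nhds hz
  have e1 : deriv (tailMellin (fun t => t * (S t * logWeight t)) x₀) =ᶠ[𝓝 z]
      tailMellin (fun t => Real.log t * (t * (S t * logWeight t))) x₀ := by
    filter_upwards [hnear] with w hw using (weighted_hasDerivAt hSm hx₀ hS hw).deriv
  rw [e1.deriv_eq, (weighted_hasDerivAt_second hSm hx₀ hS hz).deriv]
  have hlb : LogBounded (fun t => S t / t) x₀ :=
    LogBounded.of_bounded (B := C) (by linarith) fun t ht => by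
      have ht0 : 0 < t := by linarith
      rw [abs_div, abs_of_pos ht0, div_le_iff₀ ht0]
      exact hS t (by linarith)
  have hV : DifferentiableOn ℂ (tailMellin (fun t => S t / t) x₀) {z | z.re < 0} := fun w hw =>
    (hlb.tailMellin_hasDerivAt (by linarith) (hSm.div measurable_id)
      hw).differentiableAt.differentiableWithinAt
  exact sq_mul_add_deriv_eq hP (hV.analyticAt ((isOpen_re_lt 0).mem_nhds hz))
    (hnear.mono fun w hw => hPV w hw)

theorem eventually_ne_zero_of_exists_ne {P : ℂ → ℂ} {b : ℝ}
    (hP : DifferentiableOn ℂ P {z | z.re < b}) (hP0 : ∃ z : ℂ, z.re < b ∧ P z ≠ 0) {ρ : ℂ}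
    (hρ : ρ.re < b) : ∀ᶠ z in 𝓝[≠] ρ, P z ≠ 0 := by
  obtain ⟨z, hz, hPz⟩ := hP0
  by_contra hcon
  exact hPz ((hP.analyticOnNhd (isOpen_re_lt b)).eqOn_zero_of_preconnected_of_frequently_eq_zero
    (convex_halfSpace_re_lt b).isPreconnected hρ (by
      rw [Filter.Frequently]
      exact hcon) hz)

/-- If `P V = Y` in `Re z < 0` for `V(z) = ∫_{x₀}^∞ S(t) t^{z-2} dt` and `Y / P` is analytic at
the real point `τ`, then a continuation of `U` to `Re z < τ` continues to a neighbourhood of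
`τ`. -/
theorem exists_continuation_of_quotient {P Y U : ℂ → ℂ} {τ b : ℝ} (hτb : τ < b)
    (hP : DifferentiableOn ℂ P {z | z.re < b}) (hP0 : ∃ z : ℂ, z.re < b ∧ P z ≠ 0)
    (hU : DifferentiableOn ℂ U {z | z.re < τ})
    (hrel : ∀ z : ℂ, z.re < τ →
      P z ^ 2 * deriv (deriv U) z = Y z * P z + deriv Y z * P z - Y z * deriv P z)
    (hreal : ∃ g : ℂ → ℂ, AnalyticAt ℂ g τ ∧ ∀ᶠ z in 𝓝 (τ : ℂ), P z * g z = Y z) :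
    ∃ u : ℂ → ℂ, AnalyticAt ℂ u τ ∧ ∀ᶠ z in 𝓝 (τ : ℂ), z.re < τ → u z = U z := by
  obtain ⟨g, hg, hgY⟩ := hreal
  have hPτ : AnalyticAt ℂ P τ := hP.analyticOnNhd (isOpen_re_lt b) _ (by simpa using hτb)
  have hne := eventually_ne_zero_of_exists_ne hP hP0 (ρ := τ) (by simpa using hτb)
  rw [eventually_nhdsWithin_iff] at hne
  have hdU : DifferentiableOn ℂ (deriv U) {z | z.re < τ} := hU.deriv (isOpen_re_lt τ)
  refine exists_continuation_of_second_deriv (U' := deriv U) (h := deriv (deriv U))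
    (g := fun z => g z + deriv g z)
    (fun z hz => (hU.differentiableAt ((isOpen_re_lt τ).mem_nhds hz)).hasDerivAt)
    (fun z hz => (hdU.differentiableAt ((isOpen_re_lt τ).mem_nhds hz)).hasDerivAt)
    (hg.add hg.deriv) ?_
  filter_upwards [hne, hgY.eventually_nhds, hg.eventually_analyticAt,
    hPτ.eventually_analyticAt] with z hz1 hz2 hz3 hz4 hzτ
  have hPz : P z ≠ 0 := hz1 (by rintro rfl; simp at hzτ)
  have h1 := sq_mul_add_deriv_eq hz4 hz3 hz2
  exact mul_left_cancel₀ (pow_ne_zero 2 hPz) ((hrel z hzτ).trans h1.symm)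

/-- **Landau's oscillation theorem**, in the form used here. Let `K → 0` be an antiderivative of
`-S w`, with `w` the logarithmic weight. If `± K(x) ≤ c x^{-b}` for large `x`, and the transform
`V(z) = ∫_{x₀}^∞ S(t) t^{z-2} dt` equals `Y / P` with `Y / P` regular on the real segment
`[0, b)`, then `Y / P` is regular in the whole half plane `Re z < b`. -/
theorem exists_analyticAt_of_one_sided {S K : ℝ → ℝ} {C x₀ b c ε : ℝ} {P Y : ℂ → ℂ}
    (hSm : Measurable S) (hx₀ : 2 ≤ x₀) (hS : ∀ t ≥ 2, |S t| ≤ C * t) (hKm : Measurable K)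
    (hKc : ContinuousOn K (Ici x₀)) (hKb : LogBounded K x₀)
    (hK' : ∀ x ≥ x₀, HasDerivWithinAt K (-(S x * logWeight x)) (Ici x) x)
    (hK0 : Tendsto K atTop (𝓝 0)) (hb : 0 < b) (hε : ε * ε = 1)
    (hA : ∀ x > x₀, ε * K x ≤ c * x ^ (-b))
    (hP : DifferentiableOn ℂ P {z | z.re < b}) (hP0 : ∃ z : ℂ, z.re < b ∧ P z ≠ 0)
    (hY : DifferentiableOn ℂ Y {z | z.re < b})
    (hPV : ∀ z : ℂ, z.re < 0 → P z * tailMellin (fun t => S t / t) x₀ z = Y z)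
    (hreal : ∀ τ : ℝ, 0 ≤ τ → τ < b →
      ∃ g : ℂ → ℂ, AnalyticAt ℂ g τ ∧ ∀ᶠ z in 𝓝 (τ : ℂ), P z * g z = Y z)
    {ρ : ℂ} (hρ : ρ.re < b) :
    ∃ g : ℂ → ℂ, AnalyticAt ℂ g ρ ∧ ∀ᶠ z in 𝓝 ρ, P z * g z = Y z := by
  have hx0 : 0 < x₀ := by linarith
  have hx0' : (x₀ : ℂ) ≠ 0 := Complex.ofReal_ne_zero.2 hx0.ne'
  have hεC : (ε : ℂ) * ε = 1 := by exact_mod_cast hε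
  have hPan := hP.analyticOnNhd (isOpen_re_lt b)
  have hYan := hY.analyticOnNhd (isOpen_re_lt b)
  -- Here ε = ±1 selects the side of the bound, and A ≥ 0 is what Landau's theorem needs.
  set A : ℝ → ℝ := fun t => c * t ^ (-b) - ε * K t with hAdef
  have hAm : Measurable A := by fun_prop
  have hA0 : ∀ t > x₀, 0 ≤ A t := fun t ht => sub_nonneg.2 (hA t ht)
  set μ := tailMeasure A x₀
  set T : ℂ → ℂ := complexMGF Real.log μ with hT
  set R : ℂ → ℂ := fun z => c * (-(x₀ : ℂ) ^ (z - b) / (z - b)) with hR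
  -- Integration by parts with ∫ K t^{z-1} dt written as ε(R − T). This formula keeps its meaning
  -- wherever the transform T of A converges.
  set U : ℂ → ℂ := fun z => z * (ε * (R z - T z)) + (x₀ : ℂ) ^ z * K x₀ with hUdef
  have hRan : ∀ z : ℂ, z.re < b → AnalyticAt ℂ R z := fun z hz => by
    have hzb : z - b ≠ 0 := by
      intro h
      have := congrArg Complex.re h
      simp at this
      linarith
    have h1 : AnalyticAt ℂ (fun z : ℂ => (x₀ : ℂ) ^ (z - b)) z := by
      have : Differentiable ℂ fun z : ℂ => (x₀ : ℂ) ^ (z - b) := fun z =>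
        (differentiableAt_id.sub_const _).const_cpow (Or.inl hx0')
      exact this.analyticAt z
    exact analyticAt_const.mul (h1.neg.div (analyticAt_id.sub analyticAt_const) hzb)
  have hpow : Differentiable ℂ fun z : ℂ => (x₀ : ℂ) ^ z * K x₀ := fun z =>
    (differentiableAt_id.const_cpow (Or.inl hx0')).mul_const _
  let H : ℝ → Prop := fun τ => ∀ t < τ, Integrable (fun ω => Real.exp (t * Real.log ω)) μ
  have hH0 : H 0 := fun t ht => by
    rw [integrable_tailMeasure_iff hAm hx0 hA0]
    have h1 := (integrableOn_rpow_tail hx0 (b := b) (z := t) (by simp; linarith)).const_mul (c : ℂ)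
    have h2 := (hKb.integrableOn hx0 hKm (z := t) (by simpa using ht)).const_mul (ε : ℂ)
    refine (h1.sub h2).congr (Eventually.of_forall fun x => ?_)
    simp only [hAdef, Pi.sub_apply]
    push_cast
    ring
  have hUT : ∀ z : ℂ, z.re < 0 →
      U z = tailMellin (fun t => t * (S t * logWeight t)) x₀ z := fun z hz => by
    rw [weighted_eq_of_antideriv hSm hx₀ hS hKm hKc hKb hK' hz]
    simp only [hUdef]
    congr 2
    have h1 := (integrableOn_rpow_tail hx0 (b := b) (z := z) (by linarith)).const_mul (c : ℂ)
    have h2 := (hKb.integrableOn hx0 hKm hz).const_mul (ε : ℂ)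
    have h3 : T z = R z - ε * tailMellin K x₀ z := by
      rw [hT, complexMGF_tailMeasure hAm hx0 hA0]
      simp only [hR]
      rw [← tailMellin_rpow hx0 (by linarith : z.re < b)]
      simp only [tailMellin]
      rw [← integral_const_mul, ← integral_const_mul, ← integral_sub h1 h2]
      congr 1
      ext x
      simp only [hAdef]
      push_cast
      ring
    rw [h3]
    linear_combination tailMellin K x₀ z * hεC
  have hTdiff : ∀ τ, H τ → DifferentiableOn ℂ T {z | z.re < τ} := fun τ hτ =>
    differentiableOn_complexMGF.mono fun z hz =>
      mem_interior.2 ⟨Iio τ, fun s hs => hτ s hs, isOpen_Iio, hz⟩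
  have hUdiff : ∀ τ ≤ b, H τ → DifferentiableOn ℂ U {z | z.re < τ} := fun τ hτb hτ =>
    (differentiableOn_id.mul (((DifferentiableOn.sub (fun z hz =>
      (hRan z (lt_of_lt_of_le hz hτb)).differentiableAt.differentiableWithinAt)
      (hTdiff τ hτ)).const_mul _))).add hpow.differentiableOn
  have hrel : ∀ τ, 0 ≤ τ → τ ≤ b → H τ → ∀ z : ℂ, z.re < τ →
      P z ^ 2 * deriv (deriv U) z = Y z * P z + deriv Y z * P z - Y z * deriv P z := by
    intro τ hτ0 hτb hτ
    have hsub : {z : ℂ | z.re < τ} ⊆ {z | z.re < b} := fun z hz => lt_of_lt_of_le hz hτb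
    have hUan := ((((hUdiff τ hτb hτ).deriv (isOpen_re_lt τ)).deriv
      (isOpen_re_lt τ)).analyticOnNhd (isOpen_re_lt τ))
    have hP' := hPan.mono hsub
    have hY' := hYan.mono hsub
    have hmem : (-τ - 1 : ℂ) ∈ {z : ℂ | z.re < τ} := by
      simp
      linarith
    refine AnalyticOnNhd.eqOn_of_preconnected_of_eventuallyEq (𝕜 := ℂ)
      (f := fun z => P z ^ 2 * deriv (deriv U) z)
      (g := fun z => Y z * P z + deriv Y z * P z - Y z * deriv P z)
      ((hP'.pow 2).mul hUan)
      (((hY'.mul hP').add (hY'.deriv.mul hP')).sub (hY'.mul hP'.deriv))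
      (convex_halfSpace_re_lt τ).isPreconnected hmem ?_
    have hev : ∀ᶠ z : ℂ in 𝓝 (-τ - 1 : ℂ), z.re < 0 :=
      (isOpen_re_lt 0).mem_nhds (by simp; linarith)
    filter_upwards [hev] with z hz
    have e2 : U =ᶠ[𝓝 z] tailMellin (fun t => t * (S t * logWeight t)) x₀ := by
      filter_upwards [(isOpen_re_lt 0).mem_nhds hz] with v hv using hUT v hv
    rw [e2.deriv.deriv_eq]
    exact weighted_relation hSm hx₀ hS hz (hPan z (by simp; linarith)) hPV
  -- The abscissa of convergence can be moved past any real τ in [0, b): regularity of Y/P at τ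
  -- continues U, hence T, to τ, and Landau's theorem applies.
  have hstep : ∀ τ, 0 ≤ τ → τ < b → H τ → ∃ t > τ, H t := by
    intro τ hτ0 hτb hτ
    obtain ⟨u, hu, huU⟩ := exists_continuation_of_quotient hτb hP hP0 (hUdiff τ hτb.le hτ)
      (hrel τ hτ0 hτb.le hτ) (hreal τ hτ0 hτb)
    set N : ℂ → ℂ := fun z => u z - (x₀ : ℂ) ^ z * K x₀
    have hN : AnalyticAt ℂ N τ := hu.sub (hpow.analyticAt _)
    have hNU : ∀ᶠ z in 𝓝 (τ : ℂ), z.re < τ → N z = z * (ε * (R z - T z)) := by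
      filter_upwards [huU] with z hz hzτ
      simp only [N, hz hzτ, hUdef]
      ring
    obtain ⟨k, hk, hkN⟩ : ∃ k : ℂ → ℂ, AnalyticAt ℂ k τ ∧
        ∀ᶠ z in 𝓝 (τ : ℂ), z.re < τ → k z = ε * (R z - T z) := by
      -- Recovering T from U requires division by z. At τ = 0 this is legitimate because N(0) = 0,
      -- the Abelian consequence of K → 0.
      rcases eq_or_lt_of_le hτ0 with h0 | h0
      · subst h0
        have hN0 : N 0 = 0 := by
          have h1 : Tendsto (fun σ : ℝ => N σ) (𝓝[<] 0) (𝓝 (N 0)) := by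
            have h2 : Tendsto (fun σ : ℝ => (σ : ℂ)) (𝓝[<] 0) (𝓝 ((0 : ℝ) : ℂ)) :=
              (Complex.continuous_ofReal.tendsto 0).mono_left nhdsWithin_le_nhds
            have h3 := hN.continuousAt.tendsto.comp h2
            simpa using! h3
          refine tendsto_nhds_unique h1 ((tendsto_mul_tailMellin_zero (by linarith) hKb hK0).congr'
            ?_)
          have h4 : ∀ᶠ σ : ℝ in 𝓝[<] 0, ((σ : ℂ)).re < 0 → N σ = σ * (ε * (R σ - T σ)) :=
            (((Complex.continuous_ofReal.tendsto 0).mono_left nhdsWithin_le_nhds).eventually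
              (by simpa using hNU))
          filter_upwards [h4, self_mem_nhdsWithin] with σ h5 hσ
          have hσ' : (σ : ℂ).re < 0 := by simpa using hσ
          rw [h5 hσ']
          have h6 := hUT σ hσ'
          rw [weighted_eq_of_antideriv hSm hx₀ hS hKm hKc hKb hK' hσ'] at h6
          simp only [hUdef] at h6
          exact (add_right_cancel h6).symm
        refine ⟨dslope N 0, ?_, ?_⟩
        · obtain ⟨p, hp⟩ := hN
          exact ⟨p.fslope, by simpa using hp.has_fpower_series_dslope_fslope⟩
        · filter_upwards [hNU] with z hz hz0
          have hz1 : z ≠ 0 := by rintro rfl; simp at hz0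
          rw [dslope_of_ne _ hz1, slope_def_field, hN0, hz hz0]
          field_simp
          ring
      · refine ⟨fun z => N z / z, hN.div analyticAt_id
          (by simpa using h0.ne'), ?_⟩
        have hne : ∀ᶠ z in 𝓝 (τ : ℂ), z ≠ 0 :=
          isOpen_ne.mem_nhds (by simpa using h0.ne')
        filter_upwards [hNU, hne] with z hz hz1 hzτ
        simp only [hz hzτ]
        field_simp
    have hlogm : Measurable Real.log := Real.measurable_log
    have hlog0 : ∀ᵐ ω ∂μ, 0 ≤ Real.log ω := by
      refine (withDensity_absolutelyContinuous _ _).ae_le ?_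
      filter_upwards [self_mem_ae_restrict measurableSet_Ioi] with t ht
      exact Real.log_nonneg (by linarith [mem_Ioi.1 ht])
    obtain ⟨t, htτ, ht⟩ := exists_gt_integrable_of_analyticAt hlogm hlog0 hτ
      (g := fun z => R z - ε * k z)
      ((hRan τ (by simpa using hτb)).sub (analyticAt_const.mul hk)) (by
        filter_upwards [hkN] with z hz hzτ
        simp only [hz hzτ]
        change _ = T z
        linear_combination (T z - R z) * hεC)
    refine ⟨t, htτ, fun s hs => ?_⟩
    -- The set of exponents with finite moment is an interval, so finiteness at t and at some point
    -- below τ fills the gap.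
    have hconv := (convex_integrableExpSet (X := Real.log) (μ := μ)).ordConnected
    exact hconv.out (hτ (min s (τ - 1)) (by
      exact lt_of_le_of_lt (min_le_right _ _) (by linarith))) ht ⟨min_le_left _ _, hs.le⟩
  -- The supremum of the admissible τ is itself admissible, and if it were below b the previous step
  -- would exceed it.
  have hHb : H b := by
    set I : Set ℝ := {τ | τ ≤ b ∧ H τ}
    have hI0 : (0 : ℝ) ∈ I := ⟨hb.le, hH0⟩
    have hIb : BddAbove I := ⟨b, fun τ hτ => hτ.1⟩
    have hs0 : 0 ≤ sSup I := le_csSup hIb hI0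
    have hsb : sSup I ≤ b := csSup_le ⟨0, hI0⟩ fun τ hτ => hτ.1
    have hHs : H (sSup I) := fun t ht => by
      obtain ⟨τ, hτ, htτ⟩ := exists_lt_of_lt_csSup ⟨0, hI0⟩ ht
      exact hτ.2 t htτ
    rcases eq_or_lt_of_le hsb with h | h
    · rwa [h] at hHs
    · obtain ⟨t, ht, hHt⟩ := hstep _ hs0 h hHs
      have hmem : min t b ∈ I := ⟨min_le_right _ _, fun s hs =>
        hHt s (lt_of_lt_of_le hs (min_le_left _ _))⟩
      exact absurd (le_csSup hIb hmem) (not_le.2 (lt_min ht h))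
  have hUb := hUdiff b le_rfl hHb
  refine exists_analyticAt_quotient (h := deriv (deriv U)) (hPan ρ hρ) (hYan ρ hρ)
    (((hUb.deriv (isOpen_re_lt b)).deriv (isOpen_re_lt b)).analyticAt
      ((isOpen_re_lt b).mem_nhds hρ)) (eventually_ne_zero_of_exists_ne hP hP0 hρ) ?_
  filter_upwards [(isOpen_re_lt b).mem_nhds hρ] with z hz using hrel b hb.le le_rfl hHb z hz

end PrimesAP

/-! ### A Tauberian theorem of Karamata type -/

namespace PrimesAP

open MeasureTheory Set

/-- The two powers are those of the Gamma integrals at 1/2 and 2, which makes |log v| integrable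
against e^{-v}. -/
theorem abs_log_le_two_mul_rpow_add {v : ℝ} (hv : 0 < v) :
    |Real.log v| ≤ 2 * v ^ ((1 / 2 : ℝ) - 1) + v ^ ((2 : ℝ) - 1) := by
  have h1 : 0 < v ^ ((1 / 2 : ℝ) - 1) := Real.rpow_pos_of_pos hv _
  have h2 : v ^ ((2 : ℝ) - 1) = v := by norm_num
  rw [h2, abs_le]
  constructor
  · have h3 := Real.log_le_sub_one_of_pos h1
    rw [Real.log_rpow hv] at h3
    linarith
  · linarith [Real.log_le_sub_one_of_pos hv]

theorem integrableOn_exp_neg_mul_abs_log :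
    IntegrableOn (fun v => Real.exp (-v) * |Real.log v|) (Ioi 0) := by
  have h1 := (Real.GammaIntegral_convergent (s := 1 / 2) (by norm_num)).const_mul 2
  have h2 := Real.GammaIntegral_convergent (s := 2) (by norm_num)
  refine (h1.add h2).mono' (by fun_prop) ?_
  filter_upwards [self_mem_ae_restrict measurableSet_Ioi] with v hv
  rw [Real.norm_eq_abs, abs_mul, abs_abs, Real.abs_exp]
  calc Real.exp (-v) * |Real.log v|
      ≤ Real.exp (-v) * (2 * v ^ ((1 / 2 : ℝ) - 1) + v ^ ((2 : ℝ) - 1)) := by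
        gcongr
        exact abs_log_le_two_mul_rpow_add hv
    _ = _ := by
      simp only [Pi.add_apply]
      ring

theorem integrableOn_exp_neg_mul_of_bounded {φ : ℝ → ℝ} (hφ : Measurable φ) {M : ℝ}
    (hM : ∀ v > 0, |φ v| ≤ M) : IntegrableOn (fun v => Real.exp (-v) * φ v) (Ioi 0) := by
  have h := (integrableOn_exp_neg_Ioi 0).const_mul M
  refine h.mono' (by fun_prop) ?_
  filter_upwards [self_mem_ae_restrict measurableSet_Ioi] with v hv
  rw [Real.norm_eq_abs, abs_mul, Real.abs_exp, mul_comm]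
  exact mul_le_mul_of_nonneg_right (hM v hv) (Real.exp_pos _).le

theorem exp_neg_mem_Icc {v : ℝ} (hv : 0 < v) : Real.exp (-v) ∈ Icc (0 : ℝ) 1 :=
  ⟨(Real.exp_pos _).le, Real.exp_le_one_iff.2 (by linarith)⟩

theorem exists_bound_polynomial (Q : Polynomial ℝ) :
    ∃ M, 0 ≤ M ∧ ∀ v > 0, |Q.eval (Real.exp (-v))| ≤ M := by
  obtain ⟨M, hM⟩ := isCompact_Icc.exists_bound_of_continuousOn
    (Q.continuous.continuousOn (s := Icc (0 : ℝ) 1))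
  exact ⟨M, (norm_nonneg _).trans (hM 0 (by simp)), fun v hv => hM _ (exp_neg_mem_Icc hv)⟩

/-- Polynomial kernels in `e^{-v}` concentrating at `v = 1`. -/
theorem exists_polynomial_concentrating {η : ℝ} (hη : 0 < η) :
    ∃ Q : Polynomial ℝ, 0 < ∫ v in Ioi 0, Real.exp (-v) * Q.eval (Real.exp (-v)) ∧
      ∫ v in Ioi 0, Real.exp (-v) * (|Q.eval (Real.exp (-v))| * |Real.log v|) ≤
        η * ∫ v in Ioi 0, Real.exp (-v) * Q.eval (Real.exp (-v)) := by
  -- In the variable y = e^{-v} the point v = 1 is y = e^{-1}, and log v = log(−log y) is small near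
  -- it. A tent function there is then approximated by Weierstrass.
  obtain ⟨r, hr, hrlog⟩ : ∃ r > 0, ∀ v > 0, |Real.exp (-v) - Real.exp (-1)| < r →
      |Real.log v| ≤ η / 4 := by
    have hc : ContinuousAt (fun y => Real.log (-Real.log y)) (Real.exp (-1)) := by
      refine ContinuousAt.log (Real.continuousAt_log (Real.exp_pos _).ne').neg ?_
      simp
    obtain ⟨r, hr, h⟩ := Metric.continuousAt_iff.1 hc (η / 4) (by positivity)
    refine ⟨r, hr, fun v hv hvr => ?_⟩
    have := h (x := Real.exp (-v)) (by rwa [Real.dist_eq])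
    simp only [Real.log_exp, neg_neg, Real.log_one, Real.dist_eq, sub_zero] at this
    exact this.le
  set φ : ℝ → ℝ := fun y => max 0 (r - |y - Real.exp (-1)|) with hφ
  have hφc : Continuous φ := by fun_prop
  have hφ0 : ∀ y, 0 ≤ φ y := fun y => le_max_left _ _
  have hφr : ∀ y, |φ y| ≤ r := fun y => by
    rw [abs_of_nonneg (hφ0 y)]
    exact max_le hr.le (by linarith [abs_nonneg (y - Real.exp (-1))])
  have hφlog : ∀ v > 0, φ (Real.exp (-v)) * |Real.log v| ≤ φ (Real.exp (-v)) * (η / 4) := by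
    intro v hv
    by_cases h : |Real.exp (-v) - Real.exp (-1)| < r
    · exact mul_le_mul_of_nonneg_left (hrlog v hv h) (hφ0 _)
    · have : φ (Real.exp (-v)) = 0 := max_eq_left (by linarith)
      simp [this]
  have hφi : IntegrableOn (fun v => Real.exp (-v) * φ (Real.exp (-v))) (Ioi 0) :=
    integrableOn_exp_neg_mul_of_bounded (φ := fun v => φ (Real.exp (-v))) (by fun_prop)
      fun v _ => hφr _
  set m := ∫ v in Ioi 0, Real.exp (-v) * φ (Real.exp (-v)) with hm
  have hm0 : 0 < m := by
    rw [hm, setIntegral_pos_iff_support_of_nonneg_ae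
      (Eventually.of_forall fun v => mul_nonneg (Real.exp_pos _).le (hφ0 _)) hφi]
    have hopen : IsOpen ({v : ℝ | 0 < φ (Real.exp (-v))} ∩ Ioi 0) :=
      (isOpen_lt continuous_const (by fun_prop)).inter isOpen_Ioi
    refine (hopen.measure_pos volume ⟨1, ?_, by simp⟩).trans_le (measure_mono ?_)
    · simp [hφ, hr]
    · rintro v ⟨h1, h2⟩
      exact ⟨mul_ne_zero (Real.exp_pos _).ne' (ne_of_gt h1), h2⟩
  set L := ∫ v in Ioi 0, Real.exp (-v) * |Real.log v|
  have hL : 0 ≤ L := integral_nonneg fun v => by positivity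
  -- The first bound keeps at least half the mass of the tent; the second keeps the approximation
  -- error κL below ηm/4.
  set κ := min (m / 2) (η * m / (4 * (L + 1))) with hκ
  have hκ0 : 0 < κ := by positivity
  obtain ⟨Q, hQ⟩ := exists_polynomial_near_of_continuousOn 0 1 φ hφc.continuousOn κ hκ0
  obtain ⟨M, -, hM⟩ := exists_bound_polynomial Q
  have hQi : IntegrableOn (fun v => Real.exp (-v) * Q.eval (Real.exp (-v))) (Ioi 0) :=
    integrableOn_exp_neg_mul_of_bounded (φ := fun v => Q.eval (Real.exp (-v))) (by fun_prop) hM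
  have hlow : m - κ ≤ ∫ v in Ioi 0, Real.exp (-v) * Q.eval (Real.exp (-v)) := by
    have h1 := integral_exp_neg_Ioi_zero
    have h2 : m - κ = ∫ v in Ioi 0, (Real.exp (-v) * φ (Real.exp (-v)) - κ * Real.exp (-v)) := by
      rw [integral_sub hφi ((integrableOn_exp_neg_Ioi 0).const_mul κ), integral_const_mul, h1,
        mul_one]
    rw [h2]
    refine setIntegral_mono_on (hφi.sub ((integrableOn_exp_neg_Ioi 0).const_mul κ)) hQi
      measurableSet_Ioi fun v hv => ?_
    have := (abs_lt.1 (hQ _ (exp_neg_mem_Icc hv))).1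
    nlinarith [Real.exp_pos (-v)]
  have hm2 : m / 2 ≤ ∫ v in Ioi 0, Real.exp (-v) * Q.eval (Real.exp (-v)) := by
    have : κ ≤ m / 2 := min_le_left _ _
    linarith
  refine ⟨Q, by linarith, ?_⟩
  have hbig : Integrable (fun v => η / 4 * (Real.exp (-v) * φ (Real.exp (-v))) +
      κ * (Real.exp (-v) * |Real.log v|)) (volume.restrict (Ioi 0)) :=
    (hφi.const_mul _).add (integrableOn_exp_neg_mul_abs_log.const_mul _)
  calc ∫ v in Ioi 0, Real.exp (-v) * (|Q.eval (Real.exp (-v))| * |Real.log v|)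
      ≤ ∫ v in Ioi 0, (η / 4 * (Real.exp (-v) * φ (Real.exp (-v))) +
          κ * (Real.exp (-v) * |Real.log v|)) := by
        refine integral_mono_of_nonneg (Eventually.of_forall fun v => by positivity) hbig ?_
        filter_upwards [self_mem_ae_restrict measurableSet_Ioi] with v hv
        have h1 : |Q.eval (Real.exp (-v))| ≤ φ (Real.exp (-v)) + κ := by
          have := abs_lt.1 (hQ _ (exp_neg_mem_Icc hv))
          rw [abs_le]
          constructor <;> linarith [hφ0 (Real.exp (-v))]
        have h2 := hφlog v hv
        have h3 := mul_le_mul_of_nonneg_right h1 (abs_nonneg (Real.log v))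
        have h4 : |Q.eval (Real.exp (-v))| * |Real.log v| ≤
            φ (Real.exp (-v)) * (η / 4) + κ * |Real.log v| := by linarith
        calc _ ≤ Real.exp (-v) * (φ (Real.exp (-v)) * (η / 4) + κ * |Real.log v|) := by gcongr
          _ = _ := by ring
    _ = η / 4 * m + κ * L := by
        rw [integral_add (hφi.const_mul _) (integrableOn_exp_neg_mul_abs_log.const_mul _),
          integral_const_mul, integral_const_mul]
    _ ≤ η / 4 * m + η * m / (4 * (L + 1)) * (L + 1) := by
        gcongr
        · exact min_le_right _ _
        · linarith
    _ = η * (m / 2) := by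
        field_simp
        ring
    _ ≤ _ := by gcongr

section Tauberian

variable {k : ℝ → ℝ} {C c : ℝ}

theorem integrableOn_comp_mul_of_logLipschitz (hkm : Measurable k)
    (hk : ∀ u > 0, ∀ v > 0, |k u - k v| ≤ C * |Real.log u - Real.log v|) {Λ : ℝ} (hΛ : 0 < Λ)
    (Q : Polynomial ℝ) :
    IntegrableOn (fun v => Real.exp (-v) * (Q.eval (Real.exp (-v)) * k (Λ * v))) (Ioi 0) := by
  obtain ⟨M, hM0, hM⟩ := exists_bound_polynomial Q
  have h1 := ((integrableOn_exp_neg_Ioi 0).const_mul (M * |k Λ|)).add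
    (integrableOn_exp_neg_mul_abs_log.const_mul (M * C))
  have hQm : Measurable fun v : ℝ => Q.eval (Real.exp (-v)) :=
    (Q.continuous.comp (by fun_prop)).measurable
  have hkm' : Measurable fun v => k (Λ * v) := hkm.comp (measurable_const_mul Λ)
  refine h1.mono' ((by fun_prop : Measurable fun v : ℝ => Real.exp (-v)).mul
    (hQm.mul hkm')).aestronglyMeasurable ?_
  filter_upwards [self_mem_ae_restrict measurableSet_Ioi] with v hv
  have hv0 : 0 < v := hv
  have h2 := hk (Λ * v) (by positivity) Λ hΛ
  rw [Real.log_mul hΛ.ne' hv0.ne', add_sub_cancel_left] at h2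
  have h3 : |k (Λ * v)| ≤ |k Λ| + C * |Real.log v| := by
    have := abs_sub_abs_le_abs_sub (k (Λ * v)) (k Λ)
    linarith
  rw [Real.norm_eq_abs, abs_mul, abs_mul, Real.abs_exp]
  calc Real.exp (-v) * (|Q.eval (Real.exp (-v))| * |k (Λ * v)|)
      ≤ Real.exp (-v) * (M * (|k Λ| + C * |Real.log v|)) := by
        gcongr
        exact hM v hv
    _ = _ := by
      simp only [Pi.add_apply]
      ring

/-- By linearity a monomial y^n suffices. Its kernel e^{-(n+1)v} has mass 1/(n+1) and, after
rescaling, is the Laplace mean of k at δ = (n+1)/Λ. -/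
theorem tendsto_integral_polynomial_kernel (hkm : Measurable k)
    (hk : ∀ u > 0, ∀ v > 0, |k u - k v| ≤ C * |Real.log u - Real.log v|)
    (hL : Tendsto (fun δ : ℝ => δ * ∫ u in Ioi 0, Real.exp (-(δ * u)) * k u) (𝓝[>] 0) (𝓝 c))
    (Q : Polynomial ℝ) :
    Tendsto (fun Λ : ℝ =>
      ∫ v in Ioi 0, Real.exp (-v) * (Q.eval (Real.exp (-v)) * k (Λ * v))) atTop
      (𝓝 (c * ∫ v in Ioi 0, Real.exp (-v) * Q.eval (Real.exp (-v)))) := by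
  have hQi : ∀ Q : Polynomial ℝ,
      IntegrableOn (fun v => Real.exp (-v) * Q.eval (Real.exp (-v))) (Ioi 0) := fun Q => by
    obtain ⟨M, -, hM⟩ := exists_bound_polynomial Q
    exact integrableOn_exp_neg_mul_of_bounded (φ := fun v => Q.eval (Real.exp (-v)))
      (by fun_prop) hM
  induction Q using Polynomial.induction_on' with
  | add p q hp hq =>
    have h1 := hp.add hq
    rw [← mul_add, ← integral_add (hQi p) (hQi q)] at h1
    simp only [Polynomial.eval_add, add_mul, mul_add] at h1 ⊢
    refine h1.congr' ?_
    filter_upwards [eventually_gt_atTop 0] with Λ hΛ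
    rw [← integral_add (integrableOn_comp_mul_of_logLipschitz hkm hk hΛ p)
      (integrableOn_comp_mul_of_logLipschitz hkm hk hΛ q)]
  | monomial n a =>
    have hn : (0 : ℝ) < n + 1 := by positivity
    have e1 : ∀ v : ℝ, Real.exp (-v) * (a * Real.exp (-v) ^ n) =
        a * Real.exp (-((n + 1) * v)) := fun v => by
      rw [← Real.exp_nat_mul, mul_left_comm, ← Real.exp_add]
      congr 2
      ring
    have e2 : ∫ v in Ioi (0 : ℝ), Real.exp (-v) * (a * Real.exp (-v) ^ n) = a / (n + 1) := by
      simp_rw [e1]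
      rw [integral_const_mul, integral_comp_mul_left_Ioi (fun x => Real.exp (-x)) 0 hn]
      rw [mul_zero, integral_exp_neg_Ioi_zero, smul_eq_mul, mul_one, div_eq_mul_inv]
    simp only [Polynomial.eval_monomial]
    rw [e2]
    have h1 : Tendsto (fun Λ : ℝ => (n + 1 : ℝ) / Λ) atTop (𝓝[>] 0) := by
      refine tendsto_nhdsWithin_iff.2 ⟨tendsto_const_nhds.div_atTop tendsto_id, ?_⟩
      filter_upwards [eventually_gt_atTop 0] with Λ hΛ
      exact div_pos hn hΛ
    have h2 := (hL.comp h1).const_mul (a / (n + 1))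
    rw [mul_comm c]
    refine h2.congr' ?_
    filter_upwards [eventually_gt_atTop 0] with Λ hΛ
    have e3 := integral_comp_mul_left_Ioi
      (fun u => Real.exp (-((n + 1) / Λ * u)) * k u) 0 hΛ
    rw [mul_zero, smul_eq_mul] at e3
    have e4 : ∫ u in Ioi 0, Real.exp (-((n + 1) / Λ * u)) * k u =
        Λ * ∫ v in Ioi 0, Real.exp (-((n + 1) / Λ * (Λ * v))) * k (Λ * v) := by
      rw [e3]
      field_simp
    simp only [Function.comp_apply]
    rw [e4]
    have e5 : ∀ v : ℝ, Real.exp (-v) * (a * Real.exp (-v) ^ n * k (Λ * v)) =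
        a * (Real.exp (-((n + 1) / Λ * (Λ * v))) * k (Λ * v)) := fun v => by
      rw [← mul_assoc, e1, mul_assoc]
      congr 4
      field_simp
    simp_rw [e5]
    rw [integral_const_mul]
    field_simp

/-- A Tauberian theorem of Karamata type: a function which is Lipschitz with respect to `log u`
and whose Abelian means converge is convergent. -/
theorem tendsto_of_tendsto_laplace (hkm : Measurable k)
    (hk : ∀ u > 0, ∀ v > 0, |k u - k v| ≤ C * |Real.log u - Real.log v|)
    (hL : Tendsto (fun δ : ℝ => δ * ∫ u in Ioi 0, Real.exp (-(δ * u)) * k u) (𝓝[>] 0) (𝓝 c)) :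
    Tendsto k atTop (𝓝 c) := by
  have hC : 0 ≤ C := by
    have := (abs_nonneg _).trans (hk (Real.exp 1) (Real.exp_pos _) 1 one_pos)
    simpa using this
  rw [Metric.tendsto_nhds]
  intro ε hε
  obtain ⟨Q, hQ0, hQ⟩ := exists_polynomial_concentrating (η := ε / (2 * (C + 1))) (by positivity)
  set m := ∫ v in Ioi 0, Real.exp (-v) * Q.eval (Real.exp (-v))
  obtain ⟨M, hM0, hM⟩ := exists_bound_polynomial Q
  have hQi : IntegrableOn (fun v => Real.exp (-v) * Q.eval (Real.exp (-v))) (Ioi 0) :=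
    integrableOn_exp_neg_mul_of_bounded (φ := fun v => Q.eval (Real.exp (-v))) (by fun_prop) hM
  have hQl : IntegrableOn
      (fun v => Real.exp (-v) * (|Q.eval (Real.exp (-v))| * |Real.log v|)) (Ioi 0) := by
    refine (integrableOn_exp_neg_mul_abs_log.const_mul M).mono' (by fun_prop) ?_
    filter_upwards [self_mem_ae_restrict measurableSet_Ioi] with v hv
    rw [Real.norm_eq_abs, abs_mul, abs_mul, abs_abs, abs_abs, Real.abs_exp, mul_left_comm M]
    gcongr
    exact hM v hv
  have hlim := tendsto_integral_polynomial_kernel hkm hk hL Q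
  filter_upwards [Metric.tendsto_nhds.1 hlim (ε / 2 * m) (by positivity), eventually_gt_atTop 0]
    with Λ hΛ hΛ0
  set J := ∫ v in Ioi 0, Real.exp (-v) * (Q.eval (Real.exp (-v)) * k (Λ * v)) with hJ
  -- Since log(Λv) − log Λ = log v, replacing k(Λv) by k(Λ) costs at most C|log v|, uniformly in Λ,
  -- and the kernel makes the integral of this small.
  have h1 : |J - k Λ * m| ≤ C * (ε / (2 * (C + 1)) * m) := by
    have e : J - k Λ * m = ∫ v in Ioi 0, (Real.exp (-v) * (Q.eval (Real.exp (-v)) * k (Λ * v)) -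
        k Λ * (Real.exp (-v) * Q.eval (Real.exp (-v)))) := by
      rw [integral_sub (integrableOn_comp_mul_of_logLipschitz hkm hk hΛ0 Q) (hQi.const_mul _),
        integral_const_mul]
    rw [e, ← Real.norm_eq_abs]
    refine (norm_integral_le_of_norm_le (hQl.const_mul C) ?_).trans ?_
    · filter_upwards [self_mem_ae_restrict measurableSet_Ioi] with v hv
      have hv0 : 0 < v := hv
      have h2 := hk (Λ * v) (by positivity) Λ hΛ0
      rw [Real.log_mul hΛ0.ne' hv0.ne', add_sub_cancel_left] at h2
      have e3 : Real.exp (-v) * (Q.eval (Real.exp (-v)) * k (Λ * v)) -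
          k Λ * (Real.exp (-v) * Q.eval (Real.exp (-v))) =
          Real.exp (-v) * (Q.eval (Real.exp (-v)) * (k (Λ * v) - k Λ)) := by ring
      rw [e3, Real.norm_eq_abs, abs_mul, abs_mul, Real.abs_exp]
      calc Real.exp (-v) * (|Q.eval (Real.exp (-v))| * |k (Λ * v) - k Λ|)
          ≤ Real.exp (-v) * (|Q.eval (Real.exp (-v))| * (C * |Real.log v|)) := by gcongr
        _ = _ := by ring
    · rw [integral_const_mul]
      gcongr
  have h2 : C * (ε / (2 * (C + 1)) * m) ≤ ε / 2 * m := by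
    have : C * (ε / (2 * (C + 1)) * m) = ε / 2 * m * (C / (C + 1)) := by field_simp
    rw [this]
    exact mul_le_of_le_one_right (by positivity) ((div_le_one (by positivity)).2 (by linarith))
  rw [Real.dist_eq] at hΛ ⊢
  have h3 : |(k Λ - c) * m| < ε * m := by
    have e : (k Λ - c) * m = (J - c * m) - (J - k Λ * m) := by ring
    rw [e]
    calc _ ≤ |J - c * m| + |J - k Λ * m| := abs_sub _ _
      _ < ε / 2 * m + ε / 2 * m := by linarith
      _ = ε * m := by ring
  rwa [abs_mul, abs_of_pos hQ0, mul_lt_mul_iff_left₀ hQ0] at h3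

end Tauberian

end PrimesAP

/-! ### Proper prime powers and θ(x;q,a) -/

namespace PrimesAP

open MeasureTheory Set ArithmeticFunction ArithmeticFunction.vonMangoldt

section PrimePowers

variable {q : ℕ} {a : ZMod q}

/-- The von Mangoldt function on the proper prime powers in a residue class. -/
noncomputable def properPowers (a : ZMod q) (n : ℕ) : ℝ :=
  if n.Prime then 0 else residueClass a n

theorem properPowers_nonneg (n : ℕ) : 0 ≤ properPowers a n := by
  unfold properPowers
  split_ifs
  exacts [le_rfl, residueClass_nonneg a n]

theorem summable_primes_log_mul_rpow {r : ℝ} (hr : 1 < r) :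
    Summable fun p : Nat.Primes => Real.log p * (p : ℝ) ^ (-r) := by
  set ε := (r - 1) / 2 with hε
  have hε0 : 0 < ε := by linarith
  have h := (Nat.Primes.summable_rpow (r := ε - r)).2 (by linarith)
  refine (h.mul_left (1 / ε)).of_nonneg_of_le (fun p => ?_) fun p => ?_
  · exact mul_nonneg (Real.log_nonneg (by exact_mod_cast p.2.one_lt.le)) (by positivity)
  · have hp : (0 : ℝ) < p := by exact_mod_cast p.2.pos
    calc Real.log p * (p : ℝ) ^ (-r) ≤ (p : ℝ) ^ ε / ε * (p : ℝ) ^ (-r) := by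
          gcongr
          exact Real.log_le_rpow_div hp.le hε0
      _ = 1 / ε * (p : ℝ) ^ (ε - r) := by
          rw [sub_eq_add_neg, Real.rpow_add hp]
          ring

/-- Every contributing prime power is p^{m+k} with k ≥ 0. Its term is at most log p · p^{-mσ} ·
2^{-kσ}, so the double series factors into a convergent sum over primes and a geometric series. -/
theorem summable_properPowers {m : ℕ} (hm : 2 ≤ m)
    (ha : ∀ p k : ℕ, p.Prime → 2 ≤ k → k < m → ((p ^ k : ℕ) : ZMod q) ≠ a) {σ : ℝ}
    (hσ : 1 < m * σ) : Summable fun n : ℕ => properPowers a n * (n : ℝ) ^ (-σ) := by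
  have hσ0 : 0 < σ := by
    by_contra h
    have : (m : ℝ) * σ ≤ 0 := mul_nonpos_of_nonneg_of_nonpos (by positivity) (not_lt.1 h)
    linarith
  set i : Nat.Primes × ℕ → ℕ := fun pk => (pk.1 : ℕ) ^ (pk.2 + m) with hi
  have hinj : Function.Injective i := by
    rintro ⟨p, k⟩ ⟨p', k'⟩ h
    have h1 : (p : ℕ) = p' :=
      (Nat.prime_dvd_prime_iff_eq p.2 p'.2).1 (p.2.dvd_of_dvd_pow
        ((dvd_pow_self (p : ℕ) (by omega)).trans (dvd_of_eq h)))
    simp only [hi, h1] at h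
    have h2 := Nat.pow_right_injective p'.2.two_le h
    exact Prod.ext (Subtype.ext h1) (by simpa using h2)
  refine (hinj.summable_iff ?_).1 ?_
  · intro n hn
    rw [mul_eq_zero]
    left
    by_contra hne
    unfold properPowers at hne
    rw [ite_eq_left_iff, Classical.not_imp] at hne
    obtain ⟨hnp, hne⟩ := hne
    rw [residueClass, ← ne_eq, Set.indicator_apply_ne_zero] at hne
    obtain ⟨hmem, hΛ⟩ := hne
    obtain ⟨p, k, hp, hk, rfl⟩ := (isPrimePow_nat_iff n).1 (vonMangoldt_ne_zero_iff.1 hΛ)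
    have hk1 : k ≠ 1 := by
      rintro rfl
      exact hnp (by simpa using hp)
    have hkm : m ≤ k := by
      by_contra h
      exact ha p k hp (by omega) (by omega) hmem
    exact hn ⟨(⟨p, hp⟩, k - m), by simp [hi, Nat.sub_add_cancel hkm]⟩
  · have h2 : (2 : ℝ) ^ (-σ) < 1 := Real.rpow_lt_one_of_one_lt_of_neg (by norm_num) (by linarith)
    have hg := summable_geometric_of_lt_one (by positivity) h2
    have hf := summable_primes_log_mul_rpow hσ
    have hfg := hf.mul_of_nonneg hg (fun p =>
      mul_nonneg (Real.log_nonneg (by exact_mod_cast p.2.one_lt.le)) (by positivity))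
      (fun k => by positivity)
    refine hfg.of_nonneg_of_le (fun pk => mul_nonneg (properPowers_nonneg _) (by positivity)) ?_
    rintro ⟨p, k⟩
    have hp : (0 : ℝ) < p := by exact_mod_cast p.2.pos
    have hp2 : (2 : ℝ) ≤ p := by exact_mod_cast p.2.two_le
    have hlog : 0 ≤ Real.log p := Real.log_nonneg (by linarith)
    have h3 : properPowers a (i (p, k)) ≤ Real.log p := by
      unfold properPowers
      split_ifs with h
      · exact hlog
      · refine (residueClass_le a _).trans ?_
        rw [hi, vonMangoldt_apply_pow (by simp; omega), vonMangoldt_apply_prime p.2]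
    have h4 : ((i (p, k) : ℕ) : ℝ) ^ (-σ) = (p : ℝ) ^ (-(m * σ)) * ((p : ℝ) ^ (-σ)) ^ k := by
      simp only [hi]
      push_cast
      rw [← Real.rpow_natCast, ← Real.rpow_mul hp.le, ← Real.rpow_natCast ((p : ℝ) ^ (-σ)),
        ← Real.rpow_mul hp.le, ← Real.rpow_add hp]
      congr 1
      push_cast
      ring
    have h5 : (p : ℝ) ^ (-σ) ≤ 2 ^ (-σ) :=
      Real.rpow_le_rpow_of_nonpos (by norm_num) hp2 (by linarith)
    simp only [Function.comp_apply]
    rw [h4, mul_assoc (Real.log p)]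
    gcongr

/-- The Dirichlet series over proper prime powers in the class `a` converges absolutely to the
right of `1 / m` if no `k`-th power with `2 ≤ k < m` of a prime lies in that class. -/
theorem abscissaOfAbsConv_properPowers_le {m : ℕ} (hm : 2 ≤ m)
    (ha : ∀ p k : ℕ, p.Prime → 2 ≤ k → k < m → ((p ^ k : ℕ) : ZMod q) ≠ a) {x : ℝ}
    (hx : 1 ≤ m * x) : LSeries.abscissaOfAbsConv (fun n => (properPowers a n : ℂ)) ≤ (x : EReal) := by
  refine LSeries.abscissaOfAbsConv_le_of_forall_lt_LSeriesSummable fun y hy => ?_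
  have hm0 : (0 : ℝ) < m := by positivity
  have h := summable_properPowers hm ha (σ := y) (by nlinarith)
  refine Summable.of_norm (h.congr fun n => ?_)
  rw [LSeries.norm_term_eq]
  split_ifs with h0
  · subst h0
    simp [properPowers]
  · rw [Complex.norm_real, Real.norm_eq_abs, abs_of_nonneg (properPowers_nonneg n),
      Complex.ofReal_re, Real.rpow_neg (by positivity), div_eq_mul_inv]

end PrimePowers

section Theta

variable (q : ℕ) (a : ℤ)

/-- The coefficients `log p` on the primes in the residue class `a` mod `q`. -/
noncomputable def primeLog (n : ℕ) : ℝ :=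
  if n.Prime ∧ (n : ZMod q) = (a : ZMod q) then Real.log n else 0

theorem primeLog_nonneg (n : ℕ) : 0 ≤ primeLog q a n := by
  unfold primeLog
  split_ifs with h
  exacts [Real.log_nonneg (by exact_mod_cast h.1.one_lt.le), le_rfl]

theorem thetaAP_eq_sum (x : ℝ) : thetaAP q a x = ∑ n ∈ Finset.Icc 1 ⌊x⌋₊, primeLog q a n := by
  rw [thetaAP, primesUpTo, Finset.sum_filter]
  rfl

theorem thetaAP_eq_sum_Icc_zero (x : ℝ) :
    thetaAP q a x = ∑ n ∈ Finset.Icc 0 ⌊x⌋₊, primeLog q a n := by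
  rw [thetaAP_eq_sum, ← Finset.sum_Ioc_add_eq_sum_Icc (Nat.zero_le _)]
  simp [primeLog]
  rfl

theorem thetaAP_nonneg (x : ℝ) : 0 ≤ thetaAP q a x := by
  rw [thetaAP_eq_sum]
  exact Finset.sum_nonneg fun n _ => primeLog_nonneg q a n

theorem thetaAP_mono : Monotone (thetaAP q a) := fun x y h => by
  rw [thetaAP_eq_sum, thetaAP_eq_sum]
  exact Finset.sum_le_sum_of_subset_of_nonneg
    (Finset.Icc_subset_Icc le_rfl (Nat.floor_le_floor h)) fun n _ _ => primeLog_nonneg q a n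

theorem thetaAP_le_theta (x : ℝ) : thetaAP q a x ≤ Chebyshev.theta x := by
  rw [thetaAP, Chebyshev.theta]
  refine Finset.sum_le_sum_of_subset_of_nonneg ?_ fun p hp _ => ?_
  · intro p hp
    simp only [primesUpTo, Finset.mem_filter] at hp ⊢
    exact ⟨hp.1, hp.2.1⟩
  · exact Real.log_nonneg (by exact_mod_cast (Finset.mem_filter.1 hp).2.one_lt.le)

theorem thetaAP_le {x : ℝ} (hx : 0 ≤ x) : thetaAP q a x ≤ 2 * x := by
  refine (thetaAP_le_theta q a x).trans ((Chebyshev.theta_le_log4_mul_x hx).trans ?_)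
  have : Real.log 4 ≤ 2 := by
    have h : (4 : ℝ) = 2 ^ 2 := by norm_num
    rw [h, Real.log_pow]
    have := Real.log_two_lt_d9
    push_cast
    linarith
  gcongr

/-- Right continuity of θ is what gives K a right derivative at every point. -/
theorem thetaAP_eventually_const {x : ℝ} (hx : 0 ≤ x) :
    ∀ᶠ y in 𝓝[≥] x, thetaAP q a y = thetaAP q a x := by
  have h : ∀ᶠ y in 𝓝[≥] x, y < (⌊x⌋₊ : ℝ) + 1 :=
    nhdsWithin_le_nhds (Iio_mem_nhds (Nat.lt_floor_add_one x))
  filter_upwards [h, self_mem_nhdsWithin] with y hy hxy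
  have : ⌊y⌋₊ = ⌊x⌋₊ :=
    le_antisymm (Nat.lt_succ_iff.1 ((Nat.floor_lt (hx.trans hxy)).2 (by exact_mod_cast hy)))
      (Nat.floor_le_floor hxy)
  rw [thetaAP_eq_sum, thetaAP_eq_sum, this]

/-- The error term `φ(q) θ(x;q,a) - x`. -/
noncomputable def thetaError (x : ℝ) : ℝ := q.totient * thetaAP q a x - x

theorem measurable_thetaError : Measurable (thetaError q a) :=
  ((thetaAP_mono q a).measurable.const_mul _).sub measurable_id

theorem abs_thetaError_le {x : ℝ} (hx : 0 ≤ x) :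
    |thetaError q a x| ≤ (2 * q.totient + 1) * x := by
  have h1 := mul_le_mul_of_nonneg_left (thetaAP_le q a hx) (Nat.cast_nonneg (α := ℝ) q.totient)
  have h2 := mul_nonneg (Nat.cast_nonneg (α := ℝ) q.totient) (thetaAP_nonneg q a x)
  have h3 := mul_nonneg (Nat.cast_nonneg (α := ℝ) q.totient) hx
  unfold thetaError
  rw [abs_le]
  constructor <;> linarith

theorem continuousWithinAt_thetaError {x : ℝ} (hx : 0 ≤ x) :
    ContinuousWithinAt (thetaError q a) (Ici x) x := by
  refine ContinuousWithinAt.sub (ContinuousWithinAt.mul continuousWithinAt_const ?_)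
    continuousWithinAt_id
  exact tendsto_const_nhds.congr' ((thetaAP_eventually_const q a hx).mono fun y hy => hy.symm)

end Theta

end PrimesAP

/-! ### 𝓛(s;q,a) as a quotient of entire functions -/

namespace PrimesAP

open MeasureTheory Set ArithmeticFunction ArithmeticFunction.vonMangoldt DirichletCharacter

theorem isUnit_intCast_of_isCoprime {q : ℕ} {a : ℤ} (hqa : IsCoprime a (q : ℤ)) :
    IsUnit (a : ZMod q) := by
  rwa [ZMod.coe_int_isUnit_iff_isCoprime, isCoprime_comm]

/-- The primes carry θ; the proper powers have a Dirichlet series that converges further to the left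
and is treated as a regular term. -/
theorem residueClass_eq_add (q : ℕ) (a : ℤ) (n : ℕ) :
    residueClass (a : ZMod q) n = primeLog q a n + properPowers (a : ZMod q) n := by
  unfold primeLog properPowers residueClass
  by_cases h : n.Prime <;> by_cases h2 : (n : ZMod q) = (a : ZMod q) <;>
    simp [h, h2, vonMangoldt_apply_prime]

section Characters

variable (q : ℕ) [NeZero q] (a : ℤ)

open scoped Classical in
/-- The Dirichlet `L`-function with the pole of the trivial character removed. -/
noncomputable def regL {q : ℕ} [NeZero q] (χ : DirichletCharacter ℂ q) : ℂ → ℂ :=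
  if χ = 1 then LFunctionTrivChar₁ q else LFunction χ

theorem differentiable_regL {q : ℕ} [NeZero q] (χ : DirichletCharacter ℂ q) :
    Differentiable ℂ (regL χ) := by
  unfold regL
  split_ifs with h
  exacts [differentiable_LFunctionTrivChar₁ q, differentiable_LFunction h]

theorem regL_ne_zero {q : ℕ} [NeZero q] (χ : DirichletCharacter ℂ q) {s : ℂ} (hs : 1 ≤ s.re) :
    regL χ s ≠ 0 := by
  unfold regL
  split_ifs with h
  · rcases eq_or_ne s 1 with rfl | hs1
    · exact LFunctionTrivChar₁_apply_one_ne_zero q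
    · rw [LFunctionTrivChar₁, Function.update_of_ne hs1]
      exact mul_ne_zero (sub_ne_zero.2 hs1) (LFunction_ne_zero_of_one_le_re _ (Or.inr hs1) hs)
  · exact LFunction_ne_zero_of_one_le_re χ (Or.inl h) hs

open scoped Classical in
theorem deriv_div_LFunction_eq {q : ℕ} [NeZero q] (χ : DirichletCharacter ℂ q) {s : ℂ}
    (hs : s ≠ 1) (h0 : regL χ s ≠ 0) :
    deriv (LFunction χ) s / LFunction χ s =
      deriv (regL χ) s / regL χ s - if χ = 1 then 1 / (s - 1) else 0 := by
  by_cases h : χ = 1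
  · subst h
    have e : regL (1 : DirichletCharacter ℂ q) = LFunctionTrivChar₁ q := by simp [regL]
    rw [e] at h0 ⊢
    rw [deriv_LFunctionTrivChar₁_apply_of_ne_one q hs, LFunctionTrivChar₁,
      Function.update_of_ne hs]
    rw [LFunctionTrivChar₁, Function.update_of_ne hs] at h0
    have h1 : s - 1 ≠ 0 := sub_ne_zero.2 hs
    have h2 : LFunctionTrivChar q s ≠ 0 := right_ne_zero_of_mul h0
    change deriv (LFunctionTrivChar q) s / LFunctionTrivChar q s = _
    simp only [if_true]
    field_simp
    ring
  · simp [regL, h]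

/-- The product of the regularized `L`-functions mod `q`. -/
noncomputable def prodL (s : ℂ) : ℂ := ∏ χ : DirichletCharacter ℂ q, regL χ s

open scoped Classical in
/-- The numerator of the regularization of `𝓛(s;q,a)` over the common denominator `prodL`. -/
noncomputable def numL (s : ℂ) : ℂ :=
  ∑ χ : DirichletCharacter ℂ q, starRingEnd ℂ (χ (a : ZMod q)) *
    (deriv (regL χ) s * ∏ ψ ∈ Finset.univ.erase χ, regL ψ s)

theorem differentiable_prodL : Differentiable ℂ (prodL q) := by
  unfold prodL
  exact Differentiable.fun_finsetProd fun χ _ => differentiable_regL χ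

theorem differentiable_numL : Differentiable ℂ (numL q a) := by
  unfold numL
  refine Differentiable.fun_sum fun χ _ => ((differentiable_regL χ).deriv.mul
    (Differentiable.fun_finsetProd fun ψ _ => differentiable_regL ψ)).const_mul _

theorem prodL_ne_zero {s : ℂ} (hs : 1 ≤ s.re) : prodL q s ≠ 0 :=
  Finset.prod_ne_zero_iff.2 fun χ _ => regL_ne_zero χ hs

/-- Only the trivial character has a pole, at s = 1, and its coefficient is 1 because a is a unit.
Adding 1/(s−1) therefore turns every L′/L into the logarithmic derivative of the regularized
function. -/
theorem prodL_mul_scriptL (hqa : IsCoprime a (q : ℤ)) {s : ℂ} (hs : s ≠ 1)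
    (h0 : prodL q s ≠ 0) : prodL q s * (scriptL q a s + 1 / (s - 1)) = numL q a s := by
  classical
  have hne : ∀ χ : DirichletCharacter ℂ q, regL χ s ≠ 0 := fun χ =>
    Finset.prod_ne_zero_iff.1 h0 χ (Finset.mem_univ _)
  have hu : IsUnit (a : ZMod q) := isUnit_intCast_of_isCoprime hqa
  have h1 : scriptL q a s + 1 / (s - 1) = ∑ χ : DirichletCharacter ℂ q,
      starRingEnd ℂ (χ (a : ZMod q)) * (deriv (regL χ) s / regL χ s) := by
    rw [scriptL]
    simp_rw [deriv_div_LFunction_eq _ hs (hne _), mul_sub]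
    rw [Finset.sum_sub_distrib]
    simp [MulChar.one_apply hu]
  rw [h1, numL, Finset.mul_sum]
  refine Finset.sum_congr rfl fun χ _ => ?_
  rw [prodL, ← Finset.mul_prod_erase _ _ (Finset.mem_univ χ)]
  have := hne χ
  field_simp

theorem eventually_prodL_ne_zero (s : ℂ) : ∀ᶠ w in 𝓝[≠] s, prodL q w ≠ 0 := by
  by_contra hcon
  have h1 : AnalyticOnNhd ℂ (prodL q) univ := fun z _ => (differentiable_prodL q).analyticAt z
  exact prodL_ne_zero q (s := 1) (by simp) (h1.eqOn_zero_of_preconnected_of_frequently_eq_zero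
    isPreconnected_univ (mem_univ s) (by rw [Filter.Frequently]; exact hcon) (mem_univ 1))

/-- Away from `s = 1`, the point `s` is not a singularity of `𝓛(s;q,a)` exactly if the quotient
`numL / prodL` is regular at `s`. -/
theorem not_isSingularity_iff (hqa : IsCoprime a (q : ℤ)) {s : ℂ} (hs : s ≠ 1) :
    ¬ IsSingularity (scriptL q a) s ↔
      ∃ j : ℂ → ℂ, AnalyticAt ℂ j s ∧ ∀ᶠ w in 𝓝 s, prodL q w * j w = numL q a w := by
  have hinv : AnalyticAt ℂ (fun w : ℂ => 1 / (w - 1)) s :=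
    analyticAt_const.div (analyticAt_id.sub analyticAt_const) (sub_ne_zero.2 hs)
  have hne1 : ∀ᶠ w in 𝓝[≠] s, w ≠ 1 := nhdsWithin_le_nhds (isOpen_ne.mem_nhds hs)
  rw [IsSingularity, not_not]
  constructor
  · rintro ⟨g, hg, hgs⟩
    refine ⟨fun w => g w + 1 / (w - 1), hg.add hinv, ?_⟩
    -- Singularities are defined by punctured neighbourhoods. Two analytic functions agreeing there
    -- also agree at the centre.
    refine (AnalyticAt.frequently_eq_iff_eventually_eq
      (((differentiable_prodL q).analyticAt s).mul (hg.add hinv))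
      ((differentiable_numL q a).analyticAt s)).1 (Eventually.frequently ?_)
    filter_upwards [hgs, hne1, eventually_prodL_ne_zero q s] with w h1 h2 h3
    simp only [Pi.mul_apply, Pi.add_apply]
    rw [← h1]
    exact prodL_mul_scriptL q a hqa h2 h3
  · rintro ⟨j, hj, hjs⟩
    refine ⟨fun w => j w - 1 / (w - 1), hj.sub hinv, ?_⟩
    filter_upwards [nhdsWithin_le_nhds hjs, hne1, eventually_prodL_ne_zero q s] with w h1 h2 h3
    have := prodL_mul_scriptL q a hqa h2 h3
    rw [← h1] at this
    rw [← mul_left_cancel₀ h3 this]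
    ring

/-- In the variable z = 1 − s this is z = 0, the first real point to be crossed; it rests on L(1,χ)
≠ 0. -/
theorem exists_regular_at_one :
    ∃ j : ℂ → ℂ, AnalyticAt ℂ j 1 ∧ ∀ᶠ w in 𝓝 1, prodL q w * j w = numL q a w := by
  have h0 := prodL_ne_zero q (s := 1) (by simp)
  refine ⟨fun w => numL q a w / prodL q w, ((differentiable_numL q a).analyticAt 1).div
    ((differentiable_prodL q).analyticAt 1) h0, ?_⟩
  filter_upwards [(differentiable_prodL q).continuous.continuousAt.eventually_ne h0] with w hw
  field_simp

/-- Orthogonality of characters isolates the residue class; the sign comes from −L′/L being the von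
Mangoldt series. -/
theorem scriptL_eq_LSeries (hqa : IsCoprime a (q : ℤ)) {s : ℂ} (hs : 1 < s.re) :
    scriptL q a s = -(q.totient * LSeries (fun n => (residueClass (a : ZMod q) n : ℂ)) s) := by
  have hu : IsUnit (a : ZMod q) := isUnit_intCast_of_isCoprime hqa
  have hφ : (q.totient : ℂ) ≠ 0 := mod_cast (Nat.totient_pos.mpr q.pos_of_neZero).ne'
  rw [LSeries_residueClass_eq hu hs, scriptL]
  have : ∀ χ : DirichletCharacter ℂ q, starRingEnd ℂ (χ (a : ZMod q)) = χ (a : ZMod q)⁻¹ := by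
    intro χ
    rw [starRingEnd_apply, MulChar.star_apply', MulChar.inv_apply_eq_inv']
    refine (eq_inv_of_mul_eq_one_left ?_).symm
    rw [← map_mul, ZMod.inv_mul_of_unit _ hu, map_one]
  simp_rw [this]
  field_simp

end Characters

end PrimesAP

/-! ### The Mellin transform V of φ(q)θ(t;q,a) − t -/

namespace PrimesAP

open MeasureTheory Set ArithmeticFunction ArithmeticFunction.vonMangoldt Asymptotics

section Transform

theorem sum_primeLog_isBigO (q : ℕ) (a : ℤ) :
    (fun n : ℕ => ∑ k ∈ Finset.Icc 1 n, primeLog q a k) =O[atTop] fun n : ℕ => (n : ℝ) ^ (1 : ℝ) := by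
  refine IsBigO.of_bound 2 (Eventually.of_forall fun n => ?_)
  have h := thetaAP_le q a (Nat.cast_nonneg (α := ℝ) n)
  have h0 := thetaAP_nonneg q a n
  rw [thetaAP_eq_sum, Nat.floor_natCast] at h h0
  rw [Real.norm_eq_abs, Real.rpow_one, Real.norm_eq_abs, abs_of_nonneg h0, Nat.abs_cast]
  exact h

/-- `(1 - z) ∫_1^∞ θ(t) t^{z-2} dt = ∑ log p / p^{1-z}` over the primes in the class. -/
theorem mul_tailMellin_thetaAP (q : ℕ) (a : ℤ) {z : ℂ} (hz : z.re < 0) :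
    (1 - z) * tailMellin (fun t => thetaAP q a t / t) 1 z =
      LSeries (fun n => (primeLog q a n : ℂ)) (1 - z) := by
  rw [LSeries_eq_mul_integral_of_nonneg (primeLog q a) zero_le_one (s := 1 - z)
    (by simp; linarith) (sum_primeLog_isBigO q a) (primeLog_nonneg q a), tailMellin]
  congr 1
  refine setIntegral_congr_fun measurableSet_Ioi fun t ht => ?_
  have ht0 : (0 : ℝ) < t := one_pos.trans ht
  have ht0' : (t : ℂ) ≠ 0 := Complex.ofReal_ne_zero.2 ht0.ne'
  have e : (t : ℂ) ^ (z - 1) = (t : ℂ) ^ (-(1 - z + 1)) * t := by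
    rw [show z - 1 = -(1 - z + 1) + 1 by ring, Complex.cpow_add _ _ ht0', Complex.cpow_one]
  rw [thetaAP_eq_sum, e]
  push_cast
  field_simp

/-- The term −t of S contributes (1−z)/z, whose pole at z = 0 compensates that of the prime series.
-/
theorem mul_tailMellin_thetaError (q : ℕ) (a : ℤ) {z : ℂ} (hz : z.re < 0) :
    (1 - z) * tailMellin (fun t => thetaError q a t / t) 1 z =
      q.totient * LSeries (fun n => (primeLog q a n : ℂ)) (1 - z) + (1 - z) / z := by
  have hz0 : z ≠ 0 := by rintro rfl; simp at hz
  have hθm : Measurable fun t => thetaAP q a t / t := (thetaAP_mono q a).measurable.div measurable_id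
  have hθ : LogBounded (fun t => thetaAP q a t / t) 1 :=
    LogBounded.of_bounded le_rfl fun t ht => by
      have ht0 : (0 : ℝ) < t := one_pos.trans ht
      rw [abs_of_nonneg (div_nonneg (thetaAP_nonneg q a t) ht0.le), div_le_iff₀ ht0]
      exact thetaAP_le q a ht0.le
  have h1 := (hθ.integrableOn one_pos hθm hz).const_mul (q.totient : ℂ)
  have h2 := integrableOn_rpow_tail one_pos (b := 0) (z := z) hz
  have h3 := tailMellin_rpow one_pos (b := 0) (z := z) hz
  have e : tailMellin (fun t => thetaError q a t / t) 1 z =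
      q.totient * tailMellin (fun t => thetaAP q a t / t) 1 z -
        tailMellin (fun t => t ^ (-(0 : ℝ))) 1 z := by
    simp only [tailMellin]
    rw [← integral_const_mul, ← integral_sub h1 h2]
    refine setIntegral_congr_fun measurableSet_Ioi fun t ht => ?_
    have ht0 : (t : ℂ) ≠ 0 := Complex.ofReal_ne_zero.2 (one_pos.trans ht).ne'
    simp only [thetaError, neg_zero, Real.rpow_zero]
    push_cast
    field_simp
  rw [e, mul_sub, mul_left_comm, mul_tailMellin_thetaAP q a hz, h3]
  simp
  field_simp
  ring

/-- The transform of a function supported in a bounded interval is entire. -/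
theorem differentiable_tailMellin_of_bounded_support {f : ℝ → ℝ} {B X : ℝ} (hfm : Measurable f)
    (hB : ∀ t > 1, |f t| ≤ B) (hX : ∀ t > X, f t = 0) : Differentiable ℂ (tailMellin f 1) := by
  intro z
  have hl := LogBounded.of_bounded (f := f) le_rfl hB
  have htop : (fun t => (((Ioi 1).indicator f t : ℝ) : ℂ)) =O[atTop]
      (fun t : ℝ => t ^ (-(z.re + 1))) := by
    refine IsBigO.of_bound 0 ?_
    filter_upwards [eventually_gt_atTop X] with t ht
    simp [indicator, hX t ht]
  have e1 : tailMellin f 1 = mellin (fun t => (((Ioi 1).indicator f t : ℝ) : ℂ)) :=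
    funext fun z => tailMellin_eq_mellin zero_le_one f z
  rw [e1]
  exact mellin_differentiableAt_of_isBigO_rpow (s := z) (hl.locallyIntegrableOn hfm)
    htop (by linarith) (isBigO_zero_indicator one_pos f (z.re - 1)) (by linarith)

variable (q : ℕ) (a : ℤ) (x₀ : ℝ)

/-- The entire function `∫_1^{x₀} (φ(q) θ(t;q,a) - t) t^{z-2} dt`. -/
noncomputable def headTransform (z : ℂ) : ℂ :=
  tailMellin ((Iic x₀).indicator fun t => thetaError q a t / t) 1 z

theorem abs_thetaError_div_le {t : ℝ} (ht : 0 < t) :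
    |thetaError q a t / t| ≤ 2 * q.totient + 1 := by
  rw [abs_div, abs_of_pos ht, div_le_iff₀ ht]
  exact abs_thetaError_le q a ht.le

theorem measurable_thetaError_div : Measurable fun t => thetaError q a t / t :=
  (measurable_thetaError q a).div measurable_id

theorem abs_indicator_thetaError_div_le {t : ℝ} (ht : 0 < t) :
    |(Iic x₀).indicator (fun t => thetaError q a t / t) t| ≤ 2 * q.totient + 1 := by
  by_cases h : t ≤ x₀
  · rw [indicator_of_mem (show t ∈ Iic x₀ from h)]
    exact abs_thetaError_div_le q a ht
  · rw [indicator_of_notMem (show t ∉ Iic x₀ from h), abs_zero]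
    positivity

theorem differentiable_headTransform : Differentiable ℂ (headTransform q a x₀) := by
  refine differentiable_tailMellin_of_bounded_support (B := 2 * q.totient + 1) (X := x₀)
    ((measurable_thetaError_div q a).indicator measurableSet_Iic)
    (fun t ht => abs_indicator_thetaError_div_le q a x₀ (one_pos.trans ht)) fun t ht =>
      indicator_of_notMem (by simpa using ht) _

/-- A one-sided bound holds only from some x₀ on; moving the lower limit there changes V by an
entire function. -/
theorem tailMellin_thetaError_eq (hx₀ : 1 ≤ x₀) {z : ℂ} (hz : z.re < 0) :
    tailMellin (fun t => thetaError q a t / t) x₀ z =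
      tailMellin (fun t => thetaError q a t / t) 1 z - headTransform q a x₀ z := by
  have h1 := (LogBounded.of_bounded le_rfl fun t ht =>
    abs_thetaError_div_le q a (one_pos.trans ht)).integrableOn one_pos
    (measurable_thetaError_div q a) hz
  have h2 := (LogBounded.of_bounded le_rfl fun t ht =>
    abs_indicator_thetaError_div_le q a x₀ (one_pos.trans ht)).integrableOn one_pos
    ((measurable_thetaError_div q a).indicator measurableSet_Iic) hz
  simp only [headTransform, tailMellin]
  rw [← integral_sub h1 h2, ← integral_indicator measurableSet_Ioi,
    ← integral_indicator measurableSet_Ioi]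
  congr 1
  ext t
  by_cases ht : x₀ < t
  · simp [indicator, ht, hx₀.trans_lt ht, not_le.2 ht]
  · simp [indicator, ht, not_lt.1 ht]

/-- The common denominator of the transform of `φ(q) θ(t;q,a) - t`. -/
noncomputable def transDen [NeZero q] (z : ℂ) : ℂ := (1 - z) * prodL q (1 - z)

/-- The numerator of the transform of `φ(q) θ(t;q,a) - t`. -/
noncomputable def transNum [NeZero q] (z : ℂ) : ℂ :=
  -numL q a (1 - z) - prodL q (1 - z) * (1 + q.totient *
    LSeries (fun n => (properPowers (a : ZMod q) n : ℂ)) (1 - z) +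
    (1 - z) * headTransform q a x₀ z)

variable {q a x₀}

theorem properPowers_abscissa_le_half :
    LSeries.abscissaOfAbsConv (fun n => (properPowers (a : ZMod q) n : ℂ)) ≤
      ((1 / 2 : ℝ) : EReal) :=
  abscissaOfAbsConv_properPowers_le le_rfl (fun p k _ h1 h2 => absurd h1 (by omega)) (by norm_num)

theorem LSeriesSummable_primeLog {s : ℂ} (hs : 1 < s.re) :
    LSeriesSummable (fun n => (primeLog q a n : ℂ)) s := by
  refine LSeriesSummable_of_sum_norm_bigO (r := 1) ?_ zero_le_one hs
  simpa [abs_of_nonneg (primeLog_nonneg q a _)] using sum_primeLog_isBigO q a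

variable [NeZero q]

theorem totient_mul_LSeries_primeLog (hqa : IsCoprime a (q : ℤ)) {s : ℂ} (hs : 1 < s.re) :
    q.totient * LSeries (fun n => (primeLog q a n : ℂ)) s = -scriptL q a s -
      q.totient * LSeries (fun n => (properPowers (a : ZMod q) n : ℂ)) s := by
  have h2 : LSeriesSummable (fun n => (properPowers (a : ZMod q) n : ℂ)) s := by
    refine LSeriesSummable_of_abscissaOfAbsConv_lt_re
      (lt_of_le_of_lt properPowers_abscissa_le_half ?_)
    exact_mod_cast (by linarith : (1 / 2 : ℝ) < s.re)
  have h3 := LSeries_add (LSeriesSummable_primeLog (q := q) (a := a) hs) h2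
  have h4 : ((fun n => (primeLog q a n : ℂ)) + fun n => (properPowers (a : ZMod q) n : ℂ)) =
      fun n => (residueClass (a : ZMod q) n : ℂ) := by
    ext n
    rw [residueClass_eq_add]
    push_cast
    rfl
  rw [h4] at h3
  rw [scriptL_eq_LSeries q a hqa hs, h3]
  ring

/-- With s = 1 − z one has (1−z)/z = 1/z − 1 and 1/(s−1) = −1/z. The 1/z thus completes 𝓛 to
numL/prodL, leaving −1, the proper powers and the head. -/
theorem transDen_mul_tailMellin (hqa : IsCoprime a (q : ℤ)) (hx₀ : 1 ≤ x₀) {z : ℂ}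
    (hz : z.re < 0) :
    transDen q z * tailMellin (fun t => thetaError q a t / t) x₀ z = transNum q a x₀ z := by
  have hs : 1 < (1 - z).re := by
    simp
    linarith
  have hz0 : z ≠ 0 := by rintro rfl; simp at hz
  have hs1 : 1 - z ≠ 1 := by simpa using hz0
  have h1 := mul_tailMellin_thetaError q a hz
  rw [totient_mul_LSeries_primeLog hqa hs] at h1
  have h2 := prodL_mul_scriptL q a hqa hs1 (prodL_ne_zero q hs.le)
  rw [tailMellin_thetaError_eq q a x₀ hx₀ hz, transDen, transNum, ← h2]
  have h3 : (1 : ℂ) / (1 - z - 1) = -1 / z := by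
    field_simp
    ring
  have h4 : (1 - z) / z = 1 / z - 1 := by
    field_simp
  rw [h3]
  rw [h4] at h1
  linear_combination prodL q (1 - z) * h1

theorem differentiable_one_sub : Differentiable ℂ fun z : ℂ => 1 - z := by fun_prop

theorem differentiable_transDen : Differentiable ℂ (transDen q) :=
  differentiable_one_sub.mul ((differentiable_prodL q).comp differentiable_one_sub)

theorem differentiableOn_transNum {b : ℝ} (hb : LSeries.abscissaOfAbsConv
    (fun n => (properPowers (a : ZMod q) n : ℂ)) ≤ ((1 - b : ℝ) : EReal)) :
    DifferentiableOn ℂ (transNum q a x₀) {z | z.re < b} := by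
  have h1 : DifferentiableOn ℂ
      (fun z => LSeries (fun n => (properPowers (a : ZMod q) n : ℂ)) (1 - z)) {z | z.re < b} := by
    refine (LSeries_differentiableOn _).comp differentiable_one_sub.differentiableOn fun z hz => ?_
    refine lt_of_le_of_lt hb ?_
    have : z.re < b := hz
    exact_mod_cast (by simpa using this : 1 - b < (1 - z).re)
  have h2 := ((differentiable_numL q a).comp differentiable_one_sub).differentiableOn
    (s := {z : ℂ | z.re < b})
  have h3 := ((differentiable_prodL q).comp differentiable_one_sub).differentiableOn
    (s := {z : ℂ | z.re < b})
  have h4 := (differentiable_one_sub.mul (differentiable_headTransform q a x₀)).differentiableOn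
    (s := {z : ℂ | z.re < b})
  exact h2.neg.sub (h3.mul (((h1.const_mul (q.totient : ℂ)).const_add 1).add h4))

/-- Regularity of `transNum / transDen` at `z` is regularity of `numL / prodL` at `1 - z`. -/
theorem regular_trans_iff {b : ℝ} (hb : LSeries.abscissaOfAbsConv
    (fun n => (properPowers (a : ZMod q) n : ℂ)) ≤ ((1 - b : ℝ) : EReal)) {z : ℂ}
    (hz : z.re < b) (hz1 : z ≠ 1) :
    (∃ g : ℂ → ℂ, AnalyticAt ℂ g z ∧ ∀ᶠ w in 𝓝 z, transDen q w * g w = transNum q a x₀ w) ↔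
      ∃ j : ℂ → ℂ, AnalyticAt ℂ j (1 - z) ∧ ∀ᶠ s in 𝓝 (1 - z), prodL q s * j s = numL q a s := by
  have hsub : ∀ w : ℂ, AnalyticAt ℂ (fun z : ℂ => 1 - z) w := fun w =>
    differentiable_one_sub.analyticAt w
  have hpp : AnalyticAt ℂ (LSeries (fun n => (properPowers (a : ZMod q) n : ℂ))) (1 - z) := by
    refine LSeries_analyticOnNhd _ _ (lt_of_le_of_lt hb ?_)
    exact_mod_cast (by simpa using hz : 1 - b < (1 - z).re)
  have hhead : ∀ w, AnalyticAt ℂ (headTransform q a x₀) w := fun w =>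
    (differentiable_headTransform q a x₀).analyticAt w
  have ht : Tendsto (fun w : ℂ => 1 - w) (𝓝 z) (𝓝 (1 - z)) := (hsub z).continuousAt
  have ht' : Tendsto (fun w : ℂ => 1 - w) (𝓝 (1 - z)) (𝓝 z) := by
    simpa using (hsub (1 - z)).continuousAt.tendsto
  constructor
  · rintro ⟨g, hg, hgY⟩
    refine ⟨fun s => -(s * g (1 - s) + (1 + q.totient *
      LSeries (fun n => (properPowers (a : ZMod q) n : ℂ)) s + s * headTransform q a x₀ (1 - s))),
      ?_, ?_⟩
    · have h1 : AnalyticAt ℂ (fun s => g (1 - s)) (1 - z) :=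
        AnalyticAt.fun_comp (by simpa using hg) (hsub _)
      have h2 : AnalyticAt ℂ (fun s => headTransform q a x₀ (1 - s)) (1 - z) :=
        AnalyticAt.fun_comp (hhead _) (hsub _)
      exact ((analyticAt_id.mul h1).add ((analyticAt_const.add (analyticAt_const.mul hpp)).add
        (analyticAt_id.mul h2))).neg
    · filter_upwards [ht'.eventually hgY] with s hs
      simp only [transDen, transNum, sub_sub_cancel] at hs
      linear_combination -hs
  · rintro ⟨j, hj, hjs⟩
    have hne : (1 : ℂ) - z ≠ 0 := sub_ne_zero.2 (Ne.symm hz1)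
    refine ⟨fun w => (-j (1 - w) - (1 + q.totient *
      LSeries (fun n => (properPowers (a : ZMod q) n : ℂ)) (1 - w) +
      (1 - w) * headTransform q a x₀ w)) / (1 - w), ?_, ?_⟩
    · have h1 : AnalyticAt ℂ (fun w => j (1 - w)) z := AnalyticAt.fun_comp hj (hsub _)
      have h2 : AnalyticAt ℂ (fun w => LSeries (fun n => (properPowers (a : ZMod q) n : ℂ)) (1 - w))
        z := AnalyticAt.fun_comp hpp (hsub _)
      have h3 := hhead z
      exact AnalyticAt.div (by fun_prop) (hsub z) hne
    · filter_upwards [ht.eventually hjs, (hsub z).continuousAt.eventually_ne hne] with w hw hw0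
      simp only [transDen, transNum]
      rw [← hw]
      field_simp

end Transform

end PrimesAP

/-! ### The antiderivative K -/

namespace PrimesAP

open MeasureTheory Set

section Antiderivative

/-- The antiderivative `-∫_2^x S(t) w(t) dt` of `-S w`, constant on `(-∞, 2]`. -/
noncomputable def weightedAntideriv (S : ℝ → ℝ) (x : ℝ) : ℝ :=
  -∫ t in (2 : ℝ)..x, (Ici 2).indicator (fun t => S t * logWeight t) t

variable {S : ℝ → ℝ} {C : ℝ}

theorem measurable_indicator_weight (hSm : Measurable S) :
    Measurable ((Ici (2 : ℝ)).indicator fun t => S t * logWeight t) :=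
  (hSm.mul measurable_logWeight).indicator measurableSet_Ici

theorem nonneg_of_bound (hS : ∀ t ≥ 2, |S t| ≤ C * t) : 0 ≤ C := by
  have := (abs_nonneg _).trans (hS 2 le_rfl)
  linarith

theorem abs_indicator_weight_le (hS : ∀ t ≥ 2, |S t| ≤ C * t) {t : ℝ} (ht : 1 < t) :
    |(Ici (2 : ℝ)).indicator (fun t => S t * logWeight t) t| ≤ 3 * C * (1 / (t * Real.log t)) := by
  have hC := nonneg_of_bound hS
  have hl := Real.log_pos ht
  by_cases h : 2 ≤ t
  · rw [indicator_of_mem (show t ∈ Ici (2 : ℝ) from h), mul_one_div]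
    exact abs_mul_logWeight_le (hS t h) h
  · rw [indicator_of_notMem (show t ∉ Ici (2 : ℝ) from h), abs_zero]
    positivity

theorem intervalIntegrable_weight (hSm : Measurable S) (hS : ∀ t ≥ 2, |S t| ≤ C * t) (x y : ℝ) :
    IntervalIntegrable ((Ici (2 : ℝ)).indicator fun t => S t * logWeight t) volume x y := by
  have hC := nonneg_of_bound hS
  have h : IntervalIntegrable (fun _ : ℝ => 6 * C) volume x y := intervalIntegrable_const
  refine h.mono_fun (measurable_indicator_weight hSm).aestronglyMeasurable
    (Eventually.of_forall fun t => ?_)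
  change |_| ≤ |6 * C|
  rw [abs_of_nonneg (by positivity : 0 ≤ 6 * C)]
  by_cases ht : 2 ≤ t
  · refine (abs_indicator_weight_le hS (by linarith)).trans ?_
    have h1 := half_le_log ht
    have h2 : 1 / (t * Real.log t) ≤ 1 := by
      rw [div_le_one (by positivity)]
      nlinarith
    nlinarith
  · rw [indicator_of_notMem (show t ∉ Ici (2 : ℝ) from ht), abs_zero]
    positivity

theorem continuous_weightedAntideriv (hSm : Measurable S) (hS : ∀ t ≥ 2, |S t| ≤ C * t) :
    Continuous (weightedAntideriv S) :=
  (intervalIntegral.continuous_primitive (intervalIntegrable_weight hSm hS) 2).neg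

theorem weightedAntideriv_of_le {x : ℝ} (hx : x ≤ 2) : weightedAntideriv S x = 0 := by
  rw [weightedAntideriv, intervalIntegral.integral_of_ge hx, neg_neg,
    ← integral_indicator measurableSet_Ioc]
  have : ((Ioc x 2).indicator ((Ici (2 : ℝ)).indicator fun t => S t * logWeight t)) =ᵐ[volume]
      fun _ => 0 := by
    filter_upwards [(measure_singleton (μ := volume) (2 : ℝ) : volume {(2 : ℝ)} = 0) |>
      measure_eq_zero_iff_ae_notMem.1] with t ht
    by_cases h : t ∈ Ioc x 2
    · rw [indicator_of_mem h, indicator_of_notMem]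
      intro h2
      exact ht (le_antisymm h.2 h2)
    · rw [indicator_of_notMem h]
  rw [integral_congr_ae this, integral_zero]

theorem weightedAntideriv_sub (hSm : Measurable S) (hS : ∀ t ≥ 2, |S t| ≤ C * t) {x y : ℝ}
    (hx : 2 ≤ x) (hxy : x ≤ y) :
    weightedAntideriv S x - weightedAntideriv S y = ∫ t in x..y, S t * logWeight t := by
  have h := intervalIntegral.integral_add_adjacent_intervals
    (intervalIntegrable_weight hSm hS 2 x) (intervalIntegrable_weight hSm hS x y)
  have e : weightedAntideriv S x - weightedAntideriv S y =
      ∫ t in x..y, (Ici (2 : ℝ)).indicator (fun t => S t * logWeight t) t := by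
    rw [weightedAntideriv, weightedAntideriv, ← h]
    ring
  rw [e]
  refine intervalIntegral.integral_congr fun t ht => ?_
  rw [uIcc_of_le hxy] at ht
  exact indicator_of_mem (show t ∈ Ici (2 : ℝ) from hx.trans ht.1) _

theorem continuousAt_logWeight {x : ℝ} (hx : 2 ≤ x) : ContinuousAt logWeight x := by
  have h1 := half_le_log hx
  have h2 : x ≠ 0 := by linarith
  have h3 : Real.log x ≠ 0 := by linarith
  unfold logWeight
  exact (continuousAt_const.add (Real.continuousAt_log h2)).div
    ((continuousAt_id.mul (Real.continuousAt_log h2)).pow 2) (by positivity)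

theorem weightedAntideriv_hasDerivWithinAt (hSm : Measurable S) (hS : ∀ t ≥ 2, |S t| ≤ C * t)
    {x : ℝ} (hx : 2 ≤ x) (hSx : ContinuousWithinAt S (Ici x) x) :
    HasDerivWithinAt (weightedAntideriv S) (-(S x * logWeight x)) (Ici x) x := by
  have hc : ContinuousWithinAt ((Ici (2 : ℝ)).indicator fun t => S t * logWeight t) (Ici x) x := by
    have h1 : ContinuousWithinAt (fun t => S t * logWeight t) (Ici x) x :=
      hSx.mul (continuousAt_logWeight hx).continuousWithinAt
    exact h1.congr (fun y hy => indicator_of_mem (show y ∈ Ici (2 : ℝ) from hx.trans hy) _)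
      (indicator_of_mem (show x ∈ Ici (2 : ℝ) from hx) _)
  have h := intervalIntegral.integral_hasDerivWithinAt_right
    (intervalIntegrable_weight hSm hS 2 x) (s := Ici x) (t := Ioi x)
    ((measurable_indicator_weight hSm).stronglyMeasurable.stronglyMeasurableAtFilter)
    (hc.mono Ioi_subset_Ici_self)
  rw [indicator_of_mem (show x ∈ Ici (2 : ℝ) from hx)] at h
  exact h.neg

theorem hasDerivAt_log_log {t : ℝ} (ht : 1 < t) :
    HasDerivAt (fun t => Real.log (Real.log t)) (1 / (t * Real.log t)) t := by
  have h1 : t ≠ 0 := by linarith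
  have h2 := Real.log_pos ht
  convert (Real.hasDerivAt_log h1).log h2.ne' using 1
  field_simp

/-- The integrand is at most 3C/(t log t), with primitive 3C log log t. Starting at x > 1 rather
than 2 costs nothing because K is constant below 2. -/
theorem abs_weightedAntideriv_sub_le (hSm : Measurable S) (hS : ∀ t ≥ 2, |S t| ≤ C * t) {x y : ℝ}
    (hx : 1 < x) (hxy : x ≤ y) : |weightedAntideriv S x - weightedAntideriv S y| ≤
      3 * C * (Real.log (Real.log y) - Real.log (Real.log x)) := by
  have h := intervalIntegral.integral_add_adjacent_intervals
    (intervalIntegrable_weight hSm hS 2 x) (intervalIntegrable_weight hSm hS x y)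
  have e : weightedAntideriv S x - weightedAntideriv S y =
      ∫ t in x..y, (Ici (2 : ℝ)).indicator (fun t => S t * logWeight t) t := by
    rw [weightedAntideriv, weightedAntideriv, ← h]
    ring
  have hcont : ContinuousOn (fun t => 1 / (t * Real.log t)) (uIcc x y) := by
    rw [uIcc_of_le hxy]
    intro t ht
    have h1 : 1 < t := hx.trans_le ht.1
    have h2 := Real.log_pos h1
    have h3 : t ≠ 0 := by linarith
    exact (continuousAt_const.div (continuousAt_id.mul (Real.continuousAt_log h3))
      (mul_ne_zero h3 h2.ne')).continuousWithinAt
  have hint : IntervalIntegrable (fun t => 1 / (t * Real.log t)) volume x y :=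
    hcont.intervalIntegrable
  have hFTC : ∫ t in x..y, 1 / (t * Real.log t) = Real.log (Real.log y) - Real.log (Real.log x) := by
    refine intervalIntegral.integral_eq_sub_of_hasDerivAt
      (f := fun t => Real.log (Real.log t)) (fun t ht => ?_) hint
    rw [uIcc_of_le hxy] at ht
    exact hasDerivAt_log_log (hx.trans_le ht.1)
  rw [e, ← hFTC, ← intervalIntegral.integral_const_mul, ← Real.norm_eq_abs]
  refine intervalIntegral.norm_integral_le_of_norm_le hxy
    (Eventually.of_forall fun t ht => ?_) (hint.const_mul _)
  exact abs_indicator_weight_le hS (hx.trans ht.1)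

/-- With x = e^u the modulus log log x becomes log u, which is the Tauberian condition. -/
theorem weightedAntideriv_exp_logLipschitz (hSm : Measurable S) (hS : ∀ t ≥ 2, |S t| ≤ C * t)
    {u : ℝ} (hu : 0 < u) {v : ℝ} (hv : 0 < v) :
    |weightedAntideriv S (Real.exp u) - weightedAntideriv S (Real.exp v)| ≤
      3 * C * |Real.log u - Real.log v| := by
  rcases le_total u v with h | h
  · have h1 := abs_weightedAntideriv_sub_le hSm hS (Real.one_lt_exp_iff.2 hu) (Real.exp_le_exp.2 h)
    rw [Real.log_exp, Real.log_exp] at h1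
    rw [abs_sub_comm (Real.log u), abs_of_nonneg (sub_nonneg.2 (Real.log_le_log hu h))]
    exact h1
  · have h1 := abs_weightedAntideriv_sub_le hSm hS (Real.one_lt_exp_iff.2 hv) (Real.exp_le_exp.2 h)
    rw [Real.log_exp, Real.log_exp] at h1
    rw [abs_of_nonneg (sub_nonneg.2 (Real.log_le_log hv h)), abs_sub_comm]
    exact h1

theorem logBounded_weightedAntideriv (hSm : Measurable S) (hS : ∀ t ≥ 2, |S t| ≤ C * t) :
    LogBounded (weightedAntideriv S) 2 := by
  refine ⟨3 * C, fun t ht => ?_⟩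
  have hC := nonneg_of_bound hS
  have h1 := abs_weightedAntideriv_sub_le hSm hS one_lt_two (le_of_lt ht)
  rw [weightedAntideriv_of_le le_rfl, zero_sub, abs_neg] at h1
  refine h1.trans (mul_le_mul_of_nonneg_left ?_ (by positivity))
  have h2 := half_le_log (le_of_lt ht)
  have h3 := half_le_log (le_refl 2)
  have h4 := Real.log_le_sub_one_of_pos (by linarith : 0 < Real.log t)
  have h5 := Real.log_le_log (by norm_num) h3
  have h6 : Real.log (1 / 2 : ℝ) = -Real.log 2 := by rw [one_div, Real.log_inv]
  have := Real.log_two_lt_d9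
  linarith

/-- Substitute t = e^u. The u-integral over (0, ∞) becomes a t-integral over (1, ∞), and K vanishes
on (1, 2]. -/
theorem laplace_weightedAntideriv (S : ℝ → ℝ) (δ : ℝ) :
    ((δ * ∫ u in Ioi 0, Real.exp (-(δ * u)) * weightedAntideriv S (Real.exp u) : ℝ) : ℂ) =
      -((-δ : ℂ) * tailMellin (weightedAntideriv S) 2 (-δ)) := by
  have himg : Real.exp '' Ioi 0 = Ioi 1 := by
    ext t
    constructor
    · rintro ⟨u, hu, rfl⟩
      exact Real.one_lt_exp_iff.2 hu
    · intro ht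
      exact ⟨Real.log t, Real.log_pos ht, Real.exp_log (one_pos.trans ht)⟩
  have h1 := integral_image_eq_integral_abs_deriv_smul (s := Ioi 0) measurableSet_Ioi
    (fun x _ => (Real.hasDerivAt_exp x).hasDerivWithinAt) Real.exp_injective.injOn
    (fun t : ℝ => (t : ℂ) ^ ((-δ : ℂ) - 1) * (weightedAntideriv S t : ℂ))
  rw [himg] at h1
  have h2 : ∫ t : ℝ in Ioi 1, (t : ℂ) ^ ((-δ : ℂ) - 1) * (weightedAntideriv S t : ℂ) =
      tailMellin (weightedAntideriv S) 2 (-δ) := by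
    rw [tailMellin, ← integral_indicator measurableSet_Ioi, ← integral_indicator measurableSet_Ioi]
    congr 1
    ext t
    by_cases ht : 2 < t
    · simp [indicator, ht, one_lt_two.trans ht]
    · simp [indicator, ht, weightedAntideriv_of_le (S := S) (not_lt.1 ht)]
  rw [← h2, h1]
  push_cast
  rw [← integral_complex_ofReal, neg_mul, neg_neg]
  congr 1
  refine setIntegral_congr_fun measurableSet_Ioi fun u _ => ?_
  have h3 : (Real.exp u : ℂ) ≠ 0 := by exact_mod_cast (Real.exp_pos u).ne'
  have h4 : Complex.log (Real.exp u : ℂ) = u := by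
    rw [← Complex.ofReal_log (Real.exp_pos u).le, Real.log_exp]
  have h5 : (Real.exp u : ℂ) * (Real.exp u : ℂ) ^ ((-δ : ℂ) - 1) = (Real.exp (-(δ * u)) : ℝ) := by
    rw [Complex.cpow_def_of_ne_zero h3, h4, Complex.ofReal_exp, ← Complex.exp_add,
      Complex.ofReal_exp]
    congr 1
    push_cast
    ring
  rw [Complex.ofReal_exp] at h5
  simp only [Real.abs_exp, Complex.real_smul, Complex.ofReal_exp, ← mul_assoc, h5]
  push_cast
  rfl

end Antiderivative

end PrimesAP

/-! ### Convergence of K -/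

namespace PrimesAP

open MeasureTheory Set

theorem exists_transDen_ne_zero (q : ℕ) [NeZero q] {b : ℝ} (hb : 0 < b) :
    ∃ z : ℂ, z.re < b ∧ transDen q z ≠ 0 := by
  refine ⟨-1, by simp; linarith, ?_⟩
  have h := prodL_ne_zero q (s := 2) (by simp)
  have e : (1 : ℂ) - -1 = 2 := by norm_num
  rw [transDen, e]
  exact mul_ne_zero two_ne_zero h

theorem bound_thetaError (q : ℕ) (a : ℤ) : ∀ t ≥ 2, |thetaError q a t| ≤ (2 * q.totient + 1) * t :=
  fun _ ht => abs_thetaError_le q a (by linarith)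

/-- The Laplace mean of K(e^u) at δ is −U(−δ), because K(2) = 0. Regularity at s = 1 alone continues
U to 0, so the means converge, and the Tauberian theorem gives convergence of K without the prime
number theorem. -/
theorem exists_tendsto_weightedAntideriv (q : ℕ) [NeZero q] (a : ℤ)
    (hqa : IsCoprime a (q : ℤ)) :
    ∃ c, Tendsto (weightedAntideriv (thetaError q a)) atTop (𝓝 c) := by
  have hSm := measurable_thetaError q a
  have hS := bound_thetaError q a
  have hKc := continuous_weightedAntideriv hSm hS
  obtain ⟨u, hu, huU⟩ := exists_continuation_of_quotient (P := transDen q)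
    (Y := transNum q a 2) (τ := 0) (b := 1 / 2)
    (U := tailMellin (fun t => t * (thetaError q a t * logWeight t)) 2) (by norm_num)
    differentiable_transDen.differentiableOn (exists_transDen_ne_zero q (by norm_num))
    (fun z hz => (weighted_hasDerivAt hSm le_rfl hS hz).differentiableAt.differentiableWithinAt)
    (fun z hz => weighted_relation hSm le_rfl hS hz (differentiable_transDen.analyticAt z)
      fun w hw => transDen_mul_tailMellin hqa one_le_two hw)
    ((regular_trans_iff (b := 1 / 2) (by
      convert properPowers_abscissa_le_half (q := q) (a := a) using 2; norm_num)
      (by simp) (by simp)).2 (by simpa using exists_regular_at_one q a))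
  refine ⟨-(u 0).re, ?_⟩
  have hk := tendsto_of_tendsto_laplace (k := fun v => weightedAntideriv (thetaError q a) (Real.exp v))
    (c := -(u 0).re) (hKc.comp Real.continuous_exp).measurable
    (fun x hx y hy => weightedAntideriv_exp_logLipschitz hSm hS hx hy) ?_
  · refine (hk.comp Real.tendsto_log_atTop).congr' ?_
    filter_upwards [eventually_gt_atTop 0] with x hx
    simp only [Function.comp_apply, Real.exp_log hx]
  · have ht : Tendsto (fun δ : ℝ => (-δ : ℂ)) (𝓝[>] 0) (𝓝 0) := by
      have h1 : Continuous fun δ : ℝ => (-δ : ℂ) := by fun_prop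
      simpa using (h1.tendsto 0).mono_left nhdsWithin_le_nhds
    have hu0 : ContinuousAt u 0 := by simpa using hu.continuousAt
    have h2 : Tendsto (fun δ : ℝ => -(u (-δ)).re) (𝓝[>] 0) (𝓝 (-(u 0).re)) :=
      (Complex.continuous_re.continuousAt.tendsto.comp (hu0.tendsto.comp ht)).neg
    refine h2.congr' ?_
    have h3 : ∀ᶠ z in 𝓝 (0 : ℂ), z.re < 0 →
        u z = tailMellin (fun t => t * (thetaError q a t * logWeight t)) 2 z := by
      simpa using huU
    filter_upwards [ht.eventually h3, self_mem_nhdsWithin] with δ hδ hδ0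
    have hδ0' : (0 : ℝ) < δ := hδ0
    have hre : (-δ : ℂ).re < 0 := by simpa using hδ0'
    have h4 := weighted_eq_of_antideriv hSm le_rfl hS hKc.measurable hKc.continuousOn
      (logBounded_weightedAntideriv hSm hS) (fun x hx => weightedAntideriv_hasDerivWithinAt hSm hS hx
        ((continuousWithinAt_thetaError q a (by linarith)))) hre
    rw [weightedAntideriv_of_le le_rfl] at h4
    have h5 := laplace_weightedAntideriv (thetaError q a) δ
    rw [hδ hre, h4, ← Complex.ofReal_re (δ * _), h5]
    simp

end PrimesAP

/-! ### Mertens' theorem in a residue class -/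

namespace PrimesAP

open MeasureTheory Set

section Mertens

variable (q : ℕ) (a : ℤ)

theorem hasDerivAt_inv_mul_log {t : ℝ} (ht : 2 ≤ t) :
    HasDerivAt (fun t => (t * Real.log t)⁻¹) (-logWeight t) t := by
  have h1 := half_le_log ht
  have h2 : t ≠ 0 := by linarith
  have h3 : Real.log t ≠ 0 := by linarith
  have h := ((hasDerivAt_id t).mul (Real.hasDerivAt_log h2)).inv (mul_ne_zero h2 h3)
  refine h.congr_deriv ?_
  simp only [id, Pi.mul_apply, logWeight]
  field_simp
  ring

theorem hasDerivAt_log_log_sub {t : ℝ} (ht : 2 ≤ t) :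
    HasDerivAt (fun t => Real.log (Real.log t) - (Real.log t)⁻¹) (t * logWeight t) t := by
  have h1 := half_le_log ht
  have h2 : t ≠ 0 := by linarith
  have h3 : Real.log t ≠ 0 := by linarith
  refine ((hasDerivAt_log_log (by linarith)).sub ((Real.hasDerivAt_log h2).inv h3)).congr_deriv ?_
  unfold logWeight
  field_simp
  ring

theorem continuousOn_logWeight (x : ℝ) : ContinuousOn logWeight (Icc 2 x) := fun _ ht =>
  (continuousAt_logWeight ht.1).continuousWithinAt

theorem integral_mul_logWeight {x : ℝ} (hx : 2 ≤ x) :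
    ∫ t in (2 : ℝ)..x, t * logWeight t = Real.log (Real.log x) - (Real.log x)⁻¹ -
      (Real.log (Real.log 2) - (Real.log 2)⁻¹) := by
  refine intervalIntegral.integral_eq_sub_of_hasDerivAt
    (f := fun t => Real.log (Real.log t) - (Real.log t)⁻¹) (fun t ht => ?_) ?_
  · rw [uIcc_of_le hx] at ht
    exact hasDerivAt_log_log_sub ht.1
  · refine ContinuousOn.intervalIntegrable ?_
    rw [uIcc_of_le hx]
    exact continuousOn_id.mul (continuousOn_logWeight x)

/-- Abel summation with 1/p = log p · 1/(p log p); the derivative of 1/(t log t) is −w. -/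
theorem sum_inv_primes_eq {x : ℝ} (hx : 2 ≤ x) :
    ∑ p ∈ primesUpTo q a x, 1 / (p : ℝ) = (x * Real.log x)⁻¹ * thetaAP q a x +
      ∫ t in (2 : ℝ)..x, thetaAP q a t * logWeight t := by
  have hd : EqOn (deriv fun t : ℝ => (t * Real.log t)⁻¹) (fun t => -logWeight t) (Icc 2 x) :=
    fun t ht => (hasDerivAt_inv_mul_log ht.1).deriv
  have h := sum_mul_eq_sub_integral_mul₁ (f := fun t : ℝ => (t * Real.log t)⁻¹) (primeLog q a)
    (by simp [primeLog]) (by simp [primeLog, Nat.not_prime_one]) x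
    (fun t ht => (hasDerivAt_inv_mul_log ht.1).differentiableAt)
    (((continuousOn_logWeight x).neg.integrableOn_Icc).congr_fun hd.symm measurableSet_Icc)
  have h2 : ∫ t in Ioc 2 x, deriv (fun t : ℝ => (t * Real.log t)⁻¹) t *
      ∑ k ∈ Finset.Icc 0 ⌊t⌋₊, primeLog q a k =
      -∫ t in (2 : ℝ)..x, thetaAP q a t * logWeight t := by
    rw [intervalIntegral.integral_of_le hx, ← integral_neg]
    refine setIntegral_congr_fun measurableSet_Ioc fun t ht => ?_
    rw [hd (Ioc_subset_Icc_self ht), ← thetaAP_eq_sum_Icc_zero]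
    ring
  rw [h2, ← thetaAP_eq_sum_Icc_zero, sub_neg_eq_add] at h
  rw [← h, primesUpTo, Finset.sum_filter, ← Finset.sum_Ioc_add_eq_sum_Icc (Nat.zero_le _)]
  simp only [primeLog, Nat.not_prime_zero, false_and, if_false, mul_zero, add_zero]
  refine Finset.sum_congr rfl fun p _ => ?_
  split_ifs with hp
  · have : 0 < Real.log p := Real.log_pos (by exact_mod_cast hp.1.one_lt)
    field_simp
  · simp

/-- Partial summation: the sum of reciprocals of the primes in a residue class. -/
theorem totient_mul_sum_inv_primes {x : ℝ} (hx : 2 ≤ x) :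
    q.totient * ∑ p ∈ primesUpTo q a x, 1 / (p : ℝ) =
      thetaError q a x / (x * Real.log x) - weightedAntideriv (thetaError q a) x +
        Real.log (Real.log x) + ((Real.log 2)⁻¹ - Real.log (Real.log 2)) := by
  have hSm := measurable_thetaError q a
  have hS := bound_thetaError q a
  have h1 := weightedAntideriv_sub hSm hS le_rfl hx
  rw [weightedAntideriv_of_le le_rfl, zero_sub] at h1
  have hi1 : IntervalIntegrable (fun t => thetaError q a t * logWeight t) volume 2 x := by
    refine (intervalIntegrable_weight hSm hS 2 x).congr fun t ht => ?_
    rw [uIoc_of_le hx] at ht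
    exact indicator_of_mem (show t ∈ Ici (2 : ℝ) from ht.1.le) _
  have hi2 : IntervalIntegrable (fun t => t * logWeight t) volume 2 x := by
    refine ContinuousOn.intervalIntegrable ?_
    rw [uIcc_of_le hx]
    exact continuousOn_id.mul (continuousOn_logWeight x)
  have h2 := intervalIntegral.integral_add hi1 hi2
  have h3 : (q.totient : ℝ) * ∫ t in (2 : ℝ)..x, thetaAP q a t * logWeight t =
      ∫ t in (2 : ℝ)..x, (thetaError q a t * logWeight t + t * logWeight t) := by
    rw [← intervalIntegral.integral_const_mul]
    congr 1
    ext t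
    unfold thetaError
    ring
  have hl := half_le_log hx
  have hx0 : x ≠ 0 := by linarith
  have hl0 : Real.log x ≠ 0 := by linarith
  rw [sum_inv_primes_eq q a hx, mul_add, h3, h2, integral_mul_logWeight hx, ← h1, thetaError]
  field_simp
  ring

/-- The logarithm of `∏ (1 - 1/p)` over the primes `p ≤ x` in the residue class. -/
noncomputable def logMertens (x : ℝ) : ℝ := ∑ p ∈ primesUpTo q a x, Real.log (1 - 1 / (p : ℝ))

/-- The higher terms `-log (1 - 1/p) - 1/p` for primes in the residue class. -/
noncomputable def primeLogRemainder (n : ℕ) : ℝ :=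
  if n.Prime ∧ (n : ZMod q) = (a : ZMod q) then -Real.log (1 - 1 / (n : ℝ)) - 1 / n else 0

theorem neg_log_one_sub_bounds {u : ℝ} (h0 : 0 ≤ u) (h1 : u ≤ 1 / 2) :
    u ≤ -Real.log (1 - u) ∧ -Real.log (1 - u) - u ≤ u ^ 2 * 2 := by
  have h2 := Real.log_le_sub_one_of_pos (by linarith : 0 < 1 - u)
  have h3 := Real.one_sub_inv_le_log_of_pos (by linarith : 0 < 1 - u)
  refine ⟨by linarith, ?_⟩
  have h4 : (1 - u)⁻¹ - 1 - u ≤ u ^ 2 * 2 := by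
    have h5 : (1 - u)⁻¹ ≤ 1 + u + u ^ 2 * 2 := by
      rw [inv_le_comm₀ (by linarith) (by positivity), inv_le_iff_one_le_mul₀ (by positivity)]
      nlinarith [mul_nonneg h0 h0, mul_nonneg (mul_nonneg h0 h0) (by linarith : 0 ≤ 1 / 2 - u)]
    linarith
  linarith

theorem primeLogRemainder_bounds (n : ℕ) :
    0 ≤ primeLogRemainder q a n ∧ primeLogRemainder q a n ≤ 2 * ((n : ℝ) ^ 2)⁻¹ := by
  unfold primeLogRemainder
  split_ifs with h
  · have h2 : (2 : ℝ) ≤ n := by exact_mod_cast h.1.two_le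
    have h3 : 1 / (n : ℝ) ≤ 1 / 2 := one_div_le_one_div_of_le two_pos h2
    obtain ⟨h4, h5⟩ := neg_log_one_sub_bounds (by positivity) h3
    refine ⟨by linarith, h5.trans (le_of_eq ?_)⟩
    rw [one_div, inv_pow, mul_comm]
  · exact ⟨le_rfl, by positivity⟩

theorem summable_primeLogRemainder : Summable (primeLogRemainder q a) :=
  Summable.of_nonneg_of_le (fun n => (primeLogRemainder_bounds q a n).1)
    (fun n => (primeLogRemainder_bounds q a n).2)
    ((Real.summable_nat_pow_inv.2 one_lt_two).mul_left 2)

theorem tsum_sub_sum_primeLogRemainder {x : ℝ} (hx : 2 ≤ x) :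
    0 ≤ ∑' n, primeLogRemainder q a n - ∑ n ∈ Finset.Ioc 0 ⌊x⌋₊, primeLogRemainder q a n ∧
    ∑' n, primeLogRemainder q a n - ∑ n ∈ Finset.Ioc 0 ⌊x⌋₊, primeLogRemainder q a n ≤ 4 / x := by
  have hs := summable_primeLogRemainder q a
  have hN1 : 1 ≤ ⌊x⌋₊ := Nat.le_floor (by norm_num; linarith)
  constructor
  · exact sub_nonneg.2 (hs.sum_le_tsum _ fun n _ => (primeLogRemainder_bounds q a n).1)
  · have ht : Tendsto (fun m : ℕ => ∑ n ∈ Finset.range (m + 1), primeLogRemainder q a n) atTop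
        (𝓝 (∑' n, primeLogRemainder q a n)) :=
      hs.hasSum.tendsto_sum_nat.comp (tendsto_add_atTop_nat 1)
    refine le_of_tendsto (ht.sub_const _) ?_
    filter_upwards [eventually_ge_atTop ⌊x⌋₊] with m hm
    have h0 : primeLogRemainder q a 0 = 0 := by simp [primeLogRemainder]
    have e : ∑ n ∈ Finset.range (m + 1), primeLogRemainder q a n =
        ∑ n ∈ Finset.Ioc 0 m, primeLogRemainder q a n := by
      rw [Nat.range_succ_eq_Icc_zero, ← Finset.sum_Ioc_add_eq_sum_Icc (Nat.zero_le _), h0,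
        add_zero]
    rw [e, ← Finset.sum_Ioc_consecutive _ (Nat.zero_le _) hm, add_sub_cancel_left]
    refine (Finset.sum_le_sum fun n _ => (primeLogRemainder_bounds q a n).2).trans ?_
    rw [← Finset.mul_sum]
    have h1 := sum_Ioc_inv_sq_le_sub (α := ℝ) (by omega : ⌊x⌋₊ ≠ 0) hm
    -- Since ⌊x⌋ ≥ 1, x < ⌊x⌋ + 1 ≤ 2⌊x⌋.
    have h2 : (⌊x⌋₊ : ℝ)⁻¹ ≤ 2 / x := by
      have h3 := Nat.lt_floor_add_one x
      have h4 : (1 : ℝ) ≤ ⌊x⌋₊ := by exact_mod_cast hN1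
      rw [inv_le_comm₀ (by linarith) (by positivity), inv_div]
      linarith
    have h3 : (0 : ℝ) ≤ (m : ℝ)⁻¹ := by positivity
    calc _ ≤ 2 * ((⌊x⌋₊ : ℝ)⁻¹ - (m : ℝ)⁻¹) := by linarith
      _ ≤ 2 * (2 / x) := by linarith
      _ = 4 / x := by ring

theorem neg_logMertens_eq (x : ℝ) : -logMertens q a x =
    ∑ p ∈ primesUpTo q a x, 1 / (p : ℝ) + ∑ n ∈ Finset.Ioc 0 ⌊x⌋₊, primeLogRemainder q a n := by
  unfold logMertens primesUpTo primeLogRemainder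
  rw [← Finset.sum_filter (fun p : ℕ => p.Prime ∧ (p : ZMod q) = (a : ZMod q)),
    ← Finset.sum_add_distrib, ← Finset.sum_neg_distrib]
  exact Finset.sum_congr rfl fun p _ => by ring

/-- **Mertens' theorem** for arithmetic progressions with its error term: the error is expressed
by the antiderivative `weightedAntideriv` of the error term of `θ(x;q,a)`. -/
theorem exists_logMertens_eq [NeZero q] (hqa : IsCoprime a (q : ℤ)) :
    ∃ l c : ℝ, Tendsto (weightedAntideriv (thetaError q a)) atTop (𝓝 c) ∧
      ∀ x : ℝ, 2 ≤ x → ∃ r, 0 ≤ r ∧ r ≤ 4 * q.totient / x ∧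
        q.totient * logMertens q a x + Real.log (Real.log x) - l +
            thetaError q a x / (x * Real.log x) =
          weightedAntideriv (thetaError q a) x - c + r := by
  obtain ⟨c, hc⟩ := exists_tendsto_weightedAntideriv q a hqa
  refine ⟨c - ((Real.log 2)⁻¹ - Real.log (Real.log 2)) -
    q.totient * ∑' n, primeLogRemainder q a n, c, hc, fun x hx => ?_⟩
  obtain ⟨h1, h2⟩ := tsum_sub_sum_primeLogRemainder q a hx
  -- The error r is the tail of the series of higher terms. Its sign matters later: one direction
  -- drops r, the other uses its size.
  refine ⟨q.totient * (∑' n, primeLogRemainder q a n -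
    ∑ n ∈ Finset.Ioc 0 ⌊x⌋₊, primeLogRemainder q a n), by positivity, ?_, ?_⟩
  · refine (mul_le_mul_of_nonneg_left h2 (Nat.cast_nonneg _)).trans (le_of_eq (by ring))
  · have h3 := totient_mul_sum_inv_primes q a hx
    have h4 := congrArg (fun y => (q.totient : ℝ) * y) (neg_logMertens_eq q a x)
    simp only [mul_add, mul_neg] at h4
    rw [h3] at h4
    linarith

/-- Chebyshev's bound makes S/(x log x) of order 1/log x, and K − c and r tend to 0. -/
theorem tendsto_logMertens [NeZero q] {l c : ℝ}
    (hc : Tendsto (weightedAntideriv (thetaError q a)) atTop (𝓝 c))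
    (h : ∀ x : ℝ, 2 ≤ x → ∃ r, 0 ≤ r ∧ r ≤ 4 * q.totient / x ∧
        q.totient * logMertens q a x + Real.log (Real.log x) - l +
            thetaError q a x / (x * Real.log x) =
          weightedAntideriv (thetaError q a) x - c + r) :
    Tendsto (fun x => q.totient * logMertens q a x + Real.log (Real.log x)) atTop (𝓝 l) := by
  have h1 : Tendsto (fun x => |weightedAntideriv (thetaError q a) x - c|) atTop (𝓝 0) := by
    have := (hc.sub_const c).abs
    simpa using this
  have h2 : Tendsto (fun x : ℝ => 4 * (q.totient : ℝ) / x) atTop (𝓝 0) :=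
    tendsto_const_nhds.div_atTop tendsto_id
  have h3 : Tendsto (fun x : ℝ => (2 * (q.totient : ℝ) + 1) / Real.log x) atTop (𝓝 0) :=
    tendsto_const_nhds.div_atTop Real.tendsto_log_atTop
  have h4 := (h1.add h2).add h3
  rw [add_zero, add_zero] at h4
  rw [tendsto_iff_norm_sub_tendsto_zero]
  refine squeeze_zero' (Eventually.of_forall fun x => norm_nonneg _) ?_ h4
  filter_upwards [eventually_ge_atTop 2] with x hx
  obtain ⟨r, hr0, hr1, hr⟩ := h x hx
  have hl := half_le_log hx
  have hS : |thetaError q a x / (x * Real.log x)| ≤ (2 * q.totient + 1) / Real.log x := by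
    rw [abs_div, abs_of_pos (by positivity : 0 < x * Real.log x),
      div_le_div_iff₀ (by positivity) (by positivity)]
    have := mul_le_mul_of_nonneg_right (abs_thetaError_le q a (by linarith : 0 ≤ x))
      (by linarith : 0 ≤ Real.log x)
    linarith
  have h5 := abs_le.1 hS
  have h6 := le_abs_self (weightedAntideriv (thetaError q a) x - c)
  have h7 := neg_abs_le (weightedAntideriv (thetaError q a) x - c)
  rw [Real.norm_eq_abs, abs_le]
  constructor <;> linarith

end Mertens

end PrimesAP

/-! ### Mertens' third theorem and the constant e^{-γ} -/

namespace PrimesAP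

open MeasureTheory Set

section ZetaComparison

/-- The integral is Γ′(1). -/
theorem integral_exp_neg_mul_log :
    ∫ v in Ioi 0, Real.exp (-v) * Real.log v = -Real.eulerMascheroniConstant := by
  have h1 := Complex.hasDerivAt_GammaIntegral (s := 1) (by simp)
  have h2 : Complex.GammaIntegral =ᶠ[𝓝 1] Complex.Gamma := by
    have : ∀ᶠ s : ℂ in 𝓝 1, 0 < s.re :=
      (isOpen_lt continuous_const Complex.continuous_re).mem_nhds (by simp)
    filter_upwards [this] with s hs using (Complex.Gamma_eq_integral hs).symm
  have h3 := (h1.congr_of_eventuallyEq h2.symm).unique Complex.hasDerivAt_Gamma_one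
  have h4 : ((∫ v in Ioi 0, Real.exp (-v) * Real.log v : ℝ) : ℂ) =
      ((-Real.eulerMascheroniConstant : ℝ) : ℂ) := by
    rw [← integral_complex_ofReal, Complex.ofReal_neg, ← h3]
    congr 1
    ext v
    simp [mul_comm]
  exact_mod_cast h4

theorem integrableOn_exp_neg_mul_log :
    IntegrableOn (fun v => Real.exp (-v) * Real.log v) (Ioi 0) := by
  refine integrableOn_exp_neg_mul_abs_log.mono' (by fun_prop) (Eventually.of_forall fun v => ?_)
  rw [Real.norm_eq_abs, abs_mul, Real.abs_exp]

/-- An Abelian theorem: if `k(u) - log u → β` then the Laplace mean of `k` at `δ` is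
`-log δ - γ + β + o(1)`. -/
theorem tendsto_laplace_add_log {k : ℝ → ℝ} {β : ℝ} (hk : Monotone k)
    (hk0 : ∀ u ≤ 1 / 2, k u = 0) (hβ : Tendsto (fun u => k u - Real.log u) atTop (𝓝 β)) :
    Tendsto (fun δ => (∫ v in Ioi 0, Real.exp (-v) * k (v / δ)) + Real.log δ) (𝓝[>] 0)
      (𝓝 (β - Real.eulerMascheroniConstant)) := by
  obtain ⟨M, hM0, hM⟩ : ∃ M, 0 ≤ M ∧ ∀ u ≥ 1 / 2, |k u - Real.log u| ≤ M := by
    have h1 := hβ.abs.eventually (eventually_le_nhds (lt_add_one |β|))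
    obtain ⟨U, hU⟩ := (h1.and (eventually_ge_atTop 1)).exists_forall_of_atTop
    have hU1 := (hU U le_rfl).2
    refine ⟨|β| + 1 + k U + Real.log 2 + Real.log U, ?_, fun u hu => ?_⟩
    · have := hk (by linarith : (1 / 2 : ℝ) ≤ U)
      rw [hk0 _ le_rfl] at this
      have := Real.log_nonneg hU1
      have := Real.log_two_gt_d9
      positivity
    · have h2 := hk (by linarith : (1 / 2 : ℝ) ≤ U)
      have h3 := hk hu
      rw [hk0 _ le_rfl] at h2 h3
      have h4 := Real.log_nonneg hU1
      have h5 := Real.log_two_gt_d9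
      have h6 := abs_nonneg β
      rcases le_total U u with h | h
      · exact (hU u h).1.trans (by linarith)
      · have h7 := hk h
        have h8 := Real.log_le_log (by linarith) h
        have h9 := Real.log_le_log (by norm_num) hu
        have h10 : Real.log (1 / 2 : ℝ) = -Real.log 2 := by rw [one_div, Real.log_inv]
        rw [abs_le]
        constructor <;> linarith
  have hδ1 : ∀ᶠ δ : ℝ in 𝓝[>] 0, δ < 1 := nhdsWithin_le_nhds (eventually_lt_nhds one_pos)
  -- Dominating function, uniform in δ < 1. If v/δ ≥ 1/2, write log δ = log v − log(v/δ); otherwise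
  -- k vanishes and v ≤ δ < 1 gives |log δ| ≤ |log v|.
  have hbound : ∀ δ : ℝ, 0 < δ → δ < 1 → ∀ v : ℝ, 0 < v →
      |Real.exp (-v) * (k (v / δ) + Real.log δ)| ≤
        Real.exp (-v) * M + 2 * (Real.exp (-v) * |Real.log v|) := by
    intro δ hδ hδ1 v hv
    have hlog : Real.log (v / δ) = Real.log v - Real.log δ := Real.log_div hv.ne' hδ.ne'
    have h1 : |k (v / δ) + Real.log δ| ≤ M + 2 * |Real.log v| := by
      rcases le_total (1 / 2) (v / δ) with h | h
      · have h2 := abs_le.1 (hM _ h)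
        have h3 := le_abs_self (Real.log v)
        have h4 := neg_abs_le (Real.log v)
        rw [abs_le]
        constructor <;> linarith
      · rw [hk0 _ h, zero_add]
        have h2 : v ≤ δ := by
          rw [div_le_iff₀ hδ] at h
          linarith
        have h3 := Real.log_le_log hv h2
        have h4 := Real.log_nonpos hδ.le hδ1.le
        have h5 := neg_abs_le (Real.log v)
        have h6 := abs_nonneg (Real.log v)
        rw [abs_le]
        constructor <;> linarith
    rw [abs_mul, Real.abs_exp]
    refine (mul_le_mul_of_nonneg_left h1 (Real.exp_pos _).le).trans (le_of_eq (by ring))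
  have hexp : IntegrableOn (fun v : ℝ => Real.exp (-v)) (Ioi 0) := integrableOn_exp_neg_Ioi 0
  have hbi : IntegrableOn (fun v => Real.exp (-v) * M + 2 * (Real.exp (-v) * |Real.log v|))
      (Ioi 0) := (hexp.mul_const M).add (integrableOn_exp_neg_mul_abs_log.const_mul 2)
  have hkm := hk.measurable
  have hmeas : ∀ δ : ℝ, Measurable fun v => Real.exp (-v) * (k (v / δ) + Real.log δ) := fun δ =>
    (Real.measurable_exp.comp measurable_neg).mul
      ((hkm.comp (measurable_id.div_const δ)).add_const _)
  have hlim := tendsto_integral_filter_of_dominated_convergence (l := 𝓝[>] (0 : ℝ))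
    (μ := volume.restrict (Ioi 0)) (F := fun δ v => Real.exp (-v) * (k (v / δ) + Real.log δ))
    (f := fun v => Real.exp (-v) * β + Real.exp (-v) * Real.log v) _
    (Eventually.of_forall fun δ => (hmeas δ).aestronglyMeasurable)
    (by
      filter_upwards [hδ1, self_mem_nhdsWithin] with δ h1 h0
      filter_upwards [self_mem_ae_restrict measurableSet_Ioi] with v hv
      exact hbound δ h0 h1 v hv) hbi
    (by
      filter_upwards [self_mem_ae_restrict measurableSet_Ioi] with v hv
      have hv0 : (0 : ℝ) < v := hv
      have h1 : Tendsto (fun δ : ℝ => v / δ) (𝓝[>] 0) atTop :=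
        tendsto_inv_nhdsGT_zero.const_mul_atTop hv0
      have h2 := ((hβ.comp h1).add_const (Real.log v)).const_mul (Real.exp (-v))
      rw [← mul_add]
      refine h2.congr' ?_
      filter_upwards [self_mem_nhdsWithin] with δ hδ
      have hδ0 : (0 : ℝ) < δ := hδ
      simp only [Function.comp_apply]
      rw [Real.log_div hv0.ne' hδ0.ne']
      ring)
  have e : ∫ v in Ioi 0, (Real.exp (-v) * β + Real.exp (-v) * Real.log v) =
      β - Real.eulerMascheroniConstant := by
    rw [integral_add (hexp.mul_const β) integrableOn_exp_neg_mul_log, integral_exp_neg_mul_log,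
      integral_mul_const, integral_exp_neg_Ioi_zero]
    ring
  rw [e] at hlim
  refine hlim.congr' ?_
  filter_upwards [hδ1, self_mem_nhdsWithin] with δ h1 h0
  have hi : IntegrableOn (fun v => Real.exp (-v) * (k (v / δ) + Real.log δ)) (Ioi 0) := by
    refine Integrable.mono' hbi (hmeas δ).aestronglyMeasurable ?_
    filter_upwards [self_mem_ae_restrict measurableSet_Ioi] with v hv
    exact hbound δ h0 h1 v hv
  have h2 : (fun v => Real.exp (-v) * k (v / δ)) =
      fun v => Real.exp (-v) * (k (v / δ) + Real.log δ) - Real.exp (-v) * Real.log δ := by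
    ext v
    ring
  rw [h2, integral_sub hi (hexp.mul_const _), integral_mul_const, integral_exp_neg_Ioi_zero]
  ring

theorem primes_inv_le_half (p : Nat.Primes) : 1 / ((p : ℕ) : ℝ) ≤ 1 / 2 :=
  one_div_le_one_div_of_le two_pos (by exact_mod_cast p.2.two_le)

theorem summable_neg_log_mul_rpow {δ : ℝ} (hδ : 0 < δ) : Summable fun p : Nat.Primes =>
    -Real.log (1 - 1 / ((p : ℕ) : ℝ)) * ((p : ℕ) : ℝ) ^ (-δ) := by
  have h := (Nat.Primes.summable_rpow (r := -(1 + δ))).2 (by linarith)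
  refine Summable.of_nonneg_of_le (fun p => ?_) (fun p => ?_) (h.mul_left 2)
  · have h1 := (neg_log_one_sub_bounds (by positivity) (primes_inv_le_half p)).1
    have h2 : (0 : ℝ) ≤ 1 / ((p : ℕ) : ℝ) := by positivity
    have : 0 ≤ -Real.log (1 - 1 / ((p : ℕ) : ℝ)) := h2.trans h1
    positivity
  · have hp : (0 : ℝ) < ((p : ℕ) : ℝ) := by exact_mod_cast p.2.pos
    have h0 := primes_inv_le_half p
    have h1 := (neg_log_one_sub_bounds (by positivity) h0).2
    have h2 : (0 : ℝ) ≤ 1 / ((p : ℕ) : ℝ) := by positivity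
    have h3 : -Real.log (1 - 1 / ((p : ℕ) : ℝ)) ≤ 2 * (1 / ((p : ℕ) : ℝ)) := by nlinarith
    have h4 : ((p : ℕ) : ℝ) ^ (-(1 + δ)) = 1 / ((p : ℕ) : ℝ) * ((p : ℕ) : ℝ) ^ (-δ) := by
      rw [neg_add, Real.rpow_add hp, Real.rpow_neg_one, one_div]
    rw [h4, ← mul_assoc]
    exact mul_le_mul_of_nonneg_right h3 (by positivity)

theorem neg_logMertens_eq_tsum (x : ℝ) (hx : 0 ≤ x) : -logMertens 1 0 x =
    ∑' p : Nat.Primes, if ((p : ℕ) : ℝ) ≤ x then -Real.log (1 - 1 / ((p : ℕ) : ℝ)) else 0 := by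
  refine Eq.trans ?_ (tsum_subtype {p : ℕ | p.Prime}
    fun n : ℕ => if (n : ℝ) ≤ x then -Real.log (1 - 1 / (n : ℝ)) else 0).symm
  rw [tsum_eq_sum (s := Finset.Ioc 0 ⌊x⌋₊), logMertens, primesUpTo, Finset.sum_filter,
    ← Finset.sum_neg_distrib]
  · refine Finset.sum_congr rfl fun n hn => ?_
    have h1 : (n : ℝ) ≤ x := (Nat.le_floor_iff hx).1 (Finset.mem_Ioc.1 hn).2
    by_cases hp : n.Prime
    · simp [hp, h1, Subsingleton.elim (n : ZMod 1) 0]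
    · simp [hp]
  · intro n hn
    by_cases hp : n.Prime
    · have h1 : ¬ (n : ℝ) ≤ x := fun h => hn (Finset.mem_Ioc.2 ⟨hp.pos, Nat.le_floor h⟩)
      simp [h1]
    · simp [hp]

/-- A prime p is counted from v = δ log p on, and ∫_{δ log p}^∞ e^{-v} dv = p^{-δ}. -/
theorem integral_exp_neg_mul_logMertens {δ : ℝ} (hδ : 0 < δ) :
    ∫ v in Ioi 0, Real.exp (-v) * -logMertens 1 0 (Real.exp (v / δ)) =
      ∑' p : Nat.Primes, -Real.log (1 - 1 / ((p : ℕ) : ℝ)) * ((p : ℕ) : ℝ) ^ (-δ) := by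
  set g : Nat.Primes → ℝ := fun p => -Real.log (1 - 1 / ((p : ℕ) : ℝ)) with hg
  have hg0 : ∀ p, 0 ≤ g p := fun p => by
    have h2 : (0 : ℝ) ≤ 1 / ((p : ℕ) : ℝ) := by positivity
    exact h2.trans (neg_log_one_sub_bounds h2 (primes_inv_le_half p)).1
  set F : Nat.Primes → ℝ → ℝ := fun p =>
    (Ici (δ * Real.log ((p : ℕ) : ℝ))).indicator fun v => g p * Real.exp (-v) with hF
  have hc : ∀ p : Nat.Primes, 0 < δ * Real.log ((p : ℕ) : ℝ) := fun p =>
    mul_pos hδ (Real.log_pos (by exact_mod_cast p.2.one_lt))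
  have hF0 : ∀ p v, 0 ≤ F p v := fun p v =>
    indicator_nonneg (fun v _ => mul_nonneg (hg0 p) (Real.exp_pos _).le) v
  have hFi : ∀ p, IntegrableOn (F p) (Ioi 0) := fun p =>
    ((integrableOn_exp_neg_Ioi 0).const_mul (g p)).indicator measurableSet_Ici
  have hinter : ∀ p : Nat.Primes, Ici (δ * Real.log ((p : ℕ) : ℝ)) ∩ Ioi 0 =
      Ici (δ * Real.log ((p : ℕ) : ℝ)) := fun p =>
    inter_eq_left.2 fun v hv => (hc p).trans_le hv
  have hFint : ∀ p, ∫ v in Ioi 0, F p v = g p * ((p : ℕ) : ℝ) ^ (-δ) := fun p => by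
    have hp : (0 : ℝ) < ((p : ℕ) : ℝ) := by exact_mod_cast p.2.pos
    rw [hF, integral_indicator measurableSet_Ici, Measure.restrict_restrict measurableSet_Ici,
      hinter, integral_Ici_eq_integral_Ioi,
      integral_const_mul, integral_exp_neg_Ioi, Real.rpow_def_of_pos hp]
    congr 2
    ring
  have h := integral_tsum_of_summable_integral_norm (μ := volume.restrict (Ioi 0)) hFi (by
    simp only [Real.norm_eq_abs, abs_of_nonneg (hF0 _ _), hFint]
    exact summable_neg_log_mul_rpow hδ)
  simp only [hFint] at h
  rw [h]
  congr 1
  ext v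
  rw [neg_logMertens_eq_tsum _ (Real.exp_pos _).le, ← tsum_mul_left]
  refine tsum_congr fun p => ?_
  have hp : (0 : ℝ) < ((p : ℕ) : ℝ) := by exact_mod_cast p.2.pos
  have : ((p : ℕ) : ℝ) ≤ Real.exp (v / δ) ↔ δ * Real.log ((p : ℕ) : ℝ) ≤ v := by
    rw [← Real.log_le_iff_le_exp hp, le_div_iff₀ hδ, mul_comm]
  by_cases hv : δ * Real.log ((p : ℕ) : ℝ) ≤ v
  · simp [hF, this, hv, hg, mul_comm]
  · simp [hF, this, hv]

/-- One side is Bernoulli's inequality (1−u)^w ≤ 1 − uw, the other the quadratic bound for −log(1−u)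
− u. -/
theorem abs_neg_log_mul_add_log_le {u w : ℝ} (hu0 : 0 ≤ u) (hu : u ≤ 1 / 2) (hw0 : 0 ≤ w)
    (hw : w ≤ 1) : |-Real.log (1 - u) * w + Real.log (1 - u * w)| ≤ u ^ 2 * 2 := by
  obtain ⟨h1, h2⟩ := neg_log_one_sub_bounds hu0 hu
  have h3 := rpow_one_add_le_one_add_mul_self (s := -u) (by linarith) hw0 hw
  have hpos : 0 < 1 - u := by linarith
  have huw : u * w ≤ u := mul_le_of_le_one_right hu0 hw
  have h4 : w * Real.log (1 - u) ≤ Real.log (1 - u * w) := by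
    rw [← Real.log_rpow hpos]
    refine Real.log_le_log (Real.rpow_pos_of_pos hpos _) ?_
    rw [show 1 + -u = 1 - u by ring] at h3
    linarith
  have h5 := Real.log_le_sub_one_of_pos (by linarith : 0 < 1 - u * w)
  have h6 : (-Real.log (1 - u) - u) * w ≤ -Real.log (1 - u) - u :=
    mul_le_of_le_one_right (by linarith) hw
  rw [abs_le]
  constructor <;> nlinarith [sq_nonneg u]

theorem summable_neg_log_one_sub_rpow {δ : ℝ} (hδ : 0 < δ) : Summable fun p : Nat.Primes =>
    -Real.log (1 - ((p : ℕ) : ℝ) ^ (-(1 + δ))) := by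
  have h := (Nat.Primes.summable_rpow (r := -(1 + δ))).2 (by linarith)
  have hb : ∀ p : Nat.Primes, ((p : ℕ) : ℝ) ^ (-(1 + δ)) ≤ 1 / 2 := fun p => by
    have hp : (1 : ℝ) ≤ ((p : ℕ) : ℝ) := by exact_mod_cast p.2.one_lt.le
    refine le_trans ?_ (primes_inv_le_half p)
    rw [one_div, ← Real.rpow_neg_one]
    exact Real.rpow_le_rpow_of_exponent_le hp (by linarith)
  refine Summable.of_nonneg_of_le (fun p => ?_) (fun p => ?_) (h.mul_left 2)
  · have h2 : (0 : ℝ) ≤ ((p : ℕ) : ℝ) ^ (-(1 + δ)) := by positivity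
    exact h2.trans (neg_log_one_sub_bounds h2 (hb p)).1
  · have h2 : (0 : ℝ) ≤ ((p : ℕ) : ℝ) ^ (-(1 + δ)) := by positivity
    have h3 := (neg_log_one_sub_bounds h2 (hb p)).2
    have h4 := hb p
    nlinarith

/-- With u = 1/p and w = p^{-δ} the terms −log(1−u)·w and −log(1−uw) differ by at most 2/p², and by
0 in the limit; dominated convergence applies. -/
theorem tendsto_tsum_sub_tsum :
    Tendsto (fun δ : ℝ => ∑' p : Nat.Primes,
        -Real.log (1 - 1 / ((p : ℕ) : ℝ)) * ((p : ℕ) : ℝ) ^ (-δ) -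
      ∑' p : Nat.Primes, -Real.log (1 - ((p : ℕ) : ℝ) ^ (-(1 + δ)))) (𝓝[>] 0) (𝓝 0) := by
  have hpow : ∀ (p : Nat.Primes) (δ : ℝ), ((p : ℕ) : ℝ) ^ (-(1 + δ)) =
      1 / ((p : ℕ) : ℝ) * ((p : ℕ) : ℝ) ^ (-δ) := fun p δ => by
    have hp : (0 : ℝ) < ((p : ℕ) : ℝ) := by exact_mod_cast p.2.pos
    rw [neg_add, Real.rpow_add hp, Real.rpow_neg_one, one_div]
  have hb : Summable fun p : Nat.Primes => 2 * ((p : ℕ) : ℝ) ^ (-2 : ℝ) :=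
    (Nat.Primes.summable_rpow.2 (by norm_num)).mul_left 2
  have h := tendsto_tsum_of_dominated_convergence (𝓕 := 𝓝[>] (0 : ℝ))
    (f := fun δ (p : Nat.Primes) => -Real.log (1 - 1 / ((p : ℕ) : ℝ)) * ((p : ℕ) : ℝ) ^ (-δ) +
      Real.log (1 - 1 / ((p : ℕ) : ℝ) * ((p : ℕ) : ℝ) ^ (-δ))) (g := fun _ => 0) hb
    (fun p => by
      have hp : (0 : ℝ) < ((p : ℕ) : ℝ) := by exact_mod_cast p.2.pos
      have h2 : 1 - 1 / ((p : ℕ) : ℝ) ≠ 0 := by linarith [primes_inv_le_half p]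
      have hc : ContinuousAt (fun δ : ℝ => ((p : ℕ) : ℝ) ^ (-δ)) 0 :=
        (Real.continuousAt_const_rpow hp.ne').comp continuous_neg.continuousAt
      have hc2 : ContinuousAt (fun δ : ℝ => -Real.log (1 - 1 / ((p : ℕ) : ℝ)) *
          ((p : ℕ) : ℝ) ^ (-δ) + Real.log (1 - 1 / ((p : ℕ) : ℝ) * ((p : ℕ) : ℝ) ^ (-δ))) 0 :=
        (continuousAt_const.mul hc).add
          ((continuousAt_const.sub (continuousAt_const.mul hc)).log (by simpa using h2))
      have := hc2.tendsto.mono_left (nhdsWithin_le_nhds (s := Ioi 0))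
      simpa using this)
    (by
      filter_upwards [self_mem_nhdsWithin] with δ hδ p
      have hδ0 : (0 : ℝ) < δ := hδ
      have hp : (1 : ℝ) ≤ ((p : ℕ) : ℝ) := by exact_mod_cast p.2.one_lt.le
      refine (abs_neg_log_mul_add_log_le (by positivity) (primes_inv_le_half p) (by positivity)
        (Real.rpow_le_one_of_one_le_of_nonpos hp (by linarith))).trans (le_of_eq ?_)
      rw [Real.rpow_neg (by linarith), one_div, inv_pow, mul_comm]
      norm_num)
  rw [tsum_zero] at h
  refine h.congr' ?_
  filter_upwards [self_mem_nhdsWithin] with δ hδ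
  rw [← (summable_neg_log_mul_rpow hδ).tsum_sub (summable_neg_log_one_sub_rpow hδ)]
  refine tsum_congr fun p => ?_
  rw [hpow, sub_neg_eq_add]

theorem exp_tsum_neg_log_eq_riemannZeta {δ : ℝ} (hδ : 0 < δ) :
    (Real.exp (∑' p : Nat.Primes, -Real.log (1 - ((p : ℕ) : ℝ) ^ (-(1 + δ)))) : ℂ) =
      riemannZeta (1 + δ) := by
  rw [← riemannZeta_eulerProduct_exp_log (by simpa using hδ), Complex.ofReal_exp,
    Complex.ofReal_tsum]
  congr 2
  ext p
  have hp : (1 : ℝ) ≤ ((p : ℕ) : ℝ) := by exact_mod_cast p.2.one_lt.le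
  have h1 : ((p : ℕ) : ℝ) ^ (-(1 + δ)) ≤ 1 :=
    Real.rpow_le_one_of_one_le_of_nonpos hp (by linarith)
  rw [Complex.ofReal_neg, Complex.ofReal_log (by linarith), Complex.ofReal_sub,
    Complex.ofReal_cpow (by linarith)]
  push_cast
  rfl

/-- By the Euler product the sum is log ζ(1+δ), and δζ(1+δ) → 1. -/
theorem tendsto_tsum_neg_log_add_log :
    Tendsto (fun δ : ℝ => ∑' p : Nat.Primes, -Real.log (1 - ((p : ℕ) : ℝ) ^ (-(1 + δ))) +
      Real.log δ) (𝓝[>] 0) (𝓝 0) := by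
  have h1 : Tendsto (fun δ : ℝ => (1 + δ : ℂ)) (𝓝[>] 0) (𝓝[≠] 1) := by
    refine tendsto_nhdsWithin_iff.2 ⟨?_, ?_⟩
    · have : Continuous fun δ : ℝ => (1 + δ : ℂ) := by fun_prop
      simpa using (this.tendsto 0).mono_left (nhdsWithin_le_nhds (s := Ioi 0))
    · filter_upwards [self_mem_nhdsWithin] with δ hδ
      have : (δ : ℂ) ≠ 0 := Complex.ofReal_ne_zero.2 (ne_of_gt hδ)
      simpa using this
  have h2 := (Complex.continuous_re.tendsto 1).comp (riemannZeta_residue_one.comp h1)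
  have h3 := (Real.continuousAt_log one_ne_zero).tendsto.comp (by simpa using h2)
  rw [Real.log_one] at h3
  refine h3.congr' ?_
  filter_upwards [self_mem_nhdsWithin] with δ hδ
  have hδ0 : (0 : ℝ) < δ := hδ
  simp only [Function.comp_apply]
  rw [← exp_tsum_neg_log_eq_riemannZeta hδ0, add_sub_cancel_left, ← Complex.ofReal_mul,
    Complex.ofReal_re, Real.log_mul hδ0.ne' (Real.exp_pos _).ne', Real.log_exp, add_comm]

/-- **Mertens' third theorem**: the constant is `e^{-γ}`. -/
theorem logMertens_one_limit {l : ℝ}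
    (hl : Tendsto (fun x => logMertens 1 0 x + Real.log (Real.log x)) atTop (𝓝 l)) :
    l = -Real.eulerMascheroniConstant := by
  have hmono : Monotone fun u : ℝ => -logMertens 1 0 (Real.exp u) := fun u v huv => by
    simp only [logMertens, ← Finset.sum_neg_distrib]
    refine Finset.sum_le_sum_of_subset_of_nonneg ?_ fun p hp _ => ?_
    · refine Finset.filter_subset_filter _ (Finset.Ioc_subset_Ioc le_rfl
        (Nat.floor_le_floor (Real.exp_le_exp.2 huv)))
    · have hp' : p.Prime := (Finset.mem_filter.1 hp).2.1
      have h2 : (0 : ℝ) ≤ 1 / (p : ℝ) := by positivity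
      exact h2.trans (neg_log_one_sub_bounds h2 (primes_inv_le_half ⟨p, hp'⟩)).1
  have hzero : ∀ u ≤ (1 / 2 : ℝ), -logMertens 1 0 (Real.exp u) = 0 := fun u hu => by
    have h1 : Real.exp u < 2 := by
      rw [← Real.lt_log_iff_exp_lt two_pos]
      linarith [Real.log_two_gt_d9]
    rw [logMertens, Finset.sum_eq_zero, neg_zero]
    intro p hp
    obtain ⟨h2, h3⟩ := Finset.mem_filter.1 hp
    have h4 := (Nat.le_floor_iff (Real.exp_pos u).le).1 (Finset.mem_Ioc.1 h2).2
    have h5 : (2 : ℝ) ≤ p := by exact_mod_cast h3.1.two_le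
    linarith
  have hβ : Tendsto (fun u : ℝ => -logMertens 1 0 (Real.exp u) - Real.log u) atTop (𝓝 (-l)) := by
    refine ((hl.comp Real.tendsto_exp_atTop).neg).congr fun u => ?_
    simp only [Function.comp_apply, Real.log_exp]
    ring
  -- The same quantity tends to −l − γ by the Abelian theorem and to 0 by the comparison with ζ.
  have h1 := tendsto_laplace_add_log hmono hzero hβ
  have h2 := tendsto_tsum_sub_tsum.add tendsto_tsum_neg_log_add_log
  have h3 := tendsto_nhds_unique (h1.congr' ?_) h2
  · linarith
  · filter_upwards [self_mem_nhdsWithin] with δ hδ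
    rw [integral_exp_neg_mul_logMertens hδ]
    ring

end ZetaComparison

end PrimesAP

/-! ### Evaluation of C(q,a) and of log f -/

namespace PrimesAP

open MeasureTheory Set

section Constant

variable (q : ℕ) (a : ℤ)

theorem one_sub_inv_prime_pos {p : ℕ} (hp : p.Prime) : 0 < 1 - 1 / (p : ℝ) := by
  linarith [primes_inv_le_half ⟨p, hp⟩]

theorem mertensPartialProduct_pos (n : ℕ) : 0 < mertensPartialProduct q a n :=
  Finset.prod_pos fun _ hp => zpow_pos (one_sub_inv_prime_pos (Finset.mem_filter.1 hp).2) _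

theorem log_mertensPartialProduct (n : ℕ) : Real.log (mertensPartialProduct q a n) =
    q.totient * logMertens q a n - logMertens 1 0 n := by
  rw [mertensPartialProduct, Real.log_prod fun p hp =>
    (zpow_pos (one_sub_inv_prime_pos (Finset.mem_filter.1 hp).2) _).ne']
  simp only [logMertens, primesUpTo, Nat.floor_natCast]
  rw [Finset.mul_sum, Finset.sum_filter, Finset.sum_filter, Finset.sum_filter,
    ← Finset.sum_sub_distrib]
  refine Finset.sum_congr rfl fun p _ => ?_
  by_cases hp : p.Prime
  · by_cases h : (p : ZMod q) = (a : ZMod q)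
    · simp [hp, h, mertensExponent, Subsingleton.elim (p : ZMod 1) 0]
      ring
    · simp [hp, h, mertensExponent, Subsingleton.elim (p : ZMod 1) 0]
  · simp [hp]

/-- For modulus 1 the class contains all primes, so the general theorem supplies the limit and only
its value has to be identified. -/
theorem tendsto_logMertens_one :
    Tendsto (fun x => logMertens 1 0 x + Real.log (Real.log x)) atTop
      (𝓝 (-Real.eulerMascheroniConstant)) := by
  obtain ⟨l, c, hc, h⟩ := exists_logMertens_eq 1 0 (by simpa using isCoprime_one_right)
  have h1 := tendsto_logMertens 1 0 hc h
  simp only [Nat.totient_one, Nat.cast_one, one_mul] at h1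
  rwa [← logMertens_one_limit h1]

/-- In φ(q)·logMertens(q,a) − logMertens(1,0) the log log terms cancel; the limit is l + γ, and the
factor e^{-γ} leaves e^l. -/
theorem mertensConstant_eq_exp [NeZero q] {l : ℝ}
    (hl : Tendsto (fun x => q.totient * logMertens q a x + Real.log (Real.log x)) atTop (𝓝 l)) :
    mertensConstant q a = Real.exp (l / q.totient) := by
  have h1 : Tendsto (mertensPartialProduct q a) atTop
      (𝓝 (Real.exp (l - -Real.eulerMascheroniConstant))) := by
    refine ((Real.continuous_exp.tendsto _).comp
      ((hl.sub tendsto_logMertens_one).comp tendsto_natCast_atTop_atTop)).congr fun n => ?_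
    simp only [Function.comp_apply]
    rw [add_sub_add_right_eq_sub, ← log_mertensPartialProduct,
      Real.exp_log (mertensPartialProduct_pos q a n)]
  rw [mertensConstant, h1.limUnder_eq, ← Real.exp_add, ← Real.exp_mul]
  congr 1
  ring

/-- By Dirichlet's theorem a single large prime in the class is enough. -/
theorem exists_thetaAP_ge [NeZero q] (hqa : IsCoprime a (q : ℤ)) (B : ℝ) :
    ∀ᶠ x in atTop, B ≤ thetaAP q a x := by
  obtain ⟨p, hp, hp1, hp2⟩ := Nat.forall_exists_prime_gt_and_eq_mod
    (isUnit_intCast_of_isCoprime hqa) ⌈Real.exp B⌉₊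
  filter_upwards [eventually_ge_atTop (p : ℝ)] with x hx
  have h1 : p ∈ primesUpTo q a x := by
    simp only [primesUpTo, Finset.mem_filter, Finset.mem_Ioc]
    exact ⟨⟨hp1.pos, Nat.le_floor hx⟩, hp1, hp2⟩
  have h2 : B ≤ Real.log p := by
    rw [Real.le_log_iff_exp_le (by exact_mod_cast hp1.pos)]
    exact (Nat.le_ceil _).trans (by exact_mod_cast hp.le)
  refine h2.trans (Finset.single_le_sum (f := fun p : ℕ => Real.log p) (fun n hn => ?_) h1)
  exact Real.log_natCast_nonneg n

theorem totient_mul_log_nicolasF [NeZero q] {l x : ℝ}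
    (hl : Tendsto (fun x => q.totient * logMertens q a x + Real.log (Real.log x)) atTop (𝓝 l))
    (hx : 1 < q.totient * thetaAP q a x) :
    q.totient * Real.log (nicolasF q a x) =
      Real.log (Real.log (q.totient * thetaAP q a x)) - l + q.totient * logMertens q a x := by
  have hφ : (0 : ℝ) < q.totient := by
    exact_mod_cast Nat.totient_pos.2 (Nat.pos_of_ne_zero (NeZero.ne q))
  have h1 := Real.log_pos hx
  have h2 : ∀ p ∈ primesUpTo q a x, 1 - 1 / (p : ℝ) ≠ 0 := fun p hp =>
    (one_sub_inv_prime_pos (Finset.mem_filter.1 hp).2.1).ne'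
  have h3 := Real.rpow_pos_of_pos h1 (1 / (q.totient : ℝ))
  rw [nicolasF, mertensConstant_eq_exp q a hl, Real.log_mul (div_pos h3 (Real.exp_pos _)).ne'
    (Finset.prod_ne_zero_iff.2 h2), Real.log_div h3.ne' (Real.exp_pos _).ne', Real.log_exp,
    Real.log_rpow h1, Real.log_prod h2, ← logMertens]
  field_simp

end Constant

/-! ### From one-sided bounds on log f to one-sided bounds on K -/

section Oscillation

theorem exists_strictMono_of_frequently {p : ℝ → Prop} (h : ∃ᶠ x in atTop, p x) :
    ∃ u : ℕ → ℝ, StrictMono u ∧ Tendsto u atTop atTop ∧ ∀ n, p (u n) := by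
  choose f hf hp using frequently_atTop.1 h
  let u : ℕ → ℝ := fun n => Nat.rec (f 0) (fun n y => f (max (y + 1) n)) n
  have hu : ∀ n, u (n + 1) = f (max (u n + 1) n) := fun n => rfl
  refine ⟨u, strictMono_nat_of_lt_succ fun n => ?_, ?_, fun n => ?_⟩
  · rw [hu]
    linarith [le_max_left (u n + 1) (n : ℝ), hf (max (u n + 1) n)]
  · refine (tendsto_add_atTop_iff_nat 1).1 (tendsto_atTop_mono (fun n => ?_)
      tendsto_natCast_atTop_atTop)
    rw [hu]
    exact (le_max_right _ _).trans (hf _)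
  · cases n with
    | zero => exact hp 0
    | succ n => exact hp _

/-- The failure of Ω₊ is needed only for the constant 1. -/
theorem eventually_le_of_not_omegaPlus {F G : ℝ → ℝ} (h : ¬ OmegaPlus F G) :
    ∀ᶠ x in atTop, F x ≤ G x := by
  by_contra hc
  obtain ⟨u, h1, h2, h3⟩ := exists_strictMono_of_frequently (not_eventually.1 hc)
  exact h ⟨1, one_pos, u, h1, h2, fun n => by simpa using h3 n⟩

theorem eventually_ge_of_not_omegaMinus {F G : ℝ → ℝ} (h : ¬ OmegaMinus F G) :
    ∀ᶠ x in atTop, -G x ≤ F x := by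
  by_contra hc
  obtain ⟨u, h1, h2, h3⟩ := exists_strictMono_of_frequently (not_eventually.1 hc)
  exact h ⟨1, one_pos, u, h1, h2, fun n => by simpa using h3 n⟩

/-- Concavity of log log: the graph lies below its tangent at x. -/
theorem log_log_le_tangent {u x : ℝ} (hu : 1 < u) (hx : 1 < x) :
    Real.log (Real.log u) ≤ Real.log (Real.log x) + (u - x) / (x * Real.log x) := by
  have hlog : ∀ {s t : ℝ}, 0 < s → 0 < t → Real.log s ≤ Real.log t + (s - t) / t := by
    intro s t hs ht
    have h := Real.log_le_sub_one_of_pos (div_pos hs ht)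
    rw [Real.log_div hs.ne' ht.ne'] at h
    rw [sub_div, div_self ht.ne']
    linarith
  have hlx := Real.log_pos hx
  have h1 := hlog (s := u) (t := x) (by linarith) (by linarith)
  have h2 := hlog (Real.log_pos hu) hlx
  have h3 : (Real.log u - Real.log x) / Real.log x ≤ (u - x) / (x * Real.log x) := by
    rw [← div_div]
    exact div_le_div_of_nonneg_right (by linarith) hlx.le
  linarith

variable {S : ℝ → ℝ} {C c₀ x₀ b c φ : ℝ}

/-- At a point where `S < 0` the antiderivative is dominated by its value at a later maximum,
where `S` is nonnegative but small because its upward jumps are. -/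
theorem weightedAntideriv_le_of_neg (hSm : Measurable S) (hS : ∀ t ≥ 2, |S t| ≤ C * t)
    (hx₀ : 3 ≤ x₀) (hSc : ∀ x ≥ x₀, ContinuousWithinAt S (Ici x) x)
    (hjump : ∀ x ≥ x₀, ∀ t, x - 1 < t → t < x → S x - φ * Real.log x ≤ S t)
    (hK0 : Tendsto (weightedAntideriv S) atTop (𝓝 c₀)) (hb0 : 0 < b) (hb1 : b < 1) (hc : 0 ≤ c)
    (hφ : 0 ≤ φ)
    (hpos : ∀ x ≥ x₀, 0 ≤ S x →
      weightedAntideriv S x - c₀ ≤ S x / (x * Real.log x) + c * x ^ (-b))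
    {y : ℝ} (hy : x₀ ≤ y) (hSy : S y < 0) : weightedAntideriv S y - c₀ ≤ (c + φ) * y ^ (-b) := by
  by_contra! hlt
  have hKc := continuous_weightedAntideriv hSm hS
  have hy0 : 0 < y := by linarith
  have hgt : c₀ < weightedAntideriv S y := by
    have : 0 ≤ (c + φ) * y ^ (-b) := by positivity
    linarith
  -- K(y) exceeds the limit c₀, so K falls below K(y) past some Z and its maximum on [y, ∞) is
  -- attained in [y, Z].
  obtain ⟨Z, hZ⟩ := ((hK0.eventually (eventually_lt_nhds hgt)).and
    (eventually_ge_atTop y)).exists_forall_of_atTop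
  have hyZ := (hZ Z le_rfl).2
  obtain ⟨X, hX, hmax⟩ := isCompact_Icc.exists_isMaxOn (nonempty_Icc.2 hyZ) hKc.continuousOn
  have hmax' : ∀ t ≥ y, weightedAntideriv S t ≤ weightedAntideriv S X := fun t ht => by
    rcases le_total t Z with h | h
    · exact hmax ⟨ht, h⟩
    · exact (hZ t h).1.le.trans (hmax ⟨le_rfl, hyZ⟩)
  have hXx : x₀ ≤ X := hy.trans hX.1
  -- a maximum of the antiderivative to its right forces `S ≥ 0`
  have hnonneg : ∀ z ≥ x₀, (∀ t ≥ z, weightedAntideriv S t ≤ weightedAntideriv S z) → 0 ≤ S z := by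
    intro z hz hzmax
    have h1 := weightedAntideriv_hasDerivWithinAt hSm hS (by linarith) (hSc z hz)
    have h2 : IsMaxOn (weightedAntideriv S) (Ici z) z := fun t ht => hzmax t ht
    have h3 : -(S z * logWeight z) ≤ 0 := by
      rw [hasDerivWithinAt_iff_tendsto_slope, Ici_sdiff_left] at h1
      refine le_of_tendsto h1 ?_
      filter_upwards [self_mem_nhdsWithin] with t ht
      have ht' : z < t := ht
      rw [slope_def_field]
      exact div_nonpos_of_nonpos_of_nonneg (sub_nonpos.2 (h2 ht'.le)) (sub_nonneg.2 ht'.le)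
    have h4 := logWeight_pos (by linarith : 2 ≤ z)
    by_contra! h5
    nlinarith [mul_neg_of_neg_of_pos h5 h4]
  have hSX := hnonneg X hXx fun t ht => hmax' t (hX.1.trans ht)
  have hyX : y < X := lt_of_le_of_ne hX.1 fun h => by
    rw [← h] at hSX
    linarith
  have hlX := half_le_log (by linarith : 2 ≤ X)
  -- Otherwise the jump bound makes S positive just left of X, so K decreases strictly into X,
  -- against maximality.
  have hSX' : S X ≤ φ * Real.log X := by
    by_contra! h
    set t := max y (X - 1 / 2)
    have ht1 : y ≤ t := le_max_left _ _
    have ht2 : X - 1 / 2 ≤ t := le_max_right _ _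
    have ht3 : t < X := max_lt hyX (by linarith)
    have ht4 : 2 ≤ t := by linarith
    have h1 := weightedAntideriv_sub hSm hS ht4 ht3.le
    have h2 : 0 < ∫ s in t..X, S s * logWeight s := by
      refine intervalIntegral.intervalIntegral_pos_of_pos_on ?_ (fun s hs => ?_) ht3
      · refine (intervalIntegrable_weight hSm hS t X).congr fun s hs => ?_
        rw [uIoc_of_le ht3.le] at hs
        exact indicator_of_mem (show s ∈ Ici (2 : ℝ) from ht4.trans hs.1.le) _
      · have := hjump X hXx s (by linarith [hs.1]) hs.2
        exact mul_pos (by linarith) (logWeight_pos (ht4.trans hs.1.le))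
    have h3 := hmax' t ht1
    linarith
  have hX0 : 0 < X := by linarith
  have h1 := hpos X hXx hSX
  have h2 : S X / (X * Real.log X) ≤ φ * X ^ (-b) := by
    have h3 : X ^ (-1 : ℝ) ≤ X ^ (-b) :=
      Real.rpow_le_rpow_of_exponent_le (by linarith) (by linarith)
    refine le_trans ?_ (mul_le_mul_of_nonneg_left h3 hφ)
    rw [Real.rpow_neg_one, ← div_eq_mul_inv, div_le_div_iff₀ (by positivity) hX0]
    nlinarith [mul_le_mul_of_nonneg_right hSX' hX0.le]
  have h3 := hmax' y le_rfl
  have h4 : X ^ (-b) ≤ y ^ (-b) := Real.rpow_le_rpow_of_nonpos hy0 hX.1 (by linarith)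
  have h5 := mul_le_mul_of_nonneg_left h4 (by linarith : 0 ≤ c + φ)
  linarith

/-- Compare x(K − c₀) with Bx^{1-b}. At a contact point S ≥ 0, and the unwanted S/(x log x) in
`hpos` is outweighed by the term −xSw in the derivative of x(K − c₀), so the curve cannot cross. -/
theorem exists_weightedAntideriv_le (hSm : Measurable S) (hS : ∀ t ≥ 2, |S t| ≤ C * t)
    (hx₀ : 3 ≤ x₀) (hSc : ∀ x ≥ x₀, ContinuousWithinAt S (Ici x) x)
    (hjump : ∀ x ≥ x₀, ∀ t, x - 1 < t → t < x → S x - φ * Real.log x ≤ S t)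
    (hK0 : Tendsto (weightedAntideriv S) atTop (𝓝 c₀)) (hb0 : 0 < b) (hb1 : b < 1) (hc : 0 ≤ c)
    (hφ : 0 ≤ φ)
    (hpos : ∀ x ≥ x₀, 0 ≤ S x →
      weightedAntideriv S x - c₀ ≤ S x / (x * Real.log x) + c * x ^ (-b)) :
    ∃ B, ∀ x ≥ x₀, weightedAntideriv S x - c₀ ≤ B * x ^ (-b) := by
  have hKc := continuous_weightedAntideriv hSm hS
  have hx00 : 0 < x₀ := by linarith
  -- The three conditions exclude S < 0 at a contact point, make the slope of the barrier strictly
  -- larger there, and give the inequality at x₀.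
  obtain ⟨B, hB1, hB2, hB3⟩ : ∃ B, c + φ < B ∧ c < B * (1 - b) ∧
      weightedAntideriv S x₀ - c₀ ≤ B * x₀ ^ (-b) := by
    have h1 := (eventually_gt_atTop (c + φ)).and ((((tendsto_id (α := ℝ)).atTop_mul_const
      (by linarith : 0 < 1 - b)).eventually (eventually_gt_atTop c)).and
      (((tendsto_id (α := ℝ)).atTop_mul_const (Real.rpow_pos_of_pos hx00 (-b))).eventually
        (eventually_ge_atTop (weightedAntideriv S x₀ - c₀))))
    obtain ⟨B, h⟩ := h1.exists
    exact ⟨B, h.1, h.2.1, h.2.2⟩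
  refine ⟨B, fun x hx => ?_⟩
  have hx0 : 0 < x := by linarith
  have hmul : ∀ t : ℝ, 0 < t → t ^ (1 - b) = t * t ^ (-b) := fun t ht => by
    rw [sub_eq_add_neg, Real.rpow_add ht, Real.rpow_one]
  have h := image_le_of_deriv_right_lt_deriv_boundary' (a := x₀) (b := x)
    (f := fun t => t * (weightedAntideriv S t - c₀))
    (f' := fun t => 1 * (weightedAntideriv S t - c₀) + t * -(S t * logWeight t))
    (B := fun t => B * t ^ (1 - b)) (B' := fun t => B * ((1 - b) * t ^ (1 - b - 1)))
    (by fun_prop)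
    (fun t ht => (hasDerivWithinAt_id t _).mul
      ((weightedAntideriv_hasDerivWithinAt hSm hS (by linarith [ht.1]) (hSc t ht.1)).sub_const c₀))
    (by
      rw [hmul x₀ hx00]
      nlinarith [mul_le_mul_of_nonneg_left hB3 hx00.le])
    (fun t ht => ((Real.continuousAt_rpow_const _ _ (Or.inl (by linarith [ht.1]))).const_mul
      B).continuousWithinAt)
    (fun t ht => ((Real.hasDerivAt_rpow_const (Or.inl (by linarith [ht.1]))).const_mul
      B).hasDerivWithinAt)
    (fun t ht heq => by
      have ht0 : 0 < t := by linarith [ht.1]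
      have hl := half_le_log (by linarith [ht.1] : 2 ≤ t)
      have hp := Real.rpow_pos_of_pos ht0 (-b)
      rw [hmul t ht0, mul_left_comm] at heq
      have hK := mul_left_cancel₀ ht0.ne' heq
      have hS0 : 0 ≤ S t := by
        by_contra! hneg
        have h1 := weightedAntideriv_le_of_neg hSm hS hx₀ hSc hjump hK0 hb0 hb1 hc hφ hpos ht.1 hneg
        rw [hK] at h1
        nlinarith [mul_lt_mul_of_pos_right hB1 hp]
      have h1 := hpos t ht.1 hS0
      have h2 : S t / (t * Real.log t) ≤ t * (S t * logWeight t) := by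
        have : t * (S t * logWeight t) = S t / (t * Real.log t) * ((1 + Real.log t) / Real.log t) := by
          unfold logWeight
          field_simp
        rw [this]
        refine le_mul_of_one_le_right (by positivity) ?_
        rw [one_le_div (by linarith)]
        linarith
      have h3 : t ^ (1 - b - 1) = t ^ (-b) := by
        congr 1
        ring
      rw [h3, ← mul_assoc]
      nlinarith [mul_lt_mul_of_pos_right hB2 hp])
    (right_mem_Icc.2 hx)
  rw [hmul x hx0, mul_left_comm] at h
  exact le_of_mul_le_mul_left h hx0

/-- At most one integer lies in (t, x], so θ gains at most log x, while −x < −t. -/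
theorem thetaError_jump (q : ℕ) (a : ℤ) {x t : ℝ} (hx : 3 ≤ x) (h1 : x - 1 < t) (h2 : t < x) :
    thetaError q a x - q.totient * Real.log x ≤ thetaError q a t := by
  have h : thetaAP q a x - Real.log x ≤ thetaAP q a t := by
    rw [thetaAP_eq_sum, thetaAP_eq_sum]
    have hlog : 0 ≤ Real.log x := Real.log_nonneg (by linarith)
    have ht0 : 0 ≤ t := by linarith
    have h3 : ⌊t⌋₊ ≤ ⌊x⌋₊ := Nat.floor_le_floor h2.le
    have h4 : ⌊x⌋₊ ≤ ⌊t⌋₊ + 1 := by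
      have := Nat.floor_le_floor (by linarith : x ≤ t + 1)
      rwa [Nat.floor_add_one ht0] at this
    rcases h3.eq_or_lt with h5 | h5
    · rw [h5]
      linarith
    · have h6 : ⌊x⌋₊ = ⌊t⌋₊ + 1 := by omega
      rw [h6, Finset.sum_Icc_succ_top (by omega), ← h6]
      have h7 : primeLog q a ⌊x⌋₊ ≤ Real.log x := by
        unfold primeLog
        split_ifs with hp
        · exact Real.log_le_log (by exact_mod_cast hp.1.pos) (Nat.floor_le (by linarith))
        · exact hlog
      linarith
  have := mul_le_mul_of_nonneg_left h (Nat.cast_nonneg (α := ℝ) q.totient)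
  unfold thetaError
  linarith

end Oscillation

/-! ### Oscillation of log f -/

section Main

/-- A prime square in the class of a would exhibit a as a square, so cubes are the first powers to
contribute. -/
theorem properPowers_abscissa_le_third {q : ℕ} {a : ℤ} (ha : ¬ IsSquare (a : ZMod q)) :
    LSeries.abscissaOfAbsConv (fun n => (properPowers (a : ZMod q) n : ℂ)) ≤
      ((1 / 3 : ℝ) : EReal) := by
  refine abscissaOfAbsConv_properPowers_le (m := 3) (by norm_num) (fun p k h0 h1 h2 => ?_)
    (by norm_num)
  obtain rfl : k = 2 := by omega
  intro h
  exact ha ⟨(p : ZMod q), by rw [← h, Nat.cast_pow, sq]⟩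

variable {q : ℕ} [NeZero q] {a : ℤ}

/-- A one-sided bound for the antiderivative rules out singularities in `Re s > 1 - b`. -/
theorem not_isSingularity_of_one_sided (hqa : IsCoprime a (q : ℤ)) {b c c₀ ε : ℝ} (hb : 0 < b)
    (hb1 : b < 1) (hε : ε * ε = 1)
    (habs : LSeries.abscissaOfAbsConv (fun n => (properPowers (a : ZMod q) n : ℂ)) ≤
      ((1 - b : ℝ) : EReal))
    (hreal : ∀ σ : ℝ, 1 - b < σ → σ < 1 → ¬ IsSingularity (scriptL q a) σ)
    (hK0 : Tendsto (weightedAntideriv (thetaError q a)) atTop (𝓝 c₀))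
    (hA : ∀ᶠ x in atTop, ε * (weightedAntideriv (thetaError q a) x - c₀) ≤ c * x ^ (-b))
    {ρ : ℂ} (hρ : 1 - b < ρ.re) (hρ1 : ρ.re < 1) : ¬ IsSingularity (scriptL q a) ρ := by
  obtain ⟨x₀, hx₀⟩ := (hA.and (eventually_ge_atTop 2)).exists_forall_of_atTop
  have hx2 := (hx₀ x₀ le_rfl).2
  have hSm := measurable_thetaError q a
  have hS := bound_thetaError q a
  have hKc := continuous_weightedAntideriv hSm hS
  have hKl := logBounded_weightedAntideriv hSm hS
  have hne : ∀ z : ℂ, z.re < b → z ≠ 1 := by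
    rintro z hz rfl
    rw [Complex.one_re] at hz
    linarith
  have hz : (1 - ρ).re < b := by
    rw [Complex.sub_re, Complex.one_re]
    linarith
  have hρne : ρ ≠ 1 := by
    rintro rfl
    simp at hρ1
  rw [not_isSingularity_iff q a hqa hρne]
  have h := exists_analyticAt_of_one_sided (K := fun x => weightedAntideriv (thetaError q a) x - c₀)
    (P := transDen q) (Y := transNum q a x₀) (c := c) (ρ := 1 - ρ) hSm hx2 hS
    (hKc.measurable.sub_const c₀) (hKc.sub continuous_const).continuousOn
    (by
      obtain ⟨B, hB⟩ := hKl
      refine ⟨B + |c₀|, fun t ht => (abs_sub _ _).trans ?_⟩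
      have h1 := hB t (lt_of_le_of_lt hx2 ht)
      have h2 := half_le_log (hx2.trans ht.le)
      nlinarith [abs_nonneg c₀])
    (fun x hx => (weightedAntideriv_hasDerivWithinAt hSm hS (hx2.trans hx)
      (continuousWithinAt_thetaError q a (by linarith))).sub_const c₀)
    (by simpa using hK0.sub_const c₀) hb hε (fun x hx => (hx₀ x hx.le).1)
    differentiable_transDen.differentiableOn (exists_transDen_ne_zero q hb)
    (differentiableOn_transNum habs)
    (fun z hz => transDen_mul_tailMellin hqa (by linarith) hz)
    (fun τ hτ0 hτb => by
      have hτ : (τ : ℂ).re < b := by simpa using hτb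
      rw [regular_trans_iff habs hτ (hne _ hτ)]
      -- The point τ = 0 is s = 1, where numL/prodL is regular and `hreal` makes no assumption.
      rcases hτ0.eq_or_lt with h0 | h0
      · rw [← h0, Complex.ofReal_zero, sub_zero]
        exact exists_regular_at_one q a
      · have h1 : ((1 - τ : ℝ) : ℂ) ≠ 1 := by
          rw [Ne, Complex.ofReal_eq_one]
          linarith
        have h2 := (not_isSingularity_iff q a hqa h1).1 (hreal (1 - τ) (by linarith) (by linarith))
        simpa using h2)
    hz
  have h2 := (regular_trans_iff habs hz (hne _ hz)).1 h
  simpa using h2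

/-- Failure of either Ω₊ or Ω₋ would give a one-sided bound of order x^{-b} for K − c₀ and so
exclude the singularity ρ. -/
theorem omegaPlusMinus_log_nicolasF (hqa : IsCoprime a (q : ℤ)) {b : ℝ} (hb : 0 < b)
    (hb1 : b < 1)
    (habs : LSeries.abscissaOfAbsConv (fun n => (properPowers (a : ZMod q) n : ℂ)) ≤
      ((1 - b : ℝ) : EReal))
    (hreal : ∀ σ : ℝ, 1 - b < σ → σ < 1 → ¬ IsSingularity (scriptL q a) σ)
    {ρ : ℂ} (hρ : 1 - b < ρ.re) (hρ1 : ρ.re < 1) (hsing : IsSingularity (scriptL q a) ρ) :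
    OmegaPlusMinus (fun x => Real.log (nicolasF q a x)) (fun x => x ^ (-b)) := by
  obtain ⟨l, c₀, hc₀, hM⟩ := exists_logMertens_eq q a hqa
  have hl := tendsto_logMertens q a hc₀ hM
  have hφ : (1 : ℝ) ≤ q.totient := by
    exact_mod_cast Nat.totient_pos.2 (Nat.pos_of_ne_zero (NeZero.ne q))
  have hev : ∀ᶠ x in atTop, 3 ≤ x ∧ 1 < q.totient * thetaAP q a x := by
    filter_upwards [eventually_ge_atTop 3, exists_thetaAP_ge q a hqa 2] with x hx h2
    exact ⟨hx, by nlinarith⟩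
  have hinv : ∀ x : ℝ, 3 ≤ x → 4 * (q.totient : ℝ) / x ≤ 4 * q.totient * x ^ (-b) := fun x hx => by
    rw [div_eq_mul_inv, ← Real.rpow_neg_one]
    exact mul_le_mul_of_nonneg_left
      (Real.rpow_le_rpow_of_exponent_le (by linarith) (by linarith)) (by positivity)
  constructor
  · by_contra hΩ
    obtain ⟨x₀, hx₀⟩ := (hev.and (eventually_le_of_not_omegaPlus hΩ)).exists_forall_of_atTop
    have hx3 := (hx₀ x₀ le_rfl).1.1
    obtain ⟨B, hB⟩ := exists_weightedAntideriv_le (c := q.totient) (φ := q.totient)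
      (measurable_thetaError q a) (bound_thetaError q a) hx3
      (fun x hx => continuousWithinAt_thetaError q a (by linarith))
      (fun x hx t h1 h2 => thetaError_jump q a (hx3.trans hx) h1 h2) hc₀ hb hb1
      (by positivity) (by positivity) (fun x hx hSx => by
        obtain ⟨⟨hx3', hθ⟩, hF⟩ := hx₀ x hx
        obtain ⟨r, hr0, hr1, hr⟩ := hM x (by linarith)
        have h1 := totient_mul_log_nicolasF q a hl hθ
        have h2 := mul_le_mul_of_nonneg_left hF (by linarith : (0 : ℝ) ≤ q.totient)
        -- S ≥ 0 means φ(q)θ ≥ x. With r ≥ 0 dropped, the bound on log f becomes the hypothesis of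
        -- the comparison argument.
        have h3 : Real.log (Real.log x) ≤ Real.log (Real.log (q.totient * thetaAP q a x)) := by
          unfold thetaError at hSx
          refine Real.log_le_log (Real.log_pos (by linarith)) (Real.log_le_log (by linarith) ?_)
          linarith
        linarith)
    refine not_isSingularity_of_one_sided (ε := 1) (c := B) hqa hb hb1 (by norm_num) habs hreal hc₀
      ?_ hρ hρ1 hsing
    filter_upwards [eventually_ge_atTop x₀] with x hx
    rw [one_mul]
    exact hB x hx
  · by_contra hΩ
    -- The constant is φ(q) from the assumed bound on log f plus 4φ(q) from r; the tangent
    -- inequality disposes of the bracket.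
    refine not_isSingularity_of_one_sided (ε := -1) (c := 5 * q.totient) hqa hb hb1 (by norm_num)
      habs hreal hc₀ ?_ hρ hρ1 hsing
    filter_upwards [hev, eventually_ge_of_not_omegaMinus hΩ] with x hx hF
    obtain ⟨hx3, hθ⟩ := hx
    obtain ⟨r, hr0, hr1, hr⟩ := hM x (by linarith)
    have h1 := totient_mul_log_nicolasF q a hl hθ
    have h2 := mul_le_mul_of_nonneg_left hF (by linarith : (0 : ℝ) ≤ q.totient)
    have h3 := log_log_le_tangent hθ (by linarith : 1 < x)
    have h4 := hinv x hx3
    have h5 : q.totient * thetaAP q a x - x = thetaError q a x := rfl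
    rw [h5] at h3
    linarith

end Main

end PrimesAP

theorem mainTheorem2 (q : ℕ) [NeZero q] (a : ℤ) (hqa : IsCoprime a (q : ℤ)) :
    (¬ PrimesAP.SingularityHypothesis q a →
      ∀ b : ℝ, 1 - PrimesAP.bigTheta q a < b → b < 1 / 2 →
        (∀ σ : ℝ, 1 - b < σ → σ < 1 →
          ¬ PrimesAP.IsSingularity (PrimesAP.scriptL q a) (σ : ℂ)) →
        PrimesAP.OmegaPlusMinus (fun x => Real.log (PrimesAP.nicolasF q a x))
          (fun x => x ^ (-b))) ∧
    (¬ IsSquare (a : ZMod q) →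
      PrimesAP.SingularityHypothesis q a →
      (∃ ρ : ℂ, ρ.re = 1 / 2 ∧ PrimesAP.IsSingularity (PrimesAP.scriptL q a) ρ) →
      ¬ PrimesAP.IsSingularity (PrimesAP.scriptL q a) (1 / 2 : ℂ) →
      ∀ b : ℝ, 1 / 2 < b → b < 2 / 3 →
        PrimesAP.OmegaPlusMinus (fun x => Real.log (PrimesAP.nicolasF q a x))
          (fun x => x ^ (-b))) := by
  constructor
  · intro hSH b hb1 hb2 hreal
    have hne : (Complex.re '' PrimesAP.stripSingularities q a).Nonempty := by
      rw [PrimesAP.SingularityHypothesis] at hSH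
      push Not at hSH
      obtain ⟨ρ, hρ, -⟩ := hSH
      exact ⟨ρ.re, ρ, hρ, rfl⟩
    -- As 1 − b < Θ, some singularity in the strip lies strictly to the right of 1 − b.
    obtain ⟨_, ⟨ρ, ⟨-, hρ1, hsing⟩, rfl⟩, hρ⟩ :=
      exists_lt_of_lt_csSup hne (by rw [← PrimesAP.bigTheta]; linarith :
        1 - b < sSup (Complex.re '' PrimesAP.stripSingularities q a))
    refine PrimesAP.omegaPlusMinus_log_nicolasF hqa (by linarith) (by linarith)
      (PrimesAP.properPowers_abscissa_le_half.trans ?_) hreal hρ hρ1 hsing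
    exact EReal.coe_le_coe_iff.2 (by linarith)
  · rintro ha hSH ⟨ρ, hρ, hsing⟩ hhalf b hb1 hb2
    refine PrimesAP.omegaPlusMinus_log_nicolasF hqa (by linarith) (by linarith)
      ((PrimesAP.properPowers_abscissa_le_third ha).trans ?_) (fun σ h1 h2 h3 => ?_)
      (by linarith) (by linarith) hsing
    · exact EReal.coe_le_coe_iff.2 (by linarith)
    · have h4 := hSH σ ⟨by rw [Complex.ofReal_re]; linarith, by rwa [Complex.ofReal_re], h3⟩
      rw [Complex.ofReal_re] at h4
      rw [h4] at h3
      exact hhalf (by simpa using h3)
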